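/- **Setting.** For $\eta\in\mathbb R^3$ let $\mathscr E(\eta)$ be the antisymmetric $3\times3$ matrix with $\mathscr E(\eta)v=\eta\times v$. Let $\xi\in\mathbb R^3$, $|\xi|=1$, let $\alpha,\beta,\delta>0$, and let $b=(b_1,b_2,b_3)$ be a basis of $\mathbb R^3$ with period cell $Y=\{\sum_i t_ib_i:0\le t_i<1\}$ (for example the canonical basis, so that $Y$ is the unit cube, or an orthonormal basis containing $\xi$). For $|h|<\delta$ let $\sigma(h)$ be a measurable matrix field on $\mathbb R^3$ such that $\sigma(h)(y)$ depends only on $\xi\cdot y$, is $b_i$-periodic in $y$ for $i=1,2,3$, is invertible for a.e. $y$, and satisfies for a.e. $y$ and all $\zeta\in\mathbb R^3$ $$\sigma(h)(y)\zeta\cdot\zeta\ge\alpha|\zeta|^2,\qquad \sigma(h)(y)^{-1}\zeta\cdot\zeta\ge\beta^{-1}|\zeta|^2 .$$ Assume that, as $h\to0$, $$\sigma(h)(y)=a(\xi\cdot y)\,I_3+s(\xi\cdot y)\,\mathscr E(h)+\mathscr N(h,h)(\xi\cdot y)+o_{L^\infty}(|h|^2),$$ where $a:\mathbb R\to[\alpha,\beta]$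 and $s:\mathbb R\to\mathbb R$ are measurable and $1$-periodic, $\mathscr N$ is bilinear, and all coefficients of the expansion are in $L^\infty$. Put $r:=-s/a^2$. Write $\langle\cdot\rangle$ for the average over $Y$ of a function of $y$, and $\langle f\rangle=\int_0^1 f(t)\,dt$ for a $1$-periodic function $f$ of one variable. For $|h|<\delta$ let $P(h)=DU(h)=[\partial U_j/\partial y_i]_{ij}$, where $U(h)\in H^1_{\rm loc}(\mathbb R^3)^3$ solves $\mathrm{Div}(\sigma(h)DU(h))=0$ in $\mathscr D'(\mathbb R^3)$ (columnwise divergence) with $y\mapsto U(h)(y)-y$ periodic with respect to $b$. Put $\sigma_*(h)=\langle\sigma(h)P(h)\rangle$, $\sigma=\sigma(0)$, $P^0=P(0)$, $\sigma_*=\sigma_*(0)$. Define the Hall matrix $R$ and the magneto-resistance $\mathscr M$ (local), and $R_*$ and $\mathscr M_*$ (effective), with $\mathscr M,\mathscr M_*$ bilinear, by $$\sigma(h)^{-1}=\sigma^{-1}+\mathscr E(Rh)+\mathscr M(h,h)+o_{L^\infty}(|h|^2),\qquad \sigma_*(h)^{-1}=\sigma_*^{-1}+\mathscr E(R_*h)+\mathscr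 M_*(h,h)+o(|h|^2),$$ the coefficients of the first expansion being in $L^\infty$. For $h\in\mathbb R^3$ let $$\mathscr D(h,h)=\sigma_*\,\mathscr M_*(h,h)\,\sigma_*-\big\langle(\sigma P^0)^{\rm T}\mathscr M(h,h)(\sigma P^0)\big\rangle .$$ **Proposition.** The correctors $P(h)$ exist, both expansions exist, and the first holds with $R=r(\xi\cdot y)I_3$. Whatever the choice of $P$, $R$, $\mathscr M$, $R_*$, $\mathscr M_*$ as above, the following holds for every $h\in\mathbb R^3$, with $$d_1=\langle a^{-1}\rangle^{-2}\big[\langle ar^2\rangle-\langle a\rangle^{-1}\langle ar\rangle^2\big],\qquad d_2=\langle a^3r^2\rangle-\langle a\rangle^{-1}\langle a^2r\rangle^2,$$ $$d_3=\langle a^{-1}\rangle^{-1}\big[\langle a^2r^2\rangle-\langle a\rangle^{-1}\langle ar\rangle\langle a^2r\rangle\big].$$ * If $h$ is not parallel to $\xi$, then $\big(\xi,\frac{\xi\times(\xi\times h)}{|h\times\xi|},\frac{h\times\xi}{|h\times\xi|}\big)$ is an orthonormal basis and, for the matrix $O(h)$ with these columns, $$O(h)^{\rm T}\mathscr D(h,h)O(h)=\begin{pmatrix}d_1|h\times\xi|^2&d_3(h\cdot\xi)|h\times\xi|&0\\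 d_3(h\cdot\xi)|h\times\xi|&d_2(h\cdot\xi)^2&0\\0&0&d_2(h\cdot\xi)^2\end{pmatrix}.$$ * If $h$ is parallel to $\xi$ (in particular if $h=0$), then for every orthonormal basis $(\xi,u,v)$ and the matrix $O$ with these columns, $$O^{\rm T}\mathscr D(h,h)O=d_2(h\cdot\xi)^2\begin{pmatrix}0&0&0\\0&1&0\\0&0&1\end{pmatrix}.$$ * $\mathscr D(h,h)=0$ if and only if one of the following holds ("constant" means a.e. equal to a constant): $h=0$; or $h\ne0$ is orthogonal to $\xi$ and $r$ is constant; or $h\ne0$ is parallel to $\xi$ and $ar$ is constant; or $h\neq 0$ is neither parallel nor orthogonal to $\xi$ and both $ar$ and $r$ are constant. -/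

import Mathlib

open MeasureTheory Topology
open scoped Matrix ContDiff

namespace HallLaminate

/-- Three-dimensional Euclidean space. -/
abbrev V := EuclideanSpace ℝ (Fin 3)

/-- Real `3 × 3` matrices. -/
abbrev Mat := Matrix (Fin 3) (Fin 3) ℝ

/-- The cross product `u × v` in Euclidean space. -/
noncomputable def cross (u v : V) : V :=
  WithLp.toLp 2 (crossProduct (WithLp.ofLp u) (WithLp.ofLp v))

/-- The antisymmetric matrix `𝓔(η)` of the map `v ↦ η × v`. -/
def crossMat (η : V) : Mat :=
  !![0, -η 2, η 1; η 2, 0, -η 0; -η 1, η 0, 0]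

/-- The product `R h` of a matrix and a vector of Euclidean space. -/
noncomputable def mulV (R : Mat) (h : V) : V := WithLp.toLp 2 (R *ᵥ WithLp.ofLp h)

/-- The matrix whose columns are the three given vectors. -/
def colMat (v : Fin 3 → V) : Mat := Matrix.of fun i j => v j i

/-- `A ∈ 𝓜(α, β)`: a measurable field of invertible matrices with `A ζ · ζ ≥ α |ζ|²` and
`A⁻¹ ζ · ζ ≥ β⁻¹ |ζ|²` for all `ζ`, almost everywhere. -/
structure MemM (α β : ℝ) (A : V → Mat) : Prop where
  measurable : ∀ i j, Measurable fun y => A y i j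
  bounds : ∀ᵐ y : V, IsUnit (A y).det ∧
    (∀ ζ : V, α * ‖ζ‖ ^ 2 ≤ inner ℝ (mulV (A y) ζ) ζ) ∧
    (∀ ζ : V, β⁻¹ * ‖ζ‖ ^ 2 ≤ inner ℝ (mulV (A y)⁻¹ ζ) ζ)

/-- The average `⟨F⟩` over the period cell `{∑ tᵢ bᵢ : 0 ≤ tᵢ < 1}` of the lattice spanned by
the basis `b`, entry by entry.  For the canonical basis the cell is the unit cube. -/
noncomputable def cellAvg (b : Module.Basis (Fin 3) ℝ V) (F : V → Mat) : Mat :=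
  Matrix.of fun i j => ⨍ y in ZSpan.fundamentalDomain b, F y i j

/-- Local square integrability. -/
def MemL2Loc (f : V → ℝ) : Prop :=
  ∀ K : Set V, IsCompact K → MemLp f 2 (volume.restrict K)

/-- Test functions: smooth with compact support. -/
def IsTest (φ : V → ℝ) : Prop := ContDiff ℝ ∞ φ ∧ HasCompactSupport φ

/-- The partial derivative `∂φ/∂yᵢ`. -/
noncomputable def pd (i : Fin 3) (φ : V → ℝ) (y : V) : ℝ :=
  fderiv ℝ φ y (EuclideanSpace.single i 1)

/-- `P` is the weak gradient `DU = [∂Uⱼ/∂yᵢ]ᵢⱼ` of `U`, and `U ∈ H¹_loc`. -/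
structure IsWeakGrad (U : V → V) (P : V → Mat) : Prop where
  l2_fun : ∀ j, MemL2Loc fun y => U y j
  l2_grad : ∀ i j, MemL2Loc fun y => P y i j
  weak : ∀ i j, ∀ φ : V → ℝ, IsTest φ →
    ∫ y, U y j * pd i φ y = - ∫ y, P y i j * φ y

/-- `Div Σ = 0` in the sense of distributions, where `(Div Σ)ⱼ = ∑ᵢ ∂Σᵢⱼ/∂yᵢ`. -/
def DivFree (S : V → Mat) : Prop :=
  ∀ j, ∀ φ : V → ℝ, IsTest φ → ∫ y, ∑ i, S y i j * pd i φ y = 0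

/-- `P = DU` for a solution `U ∈ H¹_loc` of the cell problem of the conductivity `A`:
`Div (A DU) = 0` in the sense of distributions, and `y ↦ U y - y` is `b`-periodic. -/
def IsCorrector (b : Module.Basis (Fin 3) ℝ V) (A P : V → Mat) : Prop :=
  ∃ U : V → V, IsWeakGrad U P ∧
    (∀ i, ∀ᵐ y : V, U (y + b i) - (y + b i) = U y - y) ∧
    DivFree fun y => A y * P y

/-- The homogenized conductivity `σ_* = ⟨σ P⟩`. -/
noncomputable def effCond (b : Module.Basis (Fin 3) ℝ V) (A P : V → Mat) : Mat :=
  cellAvg b fun y => A y * P y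

/-- Second-order expansion `F(h) = F₀ + F₁(h) + F₂(h) + o(|h|²)` in `L^∞(ℝ³)^{3×3}` as
`h → 0`, with coefficients in `L^∞`. -/
structure HasLinftyExpansion (F : V → V → Mat) (F0 : V → Mat) (F1 F2 : V → V → Mat) :
    Prop where
  bdd0 : ∀ i j, MemLp (fun y => F0 y i j) ⊤ volume
  bdd1 : ∀ h i j, MemLp (fun y => F1 h y i j) ⊤ volume
  bdd2 : ∀ h i j, MemLp (fun y => F2 h y i j) ⊤ volume
  remainder : ∀ ε : ℝ, 0 < ε → ∀ᶠ h : V in 𝓝 0, ∀ᵐ y : V, ∀ i j,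
    |(F h y - F0 y - F1 h y - F2 h y) i j| ≤ ε * ‖h‖ ^ 2

/-- `R` is the local Hall matrix and `M` the local magneto-resistance tensor of the perturbed
conductivity `σ`: the resistivity `ρ(h) = σ(h)⁻¹` satisfies
`ρ(h) = ρ(0) + 𝓔(R h) + M(h,h) + o(|h|²)` in `L^∞`. -/
def IsLocalHall (σ : V → V → Mat) (R : V → Mat) (M : V →ₗ[ℝ] V →ₗ[ℝ] (V → Mat)) : Prop :=
  HasLinftyExpansion (fun h y => (σ h y)⁻¹) (fun y => (σ 0 y)⁻¹)
    (fun h y => crossMat (mulV (R y) h)) (fun h y => M h h y)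

/-- `Rs` is the effective Hall matrix and `Ms` the effective magneto-resistance tensor, for the
correctors `P`: the effective resistivity `ρ_*(h) = σ_*(h)⁻¹` satisfies
`ρ_*(h) = ρ_*(0) + 𝓔(Rs h) + Ms(h,h) + o(|h|²)`. -/
def IsEffectiveHall (b : Module.Basis (Fin 3) ℝ V) (σ P : V → V → Mat) (Rs : Mat)
    (Ms : V →ₗ[ℝ] V →ₗ[ℝ] Mat) : Prop :=
  ∀ i j, (fun h : V => ((effCond b (σ h) (P h))⁻¹ - (effCond b (σ 0) (P 0))⁻¹
      - crossMat (mulV Rs h) - Ms h h) i j) =o[𝓝 0] fun h : V => ‖h‖ ^ 2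

/-- The matrix `𝓓(h,h) = σ_* M_*(h,h) σ_* - ⟨(σ P⁰)ᵀ M(h,h) (σ P⁰)⟩`, where `σ = σ(0)`,
`P⁰ = P(0)` and `σ_* = σ_*(0)`. -/
noncomputable def gap (b : Module.Basis (Fin 3) ℝ V) (σ P : V → V → Mat)
    (M : V →ₗ[ℝ] V →ₗ[ℝ] (V → Mat)) (Ms : V →ₗ[ℝ] V →ₗ[ℝ] Mat) (h : V) : Mat :=
  effCond b (σ 0) (P 0) * Ms h h * effCond b (σ 0) (P 0)
    - cellAvg b fun y => (σ 0 y * P 0 y)ᵀ * M h h y * (σ 0 y * P 0 y)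

/-- The field `y ↦ f (ξ · y)`. -/
noncomputable def layered {X : Type*} (ξ : V) (f : ℝ → X) (y : V) : X := f (inner ℝ ξ y)

/-- The average over one period of a `1`-periodic function of one real variable. -/
noncomputable def avg (f : ℝ → ℝ) : ℝ := ∫ t in (0 : ℝ)..1, f t

/-- The Hall coefficient `r = -s / a²`. -/
noncomputable def hallCoeff (a s : ℝ → ℝ) (t : ℝ) : ℝ := -(s t / a t ^ 2)

/-- `d₁ = ⟨a⁻¹⟩⁻² (⟨a r²⟩ - ⟨a⟩⁻¹ ⟨a r⟩²)`. -/
noncomputable def d1 (a r : ℝ → ℝ) : ℝ :=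
  ((avg fun t => (a t)⁻¹) ^ 2)⁻¹ *
    ((avg fun t => a t * r t ^ 2) - (avg a)⁻¹ * (avg fun t => a t * r t) ^ 2)

/-- `d₂ = ⟨a³ r²⟩ - ⟨a⟩⁻¹ ⟨a² r⟩²`. -/
noncomputable def d2 (a r : ℝ → ℝ) : ℝ :=
  (avg fun t => a t ^ 3 * r t ^ 2) - (avg a)⁻¹ * (avg fun t => a t ^ 2 * r t) ^ 2

/-- `d₃ = ⟨a⁻¹⟩⁻¹ (⟨a² r²⟩ - ⟨a⟩⁻¹ ⟨a r⟩ ⟨a² r⟩)`. -/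
noncomputable def d3 (a r : ℝ → ℝ) : ℝ :=
  (avg fun t => (a t)⁻¹)⁻¹ *
    ((avg fun t => a t ^ 2 * r t ^ 2)
      - (avg a)⁻¹ * (avg fun t => a t * r t) * (avg fun t => a t ^ 2 * r t))

/-- The function is constant, up to a null set. -/
def IsConst (f : ℝ → ℝ) : Prop := ∃ c : ℝ, ∀ᵐ t : ℝ, f t = c

/-- `h` is parallel to `ξ`. -/
def Parallel (h ξ : V) : Prop := ∃ c : ℝ, h = c • ξ

/-- The basis `(ξ, ξ × (ξ × h) / |h × ξ|, (h × ξ) / |h × ξ|)`. -/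
noncomputable def adaptedBasis (ξ h : V) : Fin 3 → V :=
  ![ξ, ‖cross h ξ‖⁻¹ • cross ξ (cross ξ h), ‖cross h ξ‖⁻¹ • cross h ξ]

end HallLaminate

open HallLaminate

/-! A layered conductivity `S` has an explicit corrector. Write κ = ξ·Sξ and Ξ = ξξᵀ. A gradient I +
ξwᵀ, with w a bounded function of ξ·y, has a divergence-free flux as soon as its normal row Sᵀξ + κw
is a constant c. This forces w = κ⁻¹(c − Sᵀξ), and c is fixed by ⟨w⟩ = 0, which makes the potential
periodic (`isCorrector_laminateGrad`). An energy argument (`IsCorrector.unique`) shows that every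
corrector has this gradient almost everywhere on the cell. Hence, with T = ⟨κ⁻¹S⟩, σ_* = ⟨S −
κ⁻¹SΞS⟩ + ⟨κ⁻¹⟩⁻¹ TΞT (`effCond_eq_laminateCond`).

What remains is a second-order expansion of this formula. Expansions in L^∞ (`HasExp`, `MatExp`) are
stable under sums, products, inverses and averages; constants are treated as functions on a
one-point space. The coefficients are unique (`ExpRem.unique`), so the choice of the
magneto-resistance tensors is immaterial.

Put E = 𝓔(h), c₀ = ⟨a⁻¹⟩⁻¹, p = h·ξ, k = h×ξ and g = h − pξ. If f₀, f₁, f₂ are the coefficients of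
σ_*(h), then f₀ = ⟨a⟩(I − Ξ) + c₀Ξ and σ_*M_*σ_* = f₁f₀⁻¹f₁ − f₂ (`isEffectiveHall_second`). On the
local side M = a⁻³s²E² − a⁻²N and σP⁰ = a(I − Ξ) + c₀Ξ. The terms in N cancel in the gap, and what
is left is quadratic in E. The splitting E = p𝓔(ξ) + kξᵀ − ξkᵀ turns it into d₂p²(I − Ξ) + d₁|k|²Ξ −
d₃p(gξᵀ + ξgᵀ) (`gap_identity`, `gap_laminate`), and both matrices of the theorem are this tensor in
an adapted basis.

For the cases of equality, the normal component of the gap and its trace isolate d₁|k|² and d₂p². Up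
to a positive factor, d₁ is the variance of r for the weight a, and d₂ is that of ar; so they vanish
exactly when r, respectively ar, is constant (`weighted_variance_eq_zero_iff`). When ar is constant,
d₃ vanishes too. -/

namespace HallLaminate

/-! ### Layered fields and averages over the period cell -/

lemma inner_surjective {ξ : V} (hξ : ξ ≠ 0) : Function.Surjective (innerSL ℝ ξ).toLinearMap := by
  apply LinearMap.surjective
  intro h
  have := congrArg (fun L : V →ₗ[ℝ] ℝ => L ξ) h
  simp at this
  exact hξ this

lemma ae_layered_iff {ξ : V} (hξ : ξ ≠ 0) {p : ℝ → Prop} (hp : MeasurableSet {t | p t}) :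
    (∀ᵐ y : V, p (inner ℝ ξ y)) ↔ ∀ᵐ t : ℝ, p t :=
  ae_comp_linearMap_mem_iff (innerSL ℝ ξ).toLinearMap volume volume (inner_surjective hξ) hp

/-- Unlike the equivalence above, this direction needs no measurability: the exceptional set is
enlarged to its measurable hull, which is still null. -/
lemma ae_layered {ξ : V} (hξ : ξ ≠ 0) {p : ℝ → Prop} (hp : ∀ᵐ t : ℝ, p t) :
    ∀ᵐ y : V, p (inner ℝ ξ y) := by
  have hs0 : ∀ᵐ t : ℝ, t ∈ (toMeasurable volume {t : ℝ | ¬ p t})ᶜ := by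
    rw [ae_iff]
    simpa [measure_toMeasurable] using ae_iff.1 hp
  have := (ae_layered_iff hξ (p := fun t => t ∈ (toMeasurable volume {t : ℝ | ¬ p t})ᶜ)
    (measurableSet_toMeasurable _ _).compl).2 hs0
  filter_upwards [this] with y hy
  by_contra h
  exact hy (subset_toMeasurable _ _ h)

lemma ae_add_right {p : V → Prop} (z : V) (hp : ∀ᵐ y : V, p y) : ∀ᵐ y : V, p (y + z) :=
  (measurePreserving_add_right volume z).quasiMeasurePreserving.ae hp

/-- `F` is periodic with respect to the basis `b`, up to null sets. -/
def AEPeriodic {α : Type*} (b : Module.Basis (Fin 3) ℝ V) (F : V → α) : Prop :=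
  ∀ i, ∀ᵐ y : V, F (y + b i) = F y

section cell

variable {b : Module.Basis (Fin 3) ℝ V} {α : Type*}

lemma AEPeriodic.comp_add {F : V → α} (hF : AEPeriodic b F) (z : V) :
    AEPeriodic b fun y => F (y + z) := fun i => by
  filter_upwards [ae_add_right z (hF i)] with y h1
  rw [← h1]; congr 1; abel

lemma AEPeriodic.span {F : V → α} (hF : AEPeriodic b F) :
    ∀ l ∈ Submodule.span ℤ (Set.range b), ∀ᵐ y : V, F (y + l) = F y := by
  intro l hl
  induction hl using Submodule.span_induction with
  | mem x hx => obtain ⟨i, rfl⟩ := hx; exact hF i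
  | zero => simp
  | add x y _ _ h1 h2 =>
    filter_upwards [h1, ae_add_right x h2] with z h1 h2
    rw [← h1, ← h2, add_assoc]
  | smul n x _ h =>
    induction n with
    | zero => simp
    | succ n ih =>
      filter_upwards [ih, ae_add_right ((n : ℤ) • x) h] with z h1 h2
      rw [← h1, ← h2, add_smul, one_smul, add_assoc]
    | pred n ih =>
      filter_upwards [ih, ae_add_right ((-(n : ℤ) - 1) • x) h] with z h1 h2
      rw [← h1, ← h2, sub_smul, one_smul, add_assoc, sub_add_cancel]

/-- The lattice is countable, so one null set serves all translations at once. The left side is an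
exactly periodic representative of `F`. -/
lemma AEPeriodic.fract {F : V → α} (hF : AEPeriodic b F) :
    ∀ᵐ y : V, F (ZSpan.fract b y) = F y := by
  have : ∀ᵐ y : V, ∀ l : Submodule.span ℤ (Set.range b), F (y + l) = F y :=
    ae_all_iff.2 fun l => hF.span l l.2
  filter_upwards [this] with y hy
  have h := hy (-(ZSpan.floor b y))
  rw [← h, ZSpan.fract_apply, sub_eq_add_neg]; rfl

variable {E : Type*} [NormedAddCommGroup E] [NormedSpace ℝ E]

/-- A translate of the cell is another fundamental domain of the same lattice, and an exactly
periodic function has the same integral over both. `F` is only almost everywhere periodic, hence the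
detour through its representative `G`. -/
lemma setIntegral_cell_add {F : V → E} (hF : AEPeriodic b F) (z : V) :
    ∫ y in ZSpan.fundamentalDomain b, F (y + z) = ∫ y in ZSpan.fundamentalDomain b, F y := by
  set Y := ZSpan.fundamentalDomain b
  have hY : IsAddFundamentalDomain (Submodule.span ℤ (Set.range b)) Y (volume : Measure V) :=
    ZSpan.isAddFundamentalDomain b volume
  have hz := hY.vadd_of_comm z
  set G : V → E := fun y => F (ZSpan.fract b y)
  have hG : ∀ᵐ y, G y = F y := hF.fract
  have hGper : ∀ (g : Submodule.span ℤ (Set.range b)) (x : V), G (g +ᵥ x) = G x := fun g x => by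
    change F (ZSpan.fract b ((g : V) + x)) = _
    rw [ZSpan.fract_zSpan_add b x g.2]
  have e1 : ∫ y in Y, F (y + z) = ∫ y in Y, G (z +ᵥ y) :=
    integral_congr_ae (ae_restrict_of_ae (by
      filter_upwards [ae_add_right z hG] with y hy
      rw [vadd_eq_add, add_comm z y, hy]))
  have e2 : ∫ y in Y, F y = ∫ y in Y, G y :=
    integral_congr_ae (ae_restrict_of_ae (by
      filter_upwards [hG] with y hy using hy.symm))
  have : VAddInvariantMeasure (Submodule.span ℤ (Set.range b)) V volume :=
    ⟨fun c s _ => measure_preimage_add volume (c : V) s⟩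
  rw [e1, e2, hY.setIntegral_eq hz hGper]
  have := (measurePreserving_vadd z (volume : Measure V)).setIntegral_image_emb
    (measurableEmbedding_const_vadd z) G Y
  rw [← this]; rfl

lemma measurableSet_cell (b : Module.Basis (Fin 3) ℝ V) :
    MeasurableSet (ZSpan.fundamentalDomain b) := ZSpan.fundamentalDomain_measurableSet b

lemma cell_finite : (volume : Measure V) (ZSpan.fundamentalDomain b) ≠ ⊤ :=
  (ZSpan.fundamentalDomain_isBounded b).measure_lt_top.ne

lemma cell_ne_zero : (volume : Measure V) (ZSpan.fundamentalDomain b) ≠ 0 :=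
  ZSpan.measure_fundamentalDomain_ne_zero b

instance : IsFiniteMeasure ((volume : Measure V).restrict (ZSpan.fundamentalDomain b)) :=
  ⟨by simpa using cell_finite.lt_top⟩

instance : NeZero ((volume : Measure V).restrict (ZSpan.fundamentalDomain b)) :=
  ⟨by simpa using cell_ne_zero⟩

/-- Averaging a layered field along a line segment does not change its integral over the cell. -/
lemma setIntegral_cell_layered_segment {ξ : V} (hξ : ‖ξ‖ = 1) {f : ℝ → ℝ} (hf : Measurable f)
    {C : ℝ} (hC : ∀ᵐ t, |f t| ≤ C) (hper : AEPeriodic b (layered ξ f)) (c : ℝ) :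
    ∫ y in ZSpan.fundamentalDomain b, layered ξ f y =
      ∫ y in ZSpan.fundamentalDomain b, ∫ x in (0:ℝ)..1, f (inner ℝ ξ y + x * c) := by
  have hξ0 : ξ ≠ 0 := by rintro rfl; simp at hξ
  have hx : ∀ x : ℝ, ∫ y in ZSpan.fundamentalDomain b, f (inner ℝ ξ y + x * c) =
      ∫ y in ZSpan.fundamentalDomain b, layered ξ f y := fun x => by
    rw [← setIntegral_cell_add hper ((x * c) • ξ)]
    simp [layered, inner_add_right, inner_smul_right, hξ]
  have hint : Integrable (fun p : V × ℝ => f (inner ℝ ξ p.1 + p.2 * c))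
      ((volume.restrict (ZSpan.fundamentalDomain b)).prod (volume.restrict (Set.Ioc 0 1))) := by
    -- The argument of `f` is a surjective linear form in `(y, x)`, so the almost everywhere bound
    -- on `f` pulls back to the product and Fubini applies.
    let L : V × ℝ →ₗ[ℝ] ℝ :=
      (innerSL ℝ ξ).toLinearMap.comp (LinearMap.fst ℝ V ℝ) + c • LinearMap.snd ℝ V ℝ
    have hL : Function.Surjective L := fun t => by
      obtain ⟨y, hy⟩ := inner_surjective hξ0 t
      exact ⟨(y, 0), by simpa [L] using hy⟩
    have hae : ∀ᵐ p ∂((volume : Measure V).prod (volume : Measure ℝ)), |f (L p)| ≤ C :=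
      (ae_comp_linearMap_mem_iff L _ volume hL (s := {t | |f t| ≤ C})
        (measurableSet_le hf.abs measurable_const)).2 hC
    refine Integrable.of_bound (C := C) ?_ ?_
    · exact (hf.comp (by fun_prop)).aestronglyMeasurable
    · rw [Measure.prod_restrict]
      refine ae_restrict_of_ae ?_
      filter_upwards [hae] with p hp
      simpa [L, mul_comm c] using hp
  simp_rw [intervalIntegral.integral_of_le zero_le_one]
  rw [integral_integral_swap hint]
  simp_rw [hx]
  simp

/-- Averaging along a segment of length one in the direction ξ replaces the integrand by its mean
over a full period, which no longer depends on `y`. No relation between the lattice and the period 1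
is needed beyond periodicity in both senses. -/
lemma cellAverage_layered {ξ : V} (hξ : ‖ξ‖ = 1) {f : ℝ → ℝ} (hf : Measurable f)
    {C : ℝ} (hC : ∀ᵐ t, |f t| ≤ C) (hper : AEPeriodic b (layered ξ f))
    (h1 : Function.Periodic f 1) :
    ⨍ y in ZSpan.fundamentalDomain b, layered ξ f y = avg f := by
  have h := setIntegral_cell_layered_segment hξ hf hC hper 1
  have e : ∀ y : V, ∫ x in (0:ℝ)..1, f (inner ℝ ξ y + x * 1) = avg f := fun y => by
    have := intervalIntegral.integral_comp_add_left (a := 0) (b := 1) f (inner ℝ ξ y)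
    simp only [mul_one]
    rw [this, add_zero, h1.intervalIntegral_add_eq _ 0, zero_add]; rfl
  simp_rw [e] at h
  rw [setAverage_eq, h]
  simp only [integral_const, MeasurableSet.univ, Measure.restrict_apply, Set.univ_inter,
    smul_eq_mul, Measure.real]
  rw [← mul_assoc, inv_mul_cancel₀, one_mul]
  exact (ENNReal.toReal_ne_zero.2 ⟨cell_ne_zero, cell_finite⟩)

/-- The integral of a function over a period coming from the lattice, when its layered field has
mean value zero. -/
lemma intervalIntegral_period_eq_zero {ξ : V} (hξ : ‖ξ‖ = 1) {f : ℝ → ℝ} (hf : Measurable f)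
    {C : ℝ} (hC : ∀ᵐ t, |f t| ≤ C) (hper : ∀ i, Function.Periodic f (inner ℝ ξ (b i)))
    (h0 : ∫ y in ZSpan.fundamentalDomain b, layered ξ f y = 0) (i : Fin 3) :
    ∫ t in (0:ℝ)..inner ℝ ξ (b i), f t = 0 := by
  set τ : ℝ := inner ℝ ξ (b i) with hτ
  have h := setIntegral_cell_layered_segment (b := b) hξ hf hC
    (fun i => .of_forall fun y => by
      simp only [layered, inner_add_right]; exact hper i _) τ
  -- The identity is multiplied by `τ` rather than divided by it, so that `τ = 0`, a basis vector
  -- orthogonal to ξ, needs no separate treatment.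
  have e : ∀ y : V, τ * ∫ x in (0:ℝ)..1, f (inner ℝ ξ y + x * τ) = ∫ t in (0:ℝ)..τ, f t :=
    fun y => by
    have := intervalIntegral.smul_integral_comp_add_mul (a := 0) (b := 1) f τ (inner ℝ ξ y)
    simp only [smul_eq_mul, mul_zero, add_zero, mul_one] at this
    simp_rw [mul_comm _ τ]
    rw [this, (hper i).intervalIntegral_add_eq _ 0, zero_add]
  have h2 := congrArg (fun z => τ * z) h
  simp only [h0, mul_zero] at h2
  rw [← integral_const_mul] at h2
  simp_rw [e] at h2
  simp only [integral_const, MeasurableSet.univ, Measure.restrict_apply, Set.univ_inter,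
    smul_eq_mul, Measure.real] at h2
  exact (mul_eq_zero.1 h2.symm).resolve_left
    (ENNReal.toReal_ne_zero.2 ⟨cell_ne_zero, cell_finite⟩)

end cell

/-! ### Locally square integrable fields -/

lemma MemL2Loc.locallyIntegrable {f : V → ℝ} (hf : MemL2Loc f) : LocallyIntegrable f := by
  rw [locallyIntegrable_iff]
  intro K hK
  have : IsFiniteMeasure ((volume : Measure V).restrict K) :=
    ⟨by simpa using hK.measure_lt_top⟩
  exact (hf K hK).integrable (by norm_num)

lemma MemL2Loc.sub {f g : V → ℝ} (hf : MemL2Loc f) (hg : MemL2Loc g) :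
    MemL2Loc fun y => f y - g y := fun K hK => (hf K hK).sub (hg K hK)

lemma MemL2Loc.sum {f : Fin 3 → V → ℝ} (hf : ∀ i, MemL2Loc (f i)) :
    MemL2Loc fun y => ∑ i, f i y := fun K hK => memLp_finsetSum _ fun i _ => hf i K hK

lemma MemL2Loc.bdd_mul {f g : V → ℝ} (hf : MemL2Loc f) (hg : AEStronglyMeasurable g volume)
    {C : ℝ} (hC : ∀ᵐ y, |g y| ≤ C) : MemL2Loc fun y => g y * f y := fun K hK =>
  (hf K hK).mul (p := ⊤) (q := 2) (memLp_top_of_bound hg.restrict C (ae_restrict_of_ae hC))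

lemma MemL2Loc.of_bound {g : V → ℝ} (hg : AEStronglyMeasurable g volume)
    {C : ℝ} (hC : ∀ᵐ y, |g y| ≤ C) : MemL2Loc g := fun K hK => by
  have : IsFiniteMeasure ((volume : Measure V).restrict K) :=
    ⟨by simpa using hK.measure_lt_top⟩
  exact MemLp.of_bound hg.restrict C (ae_restrict_of_ae hC)

lemma MemL2Loc.of_continuous {g : V → ℝ} (hg : Continuous g) : MemL2Loc g := fun K hK => by
  have : IsFiniteMeasure ((volume : Measure V).restrict K) :=
    ⟨by simpa using hK.measure_lt_top⟩
  obtain ⟨C, hC⟩ := hK.exists_bound_of_continuousOn hg.continuousOn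
  exact MemLp.of_bound hg.aestronglyMeasurable C
    ((ae_restrict_iff' hK.measurableSet).2 (.of_forall hC))

section cell

variable {b : Module.Basis (Fin 3) ℝ V}

lemma cell_subset_closedBall (b : Module.Basis (Fin 3) ℝ V) :
    ∃ R : ℝ, 0 ≤ R ∧ ZSpan.fundamentalDomain b ⊆ Metric.closedBall 0 R := by
  obtain ⟨R, hR⟩ := (ZSpan.fundamentalDomain_isBounded b).subset_closedBall 0
  exact ⟨max R 0, le_max_right _ _, hR.trans (Metric.closedBall_subset_closedBall (le_max_left _ _))⟩

lemma MemL2Loc.cell {f : V → ℝ} (hf : MemL2Loc f) :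
    MemLp f 2 (volume.restrict (ZSpan.fundamentalDomain b)) := by
  obtain ⟨R, -, hR⟩ := cell_subset_closedBall b
  exact (hf _ (isCompact_closedBall 0 R)).mono_measure (Measure.restrict_mono hR le_rfl)

lemma locallyIntegrable_cell {f : V → ℝ} (hf : LocallyIntegrable f) :
    IntegrableOn f (ZSpan.fundamentalDomain b) := by
  obtain ⟨R, -, hR⟩ := cell_subset_closedBall b
  exact (hf.integrableOn_isCompact (isCompact_closedBall 0 R)).mono_set hR

/-- Fubini's theorem for a cross-correlation over the cell, smeared by a test function. -/
lemma integral_cell_correlation_add {f g k : V → ℝ} (hf : LocallyIntegrable f)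
    (hg : LocallyIntegrable g) (hk : Continuous k) (hk' : HasCompactSupport k) :
    IntegrableOn (fun y => f y * ∫ z, k z * g (y + z)) (ZSpan.fundamentalDomain b) ∧
    ∫ y in ZSpan.fundamentalDomain b, f y * ∫ z, k z * g (y + z) =
      ∫ z, k z * ∫ y in ZSpan.fundamentalDomain b, f y * g (y + z) := by
  obtain ⟨R, -, hR⟩ := cell_subset_closedBall b
  obtain ⟨R', hR'⟩ := hk'.isCompact.isBounded.subset_closedBall 0
  obtain ⟨C, hC⟩ := hk.bounded_above_of_compact_support hk'
  -- For `y` in the cell and `z` in the support of `k`, the point `y + z` has norm at most `R + R'`.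
  -- Cutting `g` off outside that ball changes nothing and makes it integrable.
  set G := (Metric.closedBall (0 : V) (R + R')).indicator g
  have hG : Integrable G :=
    (hg.integrableOn_isCompact (isCompact_closedBall 0 _)).integrable_indicator
      Metric.isClosed_closedBall.measurableSet
  have hkG : ∀ y ∈ ZSpan.fundamentalDomain b, ∀ z, k z * g (y + z) = k z * G (y + z) := by
    intro y hy z
    by_cases hz : k z = 0
    · simp [hz]
    · have h1 := hR hy
      have h2 := hR' (subset_tsupport k hz)
      rw [mem_closedBall_zero_iff] at h1 h2
      simp only [G]
      rw [Set.indicator_of_mem]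
      rw [mem_closedBall_zero_iff]
      exact (norm_add_le _ _).trans (add_le_add h1 h2)
  have hmeas := measurableSet_cell
  have hI : Integrable (fun p : V × V => f p.1 * (k p.2 * G (p.1 + p.2)))
      ((volume.restrict (ZSpan.fundamentalDomain b)).prod volume) := by
    have h1 : Integrable (fun p : V × V => f p.1 * G (p.1 + p.2))
        ((volume.restrict (ZSpan.fundamentalDomain b)).prod volume) :=
      (measurePreserving_prod_add (volume.restrict (ZSpan.fundamentalDomain b))
        (volume : Measure V)).integrable_comp_of_integrable
        ((locallyIntegrable_cell hf).mul_prod hG)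
    have h2 := h1.bdd_mul (f := fun p : V × V => k p.2) (c := C)
      (hk.comp continuous_snd).aestronglyMeasurable (.of_forall fun p => hC p.2)
    refine h2.congr (.of_forall fun p => ?_)
    simp only; ring
  have e0 : ∀ y ∈ ZSpan.fundamentalDomain b,
      f y * ∫ z, k z * g (y + z) = ∫ z, f y * (k z * G (y + z)) := fun y hy => by
    rw [← integral_const_mul]
    simp_rw [hkG y hy]
  refine ⟨hI.integral_prod_left.congr ((ae_restrict_iff' (hmeas b)).2
    (.of_forall fun y hy => (e0 y hy).symm)), ?_⟩
  rw [setIntegral_congr_fun (hmeas b) e0, integral_integral_swap hI]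
  refine integral_congr_ae (.of_forall fun z => ?_)
  simp only
  rw [← integral_const_mul]
  refine setIntegral_congr_fun (hmeas b) fun y hy => ?_
  beta_reduce
  rw [← hkG y hy z]; ring

lemma integral_cell_correlation_sub {f g k : V → ℝ} (hf : LocallyIntegrable f)
    (hg : LocallyIntegrable g) (hk : Continuous k) (hk' : HasCompactSupport k) :
    IntegrableOn (fun y => f y * ∫ z, k z * g (y - z)) (ZSpan.fundamentalDomain b) ∧
    ∫ y in ZSpan.fundamentalDomain b, f y * ∫ z, k z * g (y - z) =
      ∫ z, k z * ∫ y in ZSpan.fundamentalDomain b, f y * g (y - z) := by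
  have h := integral_cell_correlation_add (b := b) (k := fun z => k (-z)) hf hg
    (hk.comp continuous_neg) (hk'.comp_homeomorph (Homeomorph.neg V))
  have e1 : ∀ y, ∫ z, k (-z) * g (y + z) = ∫ z, k z * g (y - z) := fun y => by
    rw [← integral_neg_eq_self]; simp [sub_eq_add_neg]
  simp_rw [e1] at h
  refine ⟨h.1, ?_⟩
  rw [h.2, ← integral_neg_eq_self]; simp [sub_eq_add_neg]

/-- Cross-correlations over the cell of square integrable functions are continuous. -/
lemma continuous_cell_correlation {f g : V → ℝ} (hf : MemL2Loc f) (hg : MemL2Loc g) :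
    Continuous fun z => ∫ y in ZSpan.fundamentalDomain b, f y * g (y + z) := by
  rw [continuous_iff_continuousAt]
  intro z₀
  obtain ⟨R, -, hR⟩ := cell_subset_closedBall b
  set F := (ZSpan.fundamentalDomain b).indicator f
  set G := (Metric.closedBall (0 : V) (R + (‖z₀‖ + 1))).indicator g
  have hF : MemLp F 2 volume := (memLp_indicator_iff_restrict (measurableSet_cell b)).2 hf.cell
  have hG : MemLp G 2 volume := (memLp_indicator_iff_restrict
    Metric.isClosed_closedBall.measurableSet).2 (hg _ (isCompact_closedBall 0 _))
  have : Fact ((2 : ENNReal) ≠ ⊤) := ⟨by norm_num⟩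
  -- With the cut-offs, valid for all shifts within distance one of `z₀`, the correlation is an L²
  -- inner product of `F` with a translate of `G`, and translations act continuously on L².
  have hc : Continuous fun z : V => inner ℝ (hF.toLp F) (DomAddAct.mk z +ᵥ (hG.toLp G)) :=
    Continuous.inner continuous_const
      ((DomAddAct.continuous_mk).vadd continuous_const)
  refine (hc.continuousAt (x := z₀)).congr ?_
  filter_upwards [Metric.ball_mem_nhds z₀ one_pos] with z hz
  rw [L2.inner_def, ← integral_indicator (measurableSet_cell b)]
  refine integral_congr_ae ?_
  have h1 := hF.coeFn_toLp
  have h2 := DomAddAct.vadd_Lp_ae_eq (DomAddAct.mk z) (hG.toLp G)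
  have h3 : ∀ᵐ y : V, (hG.toLp G) (z +ᵥ y) = G (z +ᵥ y) :=
    (measurePreserving_vadd z (volume : Measure V)).quasiMeasurePreserving.ae hG.coeFn_toLp
  filter_upwards [h1, h2, h3] with y h1 h2 h3
  rw [h1, h2]
  simp only [Equiv.symm_apply_apply]
  rw [h3]
  simp only [F, G, vadd_eq_add]
  by_cases hy : y ∈ ZSpan.fundamentalDomain b
  · have h4 := hR hy
    rw [mem_closedBall_zero_iff] at h4
    have h5 : ‖z‖ ≤ ‖z₀‖ + 1 := by
      have := norm_add_le z₀ (z - z₀)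
      rw [Metric.mem_ball, dist_eq_norm] at hz
      rw [add_sub_cancel] at this
      linarith
    rw [Set.indicator_of_mem hy, Set.indicator_of_mem hy, Set.indicator_of_mem]
    · simp [add_comm, mul_comm]
    · rw [mem_closedBall_zero_iff]
      exact (norm_add_le _ _).trans (by linarith)
  · simp [Set.indicator_of_notMem hy]

end cell

/-! ### Test functions -/

lemma IsTest.continuous {φ : V → ℝ} (h : IsTest φ) : Continuous φ := h.1.continuous

lemma IsTest.pd_continuous {φ : V → ℝ} (h : IsTest φ) (i : Fin 3) : Continuous (pd i φ) :=
  (h.1.continuous_fderiv (by simp)).clm_apply continuous_const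

lemma IsTest.pd_compact {φ : V → ℝ} (h : IsTest φ) (i : Fin 3) : HasCompactSupport (pd i φ) :=
  h.2.fderiv_apply (𝕜 := ℝ) _

lemma IsTest.differentiable {φ : V → ℝ} (h : IsTest φ) : Differentiable ℝ φ :=
  h.1.differentiable (by simp)

lemma IsTest.comp_sub {φ : V → ℝ} (h : IsTest φ) (z : V) : IsTest fun x => φ (x - z) :=
  ⟨h.1.comp (contDiff_id.sub contDiff_const), h.2.comp_homeomorph (Homeomorph.subRight z)⟩

lemma IsTest.comp_rsub {φ : V → ℝ} (h : IsTest φ) (z : V) : IsTest fun x => φ (z - x) :=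
  ⟨h.1.comp (contDiff_const.sub contDiff_id), h.2.comp_homeomorph (Homeomorph.subLeft z)⟩

lemma pd_comp_sub (φ : V → ℝ) (z : V) (i : Fin 3) (x : V) :
    pd i (fun x => φ (x - z)) x = pd i φ (x - z) := by
  simp [pd, fderiv_comp_sub]

lemma IsTest.pd_comp_rsub {φ : V → ℝ} (h : IsTest φ) (z : V) (i : Fin 3) (x : V) :
    pd i (fun x => φ (z - x)) x = - pd i φ (z - x) := by
  have h1 : HasFDerivAt (fun x => φ (z - x)) ((fderiv ℝ φ (z - x)).comp (-ContinuousLinearMap.id ℝ V)) x :=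
    (h.differentiable (z - x)).hasFDerivAt.comp x ((hasFDerivAt_id x).const_sub z)
  simp [pd, h1.fderiv]

lemma IsTest.integrable_mul {φ f : V → ℝ} (h : IsTest φ) (hf : LocallyIntegrable f) :
    Integrable fun y => φ y * f y :=
  hf.integrable_smul_left_of_hasCompactSupport h.continuous h.2

lemma IsTest.integrable_pd_mul {φ f : V → ℝ} (h : IsTest φ) (i : Fin 3)
    (hf : LocallyIntegrable f) : Integrable fun y => pd i φ y * f y :=
  hf.integrable_smul_left_of_hasCompactSupport (h.pd_continuous i) (h.pd_compact i)

/-! ### Uniqueness of the correctors -/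

section unique

variable {b : Module.Basis (Fin 3) ℝ V}

/-- Translating the test function by a period does not change the integral against `v`, hence not
the integral against `q` either; test functions determine `q` up to a null set. -/
lemma AEPeriodic.weakGrad {v q : V → ℝ} {i : Fin 3} (hv : AEPeriodic b v)
    (hq : LocallyIntegrable q)
    (hw : ∀ φ : V → ℝ, IsTest φ → ∫ y, v y * pd i φ y = - ∫ y, q y * φ y) :
    AEPeriodic b q := fun k => by
  have hq' : LocallyIntegrable fun y => q (y + b k) := by
    rw [locallyIntegrable_iff]
    intro K hK
    have h1 := hq.integrableOn_isCompact (hK.image (continuous_add_const (b k)))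
    have h2 := (measurePreserving_add_right (volume : Measure V) (b k)).integrableOn_image
      (measurableEmbedding_addRight (b k)) (f := q) (s := K)
    exact h2.1 h1
  refine ae_eq_of_integral_contDiff_smul_eq hq' hq fun φ hφ hφ' => ?_
  have ht : IsTest φ := ⟨hφ, hφ'⟩
  have e1 : ∫ y, φ y • q (y + b k) = ∫ y, q y * φ (y - b k) := by
    rw [← integral_add_right_eq_self (fun y => q y * φ (y - b k)) (b k)]
    simp [mul_comm]
  have e2 : ∫ y, v y * pd i (fun x => φ (x - b k)) y = ∫ y, v y * pd i φ y := by
    rw [← integral_add_right_eq_self _ (b k)]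
    refine integral_congr_ae ?_
    filter_upwards [hv k] with y hy
    rw [pd_comp_sub, hy, add_sub_cancel_right]
  have e3 := hw _ (ht.comp_sub (b k))
  rw [e2, hw _ ht, neg_inj] at e3
  rw [e1, ← e3]
  exact integral_congr_ae (.of_forall fun y => mul_comm _ _)

lemma AEPeriodic.mul {f g : V → ℝ} (hf : AEPeriodic b f) (hg : AEPeriodic b g) :
    AEPeriodic b fun y => f y * g y := fun i => by
  filter_upwards [hf i, hg i] with y h1 h2
  rw [h1, h2]

/-- A periodic gradient of a periodic function is orthogonal to periodic divergence free fields. -/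
theorem integral_cell_weakGrad_mul_divFree {v : V → ℝ} {q g : Fin 3 → V → ℝ}
    (hv : MemL2Loc v) (hq : ∀ i, MemL2Loc (q i)) (hg : ∀ i, MemL2Loc (g i))
    (hw : ∀ i, ∀ φ : V → ℝ, IsTest φ → ∫ y, v y * pd i φ y = - ∫ y, q i y * φ y)
    (hvp : AEPeriodic b v) (hgp : ∀ i, AEPeriodic b (g i))
    (hdiv : ∀ φ : V → ℝ, IsTest φ → ∫ y, ∑ i, g i y * pd i φ y = 0) :
    ∫ y in ZSpan.fundamentalDomain b, ∑ i, g i y * q i y = 0 := by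
  -- The claim is `D 0 = 0`. The correlation `D` is continuous, so it suffices that it vanishes as a
  -- distribution. This replaces any regularization of `v` or any use of periodic test functions.
  set D : V → ℝ := fun z => ∑ i, ∫ y in ZSpan.fundamentalDomain b, g i y * q i (y + z) with hD
  have hDc : Continuous D :=
    continuous_finsetSum _ fun i _ => continuous_cell_correlation (hg i) (hq i)
  have hlin : ∀ i, LocallyIntegrable (g i) := fun i => (hg i).locallyIntegrable
  have hliq : ∀ i, LocallyIntegrable (q i) := fun i => (hq i).locallyIntegrable
  have hliv := hv.locallyIntegrable
  have key : ∀ ψ : V → ℝ, IsTest ψ → ∫ z, ψ z * D z = 0 := by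
    intro ψ hψ
    -- The divergence condition is tested with the reflected translate `x ↦ ψ (y - x)`. Multiplying
    -- by `v y` and integrating over the cell then gives `h2`.
    have h1 : ∀ y : V, ∑ i, ∫ z, pd i ψ z * g i (y - z) = 0 := fun y => by
      have h := hdiv _ (hψ.comp_rsub y)
      rw [integral_finsetSum] at h
      · rw [← neg_eq_zero, ← Finset.sum_neg_distrib, ← h]
        refine Finset.sum_congr rfl fun i _ => ?_
        rw [← integral_neg, ← integral_sub_left_eq_self _ volume y]
        refine integral_congr_ae (.of_forall fun z => ?_)
        simp only [hψ.pd_comp_rsub, sub_sub_cancel]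
        ring
      · intro i _
        exact ((hψ.comp_rsub y).integrable_pd_mul i (hlin i)).congr
          (.of_forall fun z => mul_comm _ _)
    have h2 : ∑ i, ∫ z, pd i ψ z * ∫ y in ZSpan.fundamentalDomain b, v y * g i (y - z) = 0 := by
      have e : ∀ i, ∫ z, pd i ψ z * ∫ y in ZSpan.fundamentalDomain b, v y * g i (y - z) =
          ∫ y in ZSpan.fundamentalDomain b, v y * ∫ z, pd i ψ z * g i (y - z) := fun i =>
        (integral_cell_correlation_sub hliv (hlin i) (hψ.pd_continuous i) (hψ.pd_compact i)).2.symm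
      simp_rw [e]
      rw [← integral_finsetSum _ fun i _ => (integral_cell_correlation_sub hliv (hlin i)
        (hψ.pd_continuous i) (hψ.pd_compact i)).1]
      simp_rw [← Finset.mul_sum, h1]
      simp
    -- Periodicity moves the shift from the flux to the potential, where the weak derivative can act
    -- in `h4`.
    have h3 : ∀ i z, ∫ y in ZSpan.fundamentalDomain b, v y * g i (y - z) =
        ∫ y in ZSpan.fundamentalDomain b, g i y * v (y + z) := fun i z => by
      have := setIntegral_cell_add (b := b) (F := fun y => v y * g i (y - z))
        (hvp.mul (by simpa [sub_eq_add_neg] using (hgp i).comp_add (-z))) z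
      rw [← this]
      simp [mul_comm]
    simp_rw [h3] at h2
    have h4 : ∀ i, ∫ z, pd i ψ z * ∫ y in ZSpan.fundamentalDomain b, g i y * v (y + z) =
        - ∫ z, ψ z * ∫ y in ZSpan.fundamentalDomain b, g i y * q i (y + z) := fun i => by
      rw [← (integral_cell_correlation_add (hlin i) hliv (hψ.pd_continuous i) (hψ.pd_compact i)).2,
        ← (integral_cell_correlation_add (hlin i) (hliq i) hψ.continuous hψ.2).2, ← integral_neg]
      refine integral_congr_ae (.of_forall fun y => ?_)
      simp only
      have h := hw i _ (hψ.comp_sub y)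
      rw [← integral_add_right_eq_self _ y, ← integral_add_right_eq_self (fun x => q i x * _) y] at h
      simp only [pd_comp_sub, add_sub_cancel_right] at h
      have e1 : ∫ z, pd i ψ z * v (y + z) = ∫ z, v (z + y) * pd i ψ z := by
        simp_rw [add_comm y, mul_comm]
      have e2 : ∫ z, ψ z * q i (y + z) = ∫ z, q i (z + y) * ψ z := by
        simp_rw [add_comm y, mul_comm]
      rw [e1, e2, h]; ring
    simp_rw [h4, Finset.sum_neg_distrib, neg_eq_zero] at h2
    rw [← h2, ← integral_finsetSum]
    · simp_rw [hD, Finset.mul_sum]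
    · intro i _
      exact hψ.integrable_mul
        (continuous_cell_correlation (hg i) (hq i)).locallyIntegrable
  -- A continuous function that vanishes almost everywhere vanishes at every point, in particular at
  -- the origin.
  have hD0 : D = 0 := by
    refine (Continuous.ae_eq_iff_eq volume hDc continuous_zero).1 ?_
    exact ae_eq_zero_of_integral_contDiff_smul_eq_zero hDc.locallyIntegrable
      fun φ h1 h2 => key φ ⟨h1, h2⟩
  have := congrFun hD0 0
  simp only [hD, add_zero, Pi.zero_apply] at this
  rw [integral_finsetSum]
  · exact this
  · intro i _
    exact (hg i).cell.integrable_mul (hq i).cell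

end unique

/-! ### Pointwise bounds for coercive matrix fields and the energy argument. -/

lemma inner_mulV (A : Mat) (ζ η : V) : inner ℝ (mulV A ζ) η = ∑ i, (∑ k, A i k * ζ k) * η i := by
  simp [mulV, PiLp.inner_apply, Matrix.mulVec, dotProduct, mul_comm]

lemma norm_sq_eq_sum (ζ : V) : ‖ζ‖ ^ 2 = ∑ i, ζ i ^ 2 := by
  simp [EuclideanSpace.norm_sq_eq]

lemma mulV_mul (A B : Mat) (ζ : V) : mulV (A * B) ζ = mulV A (mulV B ζ) := by
  simp [mulV]

lemma mulV_one (ζ : V) : mulV 1 ζ = ζ := by simp [mulV]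

/-- The lower bound for the inverse, applied to the vector Aζ, gives β⁻¹|Aζ|² ≤ ζ·Aζ ≤ |ζ||Aζ|; one
factor |Aζ| cancels. -/
lemma MemM.norm_mulV_le {α β : ℝ} (hβ : 0 < β) {A : V → Mat} (hA : MemM α β A) :
    ∀ᵐ y, ∀ ζ : V, ‖mulV (A y) ζ‖ ≤ β * ‖ζ‖ := by
  filter_upwards [hA.bounds] with y hy ζ
  obtain ⟨hu, _, h⟩ := hy
  have h1 := h (mulV (A y) ζ)
  rw [← mulV_mul, Matrix.nonsing_inv_mul _ hu, mulV_one] at h1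
  have h2 := h1.trans (real_inner_le_norm _ _)
  rcases (norm_nonneg (mulV (A y) ζ)).eq_or_lt with h0 | h0
  · rw [← h0]; positivity
  · rw [inv_mul_le_iff₀ hβ, pow_two, ← mul_assoc] at h2
    exact le_of_mul_le_mul_right h2 h0

lemma MemM.abs_le {α β : ℝ} (hβ : 0 < β) {A : V → Mat} (hA : MemM α β A) :
    ∀ᵐ y, ∀ i j, |A y i j| ≤ β := by
  filter_upwards [hA.norm_mulV_le hβ] with y h i j
  have h1 := h (EuclideanSpace.single j 1)
  have h2 := PiLp.norm_apply_le (mulV (A y) (EuclideanSpace.single j 1)) i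
  have h3 : mulV (A y) (EuclideanSpace.single j 1) i = A y i j := by
    simp [mulV]
  rw [h3] at h2
  simpa using h2.trans h1

/-- The corrector gradient of a periodic conductivity is unique on the period cell. -/
theorem IsCorrector.unique {b : Module.Basis (Fin 3) ℝ V} {α β : ℝ} (hα : 0 < α) (hβ : 0 < β)
    {A P P' : V → Mat} (hA : MemM α β A) (hAp : ∀ i y, A (y + b i) = A y)
    (hP : IsCorrector b A P) (hP' : IsCorrector b A P') :
    ∀ᵐ y ∂volume.restrict (ZSpan.fundamentalDomain b), P y = P' y := by
  obtain ⟨U, hU, hUp, hdiv⟩ := hP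
  obtain ⟨U', hU', hUp', hdiv'⟩ := hP'
  have hAP : ∀ {Q : V → Mat}, (∀ i j, MemL2Loc fun y => Q y i j) →
      ∀ i j, MemL2Loc fun y => (A y * Q y) i j := fun {Q} hQ i j => by
    simp_rw [Matrix.mul_apply]
    refine MemL2Loc.sum fun k => MemL2Loc.bdd_mul (hQ k j)
      (hA.measurable i k).aestronglyMeasurable (C := β) ?_
    filter_upwards [hA.abs_le hβ] with y hy using hy i k
  have hcol : ∀ j, ∀ᵐ y ∂volume.restrict (ZSpan.fundamentalDomain b), ∀ i,
      P y i j - P' y i j = 0 := by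
    intro j
    have hq : ∀ i, MemL2Loc fun y => P y i j - P' y i j :=
      fun i => (hU.l2_grad i j).sub (hU'.l2_grad i j)
    have hg : ∀ i, MemL2Loc fun y => (A y * P y) i j - (A y * P' y) i j :=
      fun i => (hAP hU.l2_grad i j).sub (hAP hU'.l2_grad i j)
    have hv : MemL2Loc fun y => U y j - U' y j := (hU.l2_fun j).sub (hU'.l2_fun j)
    have hvp : AEPeriodic b fun y => U y j - U' y j := fun i => by
      filter_upwards [hUp i, hUp' i] with y h1 h2
      have h1 := congrArg (fun z : V => z j) h1
      have h2 := congrArg (fun z : V => z j) h2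
      simp only [PiLp.sub_apply, PiLp.add_apply] at h1 h2
      linarith
    have hw : ∀ i, ∀ φ : V → ℝ, IsTest φ →
        ∫ y, (U y j - U' y j) * pd i φ y = - ∫ y, (P y i j - P' y i j) * φ y := by
      intro i φ hφ
      simp_rw [sub_mul]
      rw [integral_sub, integral_sub, hU.weak i j φ hφ, hU'.weak i j φ hφ]
      · ring
      · exact (hφ.integrable_mul (hU.l2_grad i j).locallyIntegrable).congr
          (.of_forall fun y => mul_comm _ _)
      · exact (hφ.integrable_mul (hU'.l2_grad i j).locallyIntegrable).congr
          (.of_forall fun y => mul_comm _ _)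
      · exact (hφ.integrable_pd_mul i (hU.l2_fun j).locallyIntegrable).congr
          (.of_forall fun y => mul_comm _ _)
      · exact (hφ.integrable_pd_mul i (hU'.l2_fun j).locallyIntegrable).congr
          (.of_forall fun y => mul_comm _ _)
    have hqp : ∀ i, AEPeriodic b fun y => P y i j - P' y i j :=
      fun i => hvp.weakGrad (hq i).locallyIntegrable (hw i)
    have hgp : ∀ i, AEPeriodic b fun y => (A y * P y) i j - (A y * P' y) i j := by
      intro i k
      filter_upwards [hqp 0 k, hqp 1 k, hqp 2 k] with y h0 h1 h2
      simp only [Matrix.mul_apply, Fin.sum_univ_three, hAp]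
      linear_combination A y i 0 * h0 + A y i 1 * h1 + A y i 2 * h2
    have hd : ∀ φ : V → ℝ, IsTest φ →
        ∫ y, ∑ i, ((A y * P y) i j - (A y * P' y) i j) * pd i φ y = 0 := by
      intro φ hφ
      simp_rw [sub_mul, Finset.sum_sub_distrib]
      rw [integral_sub, hdiv j φ hφ, hdiv' j φ hφ, sub_zero]
      all_goals
        refine integrable_finsetSum _ fun i _ => ?_
        simp_rw [mul_comm _ (pd i φ _)]
      · exact hφ.integrable_pd_mul i (hAP hU.l2_grad i j).locallyIntegrable
      · exact hφ.integrable_pd_mul i (hAP hU'.l2_grad i j).locallyIntegrable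
    have h0 := integral_cell_weakGrad_mul_divFree hv hq hg hw hvp hgp hd
    -- The energy of the difference has zero integral by `h0`, while coercivity bounds its density
    -- below by α times the squared column of `P - P'`; so that column vanishes almost everywhere on
    -- the cell.
    have hco : ∀ᵐ y, α * ∑ i, (P y i j - P' y i j) ^ 2 ≤
        ∑ i, ((A y * P y) i j - (A y * P' y) i j) * (P y i j - P' y i j) := by
      filter_upwards [hA.bounds] with y hy
      have h := hy.2.1 (WithLp.toLp 2 fun i => P y i j - P' y i j)
      rw [inner_mulV, norm_sq_eq_sum] at h
      refine h.trans (le_of_eq ?_)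
      simp only [Matrix.mul_apply, Fin.sum_univ_three]
      ring
    have hnn : ∀ᵐ y ∂volume.restrict (ZSpan.fundamentalDomain b), 0 ≤
        ∑ i, ((A y * P y) i j - (A y * P' y) i j) * (P y i j - P' y i j) := by
      refine ae_restrict_of_ae ?_
      filter_upwards [hco] with y hy
      exact le_trans (by positivity) hy
    rw [integral_eq_zero_iff_of_nonneg_ae hnn] at h0
    · filter_upwards [h0, ae_restrict_of_ae hco] with y h1 h2 i
      rw [h1] at h2
      have h3 : ∑ i, (P y i j - P' y i j) ^ 2 ≤ 0 := by
        by_contra h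
        push Not at h
        exact absurd h2 (not_le.2 (mul_pos hα h))
      have h4 := (Finset.sum_eq_zero_iff_of_nonneg (fun i _ => sq_nonneg _)).1
        (le_antisymm h3 (Finset.sum_nonneg fun i _ => sq_nonneg _)) i (Finset.mem_univ i)
      exact pow_eq_zero_iff two_ne_zero |>.1 h4
    · exact integrable_finsetSum _ fun i _ => (hg i).cell.integrable_mul (hq i).cell
  filter_upwards [ae_all_iff.2 hcol] with y hy
  ext i j
  exact sub_eq_zero.1 (hy j i)

/-! ### Existence of the correctors of a layered conductivity -/

/-- A field that is invariant along `z` does not see the derivative of test functions along `z`. -/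
lemma integral_mul_fderiv_of_invariant {f φ : V → ℝ} (hf : LocallyIntegrable f) (hφ : IsTest φ)
    {z : V} (hz : ∀ (y : V) (t : ℝ), f (y + t • z) = f y) :
    ∫ y, f y * fderiv ℝ φ y z = 0 := by
  have hl : ∀ y, HasLineDerivAt ℝ f 0 y z := fun y => by
    simp only [HasLineDerivAt, hz]
    exact hasDerivAt_const _ _
  have h := integral_bilinear_hasLineDerivAt_right_eq_neg_left_of_integrable
    (B := ContinuousLinearMap.mul ℝ ℝ) (μ := (volume : Measure V)) (f := f) (f' := fun _ => 0)
    (g := φ) (g' := fun y => fderiv ℝ φ y z) (v := z)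
    (by simp)
    (by
      have hc : Continuous fun y => fderiv ℝ φ y z :=
        (hφ.1.continuous_fderiv (by simp)).clm_apply continuous_const
      have hs : HasCompactSupport fun y => fderiv ℝ φ y z := hφ.2.fderiv_apply (𝕜 := ℝ) z
      exact hf.integrable_smul_right_of_hasCompactSupport hc hs)
    (hf.integrable_smul_right_of_hasCompactSupport hφ.continuous hφ.2)
    (fun y _ => hl y)
    (fun y _ => (hφ.differentiable y).hasFDerivAt.hasLineDerivAt z)
  simpa using h

section primitive

variable {w : ℝ → ℝ} {C : ℝ}

lemma locallyIntegrable_of_ae_bound {X : Type*} [TopologicalSpace X] [MeasurableSpace X]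
    {μ : Measure X} [IsLocallyFiniteMeasure μ] {w : X → ℝ} (hw : AEStronglyMeasurable w μ)
    (hC : ∀ᵐ t ∂μ, |w t| ≤ C) : LocallyIntegrable w μ := by
  intro x
  obtain ⟨s, hs, hfin⟩ := μ.finiteAt_nhds x
  refine ⟨s, hs, ?_⟩
  have : IsFiniteMeasure (μ.restrict s) := ⟨by simpa using hfin⟩
  exact Integrable.of_bound hw.restrict C (ae_restrict_of_ae hC)

/-- Lipschitz continuity of the primitive is what justifies integrating by parts against test
functions when `w` is merely bounded. -/
lemma lipschitzWith_primitive (hw : Measurable w) (hC : ∀ᵐ t, |w t| ≤ C) :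
    LipschitzWith C.toNNReal fun t => ∫ x in (0:ℝ)..t, w x := by
  have hli : LocallyIntegrable w := locallyIntegrable_of_ae_bound hw.aestronglyMeasurable hC
  have hi : ∀ a b : ℝ, IntervalIntegrable w volume a b := fun a b =>
    intervalIntegrable_iff.2 ((hli.integrableOn_isCompact isCompact_uIcc).mono_set
      Set.uIoc_subset_uIcc)
  have hC0 : 0 ≤ C := by
    obtain ⟨t, ht⟩ := hC.exists
    exact (abs_nonneg _).trans ht
  refine LipschitzWith.of_dist_le_mul fun s t => ?_
  rw [Real.dist_eq, Real.dist_eq, intervalIntegral.integral_interval_sub_left (hi _ _) (hi _ _),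
    Real.coe_toNNReal _ hC0]
  have := intervalIntegral.norm_integral_le_of_norm_le_const_ae (a := t) (b := s) (f := w) (C := C)
    (by filter_upwards [hC] with x hx _ using hx)
  simpa using this

lemma primitive_add_period (hw : Measurable w) (hC : ∀ᵐ t, |w t| ≤ C) {τ : ℝ}
    (hp : Function.Periodic w τ) (h0 : ∫ x in (0:ℝ)..τ, w x = 0) (t : ℝ) :
    ∫ x in (0:ℝ)..(t + τ), w x = ∫ x in (0:ℝ)..t, w x := by
  have hli : LocallyIntegrable w := locallyIntegrable_of_ae_bound hw.aestronglyMeasurable hC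
  have hi : ∀ a b : ℝ, IntervalIntegrable w volume a b := fun a b =>
    intervalIntegrable_iff.2 ((hli.integrableOn_isCompact isCompact_uIcc).mono_set
      Set.uIoc_subset_uIcc)
  rw [← intervalIntegral.integral_add_adjacent_intervals (hi 0 t) (hi t (t + τ)),
    hp.intervalIntegral_add_eq t 0, zero_add, h0, add_zero]

end primitive

/-- The matrix `I + ξ wᵀ`. -/
def rankOneGrad (ξ w : V) : Mat := Matrix.of fun i j => (if i = j then 1 else 0) + ξ i * w j

section layered

variable {b : Module.Basis (Fin 3) ℝ V} {ξ : V} {w : ℝ → V} {C C' : ℝ}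

lemma measurable_rankOneGrad (hw : ∀ j, Measurable fun t => w t j) (i j : Fin 3) :
    Measurable fun t => rankOneGrad ξ (w t) i j := by
  simp only [rankOneGrad, Matrix.of_apply]
  exact measurable_const.add (measurable_const.mul (hw j))

lemma abs_rankOneGrad_le (hξ : ‖ξ‖ = 1) (hwC : ∀ᵐ t, ∀ j, |w t j| ≤ C') :
    ∀ᵐ t, ∀ i j, |rankOneGrad ξ (w t) i j| ≤ 1 + C' := by
  filter_upwards [hwC] with t ht i j
  simp only [rankOneGrad, Matrix.of_apply]
  refine (abs_add_le _ _).trans (add_le_add (by split_ifs <;> simp) ?_)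
  rw [abs_mul]
  have h1 : |ξ i| ≤ 1 := by simpa [hξ] using PiLp.norm_apply_le ξ i
  nlinarith [abs_nonneg (w t j), ht j, abs_nonneg (ξ i)]

lemma memL2Loc_layered (hξ0 : ξ ≠ 0) {f : ℝ → ℝ} (hf : Measurable f) (hC : ∀ᵐ t, |f t| ≤ C) :
    MemL2Loc fun y => f (inner ℝ ξ y) :=
  MemL2Loc.of_bound (hf.comp (by fun_prop : Measurable fun y : V => (inner ℝ ξ y : ℝ))).aestronglyMeasurable
    (ae_layered hξ0 hC)

/-- The weak gradient of `y ↦ y + W(ξ · y)`, where `W` is a primitive of `w`. -/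
lemma weak_layered (hξ : ‖ξ‖ = 1) (hw : ∀ j, Measurable fun t => w t j)
    (hwC : ∀ j, ∀ᵐ t, |w t j| ≤ C') (i j : Fin 3) {φ : V → ℝ} (hφ : IsTest φ) :
    ∫ y, (y j + ∫ x in (0:ℝ)..inner ℝ ξ y, w x j) * pd i φ y =
      - ∫ y, rankOneGrad ξ (w (inner ℝ ξ y)) i j * φ y := by
  have hξ0 : ξ ≠ 0 := by rintro rfl; simp at hξ
  set u : V → ℝ := fun y => y j + ∫ x in (0:ℝ)..inner ℝ ξ y, w x j with hu
  have hK : LipschitzWith (‖(EuclideanSpace.proj j : V →L[ℝ] ℝ)‖₊ +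
      C'.toNNReal * ‖innerSL ℝ ξ‖₊) u :=
    (EuclideanSpace.proj j : V →L[ℝ] ℝ).lipschitz.add
      ((lipschitzWith_primitive (hw j) (hwC j)).comp (innerSL ℝ ξ).lipschitz)
  obtain ⟨K', hK'⟩ := hφ.1.lipschitzWith_of_hasCompactSupport hφ.2 (by simp)
  have h := hK.integral_lineDeriv_mul_eq (μ := volume) hK' hφ.2 (EuclideanSpace.single i 1)
  have e1 : ∀ y, lineDeriv ℝ φ y (-EuclideanSpace.single i 1) = - pd i φ y := fun y => by
    rw [(hφ.differentiable y).lineDeriv_eq_fderiv, map_neg, pd]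
  simp_rw [e1] at h
  -- By Lebesgue differentiation the primitive has derivative `w t j` at almost every `t`, and null
  -- sets of the line pull back to null sets along `y ↦ ξ·y`.
  have hWd := LocallyIntegrable.ae_hasDerivAt_integral
    (locallyIntegrable_of_ae_bound (hw j).aestronglyMeasurable (hwC j))
  have e2 : ∫ y, lineDeriv ℝ u y (EuclideanSpace.single i 1) * φ y =
      ∫ y, rankOneGrad ξ (w (inner ℝ ξ y)) i j * φ y := by
    refine integral_congr_ae ?_
    filter_upwards [ae_layered hξ0 hWd] with y hy
    have h1 : HasFDerivAt (fun y : V => (inner ℝ ξ y : ℝ)) (innerSL ℝ ξ) y :=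
      (innerSL ℝ ξ).hasFDerivAt
    have h2 : HasFDerivAt (fun y : V => y j)
        (EuclideanSpace.proj j : V →L[ℝ] ℝ) y :=
      (EuclideanSpace.proj j : V →L[ℝ] ℝ).hasFDerivAt
    have h3 := h2.add ((hy 0).comp_hasFDerivAt y h1)
    have h4 := (h3.hasLineDerivAt (EuclideanSpace.single i 1)).lineDeriv
    have h5 : lineDeriv ℝ u y (EuclideanSpace.single i 1) =
        rankOneGrad ξ (w (inner ℝ ξ y)) i j := by
      refine h4.trans ?_
      simp [rankOneGrad, EuclideanSpace.inner_single_right, mul_comm, eq_comm]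
    rw [h5]
  rw [e2] at h
  rw [h, ← integral_neg]
  refine integral_congr_ae (.of_forall fun y => ?_)
  simp only; ring

/-- A layered field with constant normal component is divergence free. -/
lemma divFree_layered (hξ : ‖ξ‖ = 1) {S : ℝ → Mat} (hS : ∀ i j, Measurable fun t => S t i j)
    (hSC : ∀ᵐ t, ∀ i j, |S t i j| ≤ C) {c : V} (hflux : ∀ᵐ t, ∀ j, ∑ i, ξ i * S t i j = c j) :
    DivFree (layered ξ S) := by
  have hξ0 : ξ ≠ 0 := by rintro rfl; simp at hξ
  intro j φ hφ
  have hGl : ∀ i, LocallyIntegrable fun y : V => S (inner ℝ ξ y) i j := fun i =>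
    (memL2Loc_layered hξ0 (hS i j) (by filter_upwards [hSC] with t ht using ht i j)).locallyIntegrable
  -- The direction `e_i - ξ i • ξ` is tangent to the layers, so the field is invariant along it.
  -- What remains of the divergence is the derivative along ξ, whose coefficient is the constant
  -- normal flux.
  have hz : ∀ i, inner ℝ ξ (EuclideanSpace.single i (1:ℝ) - ξ i • ξ) = 0 := fun i => by
    simp [inner_sub_right, inner_smul_right, hξ, EuclideanSpace.inner_single_right]
  have h1 : ∀ i, ∫ y, S (inner ℝ ξ y) i j *
      fderiv ℝ φ y (EuclideanSpace.single i (1:ℝ) - ξ i • ξ) = 0 :=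
    fun i => integral_mul_fderiv_of_invariant (hGl i) hφ fun y t => by
      rw [inner_add_right, inner_smul_right, hz, mul_zero, add_zero]
  have h2 : ∫ y, c j * fderiv ℝ φ y ξ = 0 :=
    integral_mul_fderiv_of_invariant (locallyIntegrable_const _) hφ fun _ _ => rfl
  have e : ∀ᵐ y : V, ∑ i, layered ξ S y i j * pd i φ y =
      ∑ i, S (inner ℝ ξ y) i j * fderiv ℝ φ y (EuclideanSpace.single i (1:ℝ) - ξ i • ξ)
        + c j * fderiv ℝ φ y ξ := by
    filter_upwards [ae_layered hξ0 hflux] with y hy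
    rw [← hy j]
    simp only [layered, pd, map_sub, map_smul, smul_eq_mul, Fin.sum_univ_three]
    ring
  have hint : ∀ f : V → ℝ, LocallyIntegrable f → ∀ z, Integrable fun y => f y * fderiv ℝ φ y z := by
    intro f hf z
    have hc : Continuous fun y => fderiv ℝ φ y z :=
      (hφ.1.continuous_fderiv (by simp)).clm_apply continuous_const
    exact hf.integrable_smul_right_of_hasCompactSupport hc (hφ.2.fderiv_apply (𝕜 := ℝ) z)
  rw [integral_congr_ae e, integral_add, integral_finsetSum, h2]
  · rw [Finset.sum_eq_zero fun i _ => h1 i, add_zero]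
  · exact fun i _ => hint _ (hGl i) _
  · exact integrable_finsetSum _ fun i _ => hint _ (hGl i) _
  · exact hint _ (locallyIntegrable_const _) _

/-- The potential is y + W(ξ·y) with W a primitive of `w`. The zero mean of `w` over the cell makes
its integral over each length ξ·b_i vanish, so W(ξ·y) is periodic; the constancy of the normal flux
makes the flux divergence free. -/
theorem isCorrector_layered (hξ : ‖ξ‖ = 1)
    {B : ℝ → Mat} (hB : ∀ i j, Measurable fun t => B t i j) (hBC : ∀ᵐ t, ∀ i j, |B t i j| ≤ C)
    (hw : ∀ j, Measurable fun t => w t j) (hwC : ∀ᵐ t, ∀ j, |w t j| ≤ C')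
    (hwp : ∀ i j, Function.Periodic (fun t => w t j) (inner ℝ ξ (b i)))
    (hw0 : ∀ j, ∫ y in ZSpan.fundamentalDomain b, layered ξ (fun t => w t j) y = 0)
    {c : V} (hflux : ∀ᵐ t, ∀ j, ∑ i, ξ i * (B t * rankOneGrad ξ (w t)) i j = c j) :
    IsCorrector b (layered ξ B) (layered ξ fun t => rankOneGrad ξ (w t)) := by
  have hξ0 : ξ ≠ 0 := by rintro rfl; simp at hξ
  have hwC' : ∀ j, ∀ᵐ t, |w t j| ≤ C' := fun j => by filter_upwards [hwC] with t ht using ht j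
  have hPC := abs_rankOneGrad_le hξ hwC
  refine ⟨fun y => y + WithLp.toLp 2 fun j => ∫ x in (0:ℝ)..inner ℝ ξ y, w x j,
    ⟨fun j => ?_, fun i j => ?_, fun i j φ hφ => ?_⟩, fun i => .of_forall fun y => ?_, ?_⟩
  · refine MemL2Loc.of_continuous ?_
    have := (lipschitzWith_primitive (hw j) (hwC' j)).continuous
    exact (EuclideanSpace.proj j : V →L[ℝ] ℝ).continuous.add
      (this.comp (innerSL ℝ ξ).continuous)
  · exact memL2Loc_layered hξ0 (measurable_rankOneGrad hw i j)
      (by filter_upwards [hPC] with t ht using ht i j)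
  · exact weak_layered hξ hw hwC' i j hφ
  · simp only [add_sub_cancel_left]
    ext j
    simp only [inner_add_right]
    exact primitive_add_period (hw j) (hwC' j) (hwp i j)
      (intervalIntegral_period_eq_zero hξ (hw j) (hwC' j) (fun i => hwp i j) (hw0 j) i) _
  · have hC0 : 0 ≤ C := by
      obtain ⟨t, ht⟩ := hBC.exists
      exact (abs_nonneg _).trans (ht 0 0)
    refine divFree_layered hξ (S := fun t => B t * rankOneGrad ξ (w t)) (C := 3 * (C * (1 + C')))
      ?_ ?_ hflux
    · intro i j
      simp only [Matrix.mul_apply]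
      exact Finset.measurable_sum _ fun k _ => (hB i k).mul (measurable_rankOneGrad hw k j)
    · filter_upwards [hBC, hPC] with t h1 h2 i j
      rw [Matrix.mul_apply]
      refine (Finset.abs_sum_le_sum_abs _ _).trans ?_
      refine (Finset.sum_le_sum (g := fun _ => C * (1 + C')) fun k _ => ?_).trans (by simp)
      rw [abs_mul]
      exact mul_le_mul (h1 i k) (h2 k j) (abs_nonneg _) hC0

end layered

/-! ### Second order expansions -/

section expansion

variable {X : Type*} [MeasurableSpace X] {μ ν : Measure X}
  {E : Type*} [NormedRing E] [NormedAlgebra ℝ E]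
  {E' : Type*} [NormedRing E'] [NormedAlgebra ℝ E']

omit [NormedAlgebra ℝ E] in
lemma exists_bound_of_memLp_top {f : X → E} (hf : MemLp f ⊤ μ) : ∃ C, 0 ≤ C ∧ ∀ᵐ x ∂μ, ‖f x‖ ≤ C := by
  refine ⟨(eLpNorm f ⊤ μ).toReal, ENNReal.toReal_nonneg, ?_⟩
  have h := hf.2
  rw [eLpNorm_exponent_top] at h ⊢
  filter_upwards [ae_le_eLpNormEssSup (f := f) (μ := μ)] with x hx
  have := (ENNReal.toReal_le_toReal (by simp) h.ne).2 hx
  simpa using this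

omit [NormedAlgebra ℝ E] in
lemma memLp_top_mul {f g : X → E} (hf : MemLp f ⊤ μ) (hg : MemLp g ⊤ μ) :
    MemLp (fun x => f x * g x) ⊤ μ := by
  obtain ⟨C, hC0, hC⟩ := exists_bound_of_memLp_top hf
  obtain ⟨D, -, hD⟩ := exists_bound_of_memLp_top hg
  refine memLp_top_of_bound (hf.1.mul hg.1) (C * D) ?_
  filter_upwards [hC, hD] with x h1 h2
  exact (norm_mul_le _ _).trans (mul_le_mul h1 h2 (norm_nonneg _) hC0)

lemma memLp_top_clm (L : E →L[ℝ] E') {f : X → E} (hf : MemLp f ⊤ μ) :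
    MemLp (fun x => L (f x)) ⊤ μ := by
  obtain ⟨C, hC0, hC⟩ := exists_bound_of_memLp_top hf
  refine memLp_top_of_bound (L.continuous.comp_aestronglyMeasurable hf.1) (‖L‖ * C) ?_
  filter_upwards [hC] with x h1
  exact (L.le_opNorm _).trans (mul_le_mul_of_nonneg_left h1 (norm_nonneg _))

/-- A linear function of `h` with bounded coefficients. -/
def IsLin (μ : Measure X) (f : V → X → E) : Prop :=
  ∃ φ : Fin 3 → X → E, (∀ i, MemLp (φ i) ⊤ μ) ∧ ∀ h : V, ∀ᵐ x ∂μ, f h x = ∑ i, h i • φ i x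

/-- A quadratic function of `h` with bounded coefficients. -/
def IsQuad (μ : Measure X) (f : V → X → E) : Prop :=
  ∃ φ : Fin 3 → Fin 3 → X → E, (∀ i j, MemLp (φ i j) ⊤ μ) ∧
    ∀ h : V, ∀ᵐ x ∂μ, f h x = ∑ i, ∑ j, (h i * h j) • φ i j x

lemma IsLin.congr {f g : V → X → E} (hf : IsLin μ f) (h : ∀ k, ∀ᵐ x ∂μ, f k x = g k x) :
    IsLin μ g := by
  obtain ⟨φ, h1, h2⟩ := hf
  exact ⟨φ, h1, fun k => by filter_upwards [h2 k, h k] with x h3 h4; rw [← h4, h3]⟩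

lemma IsQuad.congr {f g : V → X → E} (hf : IsQuad μ f) (h : ∀ k, ∀ᵐ x ∂μ, f k x = g k x) :
    IsQuad μ g := by
  obtain ⟨φ, h1, h2⟩ := hf
  exact ⟨φ, h1, fun k => by filter_upwards [h2 k, h k] with x h3 h4; rw [← h4, h3]⟩

lemma IsLin.zero : IsLin μ (fun _ _ => (0 : E)) :=
  ⟨fun _ _ => 0, fun _ => MemLp.zero', fun h => by simp⟩

lemma IsQuad.zero : IsQuad μ (fun _ _ => (0 : E)) :=
  ⟨fun _ _ _ => 0, fun _ _ => MemLp.zero', fun h => by simp⟩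

lemma IsLin.add {f g : V → X → E} (hf : IsLin μ f) (hg : IsLin μ g) :
    IsLin μ fun h x => f h x + g h x := by
  obtain ⟨φ, h1, h2⟩ := hf
  obtain ⟨γ, h3, h4⟩ := hg
  refine ⟨fun i x => φ i x + γ i x, fun i => (h1 i).add (h3 i), fun h => ?_⟩
  filter_upwards [h2 h, h4 h] with x h5 h6
  rw [h5, h6]; simp [smul_add, Finset.sum_add_distrib]

lemma IsQuad.add {f g : V → X → E} (hf : IsQuad μ f) (hg : IsQuad μ g) :
    IsQuad μ fun h x => f h x + g h x := by
  obtain ⟨φ, h1, h2⟩ := hf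
  obtain ⟨γ, h3, h4⟩ := hg
  refine ⟨fun i j x => φ i j x + γ i j x, fun i j => (h1 i j).add (h3 i j), fun h => ?_⟩
  filter_upwards [h2 h, h4 h] with x h5 h6
  rw [h5, h6]; simp [smul_add, Finset.sum_add_distrib]

lemma IsLin.clm (L : E →L[ℝ] E') {f : V → X → E} (hf : IsLin μ f) :
    IsLin μ fun h x => L (f h x) := by
  obtain ⟨φ, h1, h2⟩ := hf
  refine ⟨fun i x => L (φ i x), fun i => memLp_top_clm L (h1 i), fun h => ?_⟩
  filter_upwards [h2 h] with x h5
  rw [h5]; simp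

lemma IsQuad.clm (L : E →L[ℝ] E') {f : V → X → E} (hf : IsQuad μ f) :
    IsQuad μ fun h x => L (f h x) := by
  obtain ⟨φ, h1, h2⟩ := hf
  refine ⟨fun i j x => L (φ i j x), fun i j => memLp_top_clm L (h1 i j), fun h => ?_⟩
  filter_upwards [h2 h] with x h5
  rw [h5]; simp

lemma IsLin.mul_left {f : V → X → E} (hf : IsLin μ f) {g : X → E} (hg : MemLp g ⊤ μ) :
    IsLin μ fun h x => g x * f h x := by
  obtain ⟨φ, h1, h2⟩ := hf
  refine ⟨fun i x => g x * φ i x, fun i => memLp_top_mul hg (h1 i), fun h => ?_⟩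
  filter_upwards [h2 h] with x h5
  rw [h5]; simp [Finset.mul_sum]

lemma IsLin.mul_right {f : V → X → E} (hf : IsLin μ f) {g : X → E} (hg : MemLp g ⊤ μ) :
    IsLin μ fun h x => f h x * g x := by
  obtain ⟨φ, h1, h2⟩ := hf
  refine ⟨fun i x => φ i x * g x, fun i => memLp_top_mul (h1 i) hg, fun h => ?_⟩
  filter_upwards [h2 h] with x h5
  rw [h5]; simp [Finset.sum_mul]

lemma IsQuad.mul_left {f : V → X → E} (hf : IsQuad μ f) {g : X → E} (hg : MemLp g ⊤ μ) :
    IsQuad μ fun h x => g x * f h x := by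
  obtain ⟨φ, h1, h2⟩ := hf
  refine ⟨fun i j x => g x * φ i j x, fun i j => memLp_top_mul hg (h1 i j), fun h => ?_⟩
  filter_upwards [h2 h] with x h5
  rw [h5]; simp [Finset.mul_sum]

lemma IsQuad.mul_right {f : V → X → E} (hf : IsQuad μ f) {g : X → E} (hg : MemLp g ⊤ μ) :
    IsQuad μ fun h x => f h x * g x := by
  obtain ⟨φ, h1, h2⟩ := hf
  refine ⟨fun i j x => φ i j x * g x, fun i j => memLp_top_mul (h1 i j) hg, fun h => ?_⟩
  filter_upwards [h2 h] with x h5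
  rw [h5]; simp [Finset.sum_mul]

lemma IsLin.mul {f g : V → X → E} (hf : IsLin μ f) (hg : IsLin μ g) :
    IsQuad μ fun h x => f h x * g h x := by
  obtain ⟨φ, h1, h2⟩ := hf
  obtain ⟨γ, h3, h4⟩ := hg
  refine ⟨fun i j x => φ i x * γ j x, fun i j => memLp_top_mul (h1 i) (h3 j), fun h => ?_⟩
  filter_upwards [h2 h, h4 h] with x h5 h6
  rw [h5, h6, Finset.sum_mul_sum]; simp [smul_smul, mul_comm]

lemma IsLin.neg {f : V → X → E} (hf : IsLin μ f) : IsLin μ fun h x => - f h x :=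
  hf.clm (-ContinuousLinearMap.id ℝ E)

lemma IsQuad.neg {f : V → X → E} (hf : IsQuad μ f) : IsQuad μ fun h x => - f h x :=
  hf.clm (-ContinuousLinearMap.id ℝ E)

lemma IsLin.memLp {f : V → X → E} (hf : IsLin μ f) (h : V) : MemLp (f h) ⊤ μ := by
  obtain ⟨φ, h1, h2⟩ := hf
  exact (memLp_congr_ae (h2 h)).2 (memLp_finsetSum _ fun i _ => (h1 i).const_smul (h i))

lemma IsQuad.memLp {f : V → X → E} (hf : IsQuad μ f) (h : V) : MemLp (f h) ⊤ μ := by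
  obtain ⟨φ, h1, h2⟩ := hf
  exact (memLp_congr_ae (h2 h)).2 (memLp_finsetSum _ fun i _ =>
    memLp_finsetSum _ fun j _ => (h1 i j).const_smul (h i * h j))

lemma IsLin.smul {f : V → X → E} (hf : IsLin μ f) (c : ℝ) (h : V) :
    ∀ᵐ x ∂μ, f (c • h) x = c • f h x := by
  obtain ⟨φ, h1, h2⟩ := hf
  filter_upwards [h2 h, h2 (c • h)] with x h3 h4
  rw [h3, h4, Finset.smul_sum]; simp [smul_smul]

lemma IsQuad.smul {f : V → X → E} (hf : IsQuad μ f) (c : ℝ) (h : V) :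
    ∀ᵐ x ∂μ, f (c • h) x = c ^ 2 • f h x := by
  obtain ⟨φ, h1, h2⟩ := hf
  filter_upwards [h2 h, h2 (c • h)] with x h3 h4
  simp only [h3, h4, Finset.smul_sum, smul_smul, PiLp.smul_apply, smul_eq_mul]
  refine Finset.sum_congr rfl fun i _ => Finset.sum_congr rfl fun j _ => ?_
  congr 1; ring

lemma IsLin.bound {f : V → X → E} (hf : IsLin μ f) :
    ∃ C, 0 ≤ C ∧ ∀ h, ∀ᵐ x ∂μ, ‖f h x‖ ≤ C * ‖h‖ := by
  obtain ⟨φ, h1, h2⟩ := hf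
  choose C hC0 hC using fun i => exists_bound_of_memLp_top (h1 i)
  refine ⟨∑ i, C i, Finset.sum_nonneg fun i _ => hC0 i, fun h => ?_⟩
  filter_upwards [h2 h, ae_all_iff.2 hC] with x h3 h4
  rw [h3, Finset.sum_mul]
  refine norm_sum_le_of_le _ fun i _ => ?_
  rw [norm_smul, mul_comm]
  exact mul_le_mul (h4 i) (PiLp.norm_apply_le h i) (norm_nonneg _) (hC0 i)

lemma IsQuad.bound {f : V → X → E} (hf : IsQuad μ f) :
    ∃ C, 0 ≤ C ∧ ∀ h, ∀ᵐ x ∂μ, ‖f h x‖ ≤ C * ‖h‖ ^ 2 := by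
  obtain ⟨φ, h1, h2⟩ := hf
  choose C hC0 hC using fun i j => exists_bound_of_memLp_top (h1 i j)
  refine ⟨∑ i, ∑ j, C i j, Finset.sum_nonneg fun i _ => Finset.sum_nonneg fun j _ => hC0 i j,
    fun h => ?_⟩
  filter_upwards [h2 h, ae_all_iff.2 fun i => ae_all_iff.2 (hC i)] with x h3 h4
  rw [h3, Finset.sum_mul]
  refine norm_sum_le_of_le _ fun i _ => ?_
  rw [Finset.sum_mul]
  refine norm_sum_le_of_le _ fun j _ => ?_
  rw [norm_smul, mul_comm, norm_mul, pow_two]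
  exact mul_le_mul (h4 i j) (mul_le_mul (PiLp.norm_apply_le h i) (PiLp.norm_apply_le h j)
    (norm_nonneg _) (norm_nonneg _)) (by positivity) (hC0 i j)

/-- `F(h) = f₀ + f₁(h) + f₂(h) + o(|h|²)` in `L^∞`. -/
def ExpRem (μ : Measure X) (F : V → X → E) (f0 : X → E) (f1 f2 : V → X → E) : Prop :=
  ∀ ε : ℝ, 0 < ε → ∀ᶠ h : V in 𝓝 0, ∀ᵐ x ∂μ, ‖F h x - f0 x - f1 h x - f2 h x‖ ≤ ε * ‖h‖ ^ 2

/-- A second order expansion in `L^∞`, with bounded linear and quadratic terms. -/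
structure HasExp (μ : Measure X) (F : V → X → E) (f0 : X → E) (f1 f2 : V → X → E) : Prop where
  meas : ∀ᶠ h : V in 𝓝 0, AEStronglyMeasurable (F h) μ
  zero : MemLp f0 ⊤ μ
  one : IsLin μ f1
  two : IsQuad μ f2
  rem : ExpRem μ F f0 f1 f2

/-- The coefficients of an expansion are unique. -/
lemma ExpRem.unique {F : V → X → E} {f0 g0 : X → E} {f1 f2 g1 g2 : V → X → E}
    (hf : ExpRem μ F f0 f1 f2) (hg : ExpRem μ F g0 g1 g2)
    (hf1 : ∀ (c : ℝ) h, ∀ᵐ x ∂μ, f1 (c • h) x = c • f1 h x)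
    (hf2 : ∀ (c : ℝ) h, ∀ᵐ x ∂μ, f2 (c • h) x = c ^ 2 • f2 h x)
    (hg1 : ∀ (c : ℝ) h, ∀ᵐ x ∂μ, g1 (c • h) x = c • g1 h x)
    (hg2 : ∀ (c : ℝ) h, ∀ᵐ x ∂μ, g2 (c • h) x = c ^ 2 • g2 h x) :
    (∀ᵐ x ∂μ, f0 x = g0 x) ∧ (∀ h, ∀ᵐ x ∂μ, f1 h x = g1 h x) ∧
      ∀ h, ∀ᵐ x ∂μ, f2 h x = g2 h x := by
  -- At `h = 0` the error bound is zero and the homogeneous terms vanish, so the constant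
  -- coefficient has to be `F 0`.
  have h00 : ∀ {f0 : X → E} {f1 f2 : V → X → E}, ExpRem μ F f0 f1 f2 →
      (∀ (c : ℝ) h, ∀ᵐ x ∂μ, f1 (c • h) x = c • f1 h x) →
      (∀ (c : ℝ) h, ∀ᵐ x ∂μ, f2 (c • h) x = c ^ 2 • f2 h x) → ∀ᵐ x ∂μ, f0 x = F 0 x := by
    intro f0 f1 f2 hf hf1 hf2
    filter_upwards [(hf 1 one_pos).self_of_nhds, hf1 0 0, hf2 0 0] with x h1 h2 h3
    simp only [smul_zero, zero_smul, ne_eq, OfNat.ofNat_ne_zero, not_false_eq_true, zero_pow]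
      at h2 h3
    rw [h2, h3] at h1
    simp only [sub_zero, norm_zero, ne_eq, OfNat.ofNat_ne_zero, not_false_eq_true, zero_pow,
      mul_zero, norm_le_zero_iff, sub_eq_zero] at h1
    exact h1.symm
  have h0 : ∀ᵐ x ∂μ, f0 x = g0 x := by
    filter_upwards [h00 hf hf1 hf2, h00 hg hg1 hg2] with x h1 h2
    rw [h1, h2]
  have key : ∀ h, ∀ᵐ x ∂μ, f1 h x = g1 h x ∧ f2 h x = g2 h x := by
    intro h
    have ht : Filter.Tendsto (fun k : ℕ => ((k : ℝ) + 1)⁻¹ • h) Filter.atTop (𝓝 0) := by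
      have := (tendsto_one_div_add_atTop_nhds_zero_nat (𝕜 := ℝ)).smul_const h
      simpa using this
    -- Two expansions are compared at `t • h` with `t = 1/(k+1)` and accuracy `1/(m+1)`, then
    -- divided by `t`. Restricting `t` and the accuracy to sequences lets a single null set serve
    -- for all of them.
    have hm : ∀ m : ℕ, ∃ K : ℕ, ∀ k ≥ K, ∀ᵐ x ∂μ,
        ‖(f1 h x - g1 h x) + ((k : ℝ) + 1)⁻¹ • (f2 h x - g2 h x)‖ ≤
          2 * ((m : ℝ) + 1)⁻¹ * ((k : ℝ) + 1)⁻¹ * ‖h‖ ^ 2 := by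
      intro m
      have hp : (0:ℝ) < ((m : ℝ) + 1)⁻¹ := by positivity
      have h1 := ht.eventually ((hf _ hp).and (hg _ hp))
      obtain ⟨K, hK⟩ := Filter.eventually_atTop.1 h1
      refine ⟨K, fun k hk => ?_⟩
      set t : ℝ := ((k : ℝ) + 1)⁻¹ with ht
      have htp : 0 < t := by positivity
      filter_upwards [(hK k hk).1, (hK k hk).2, hf1 t h, hg1 t h, hf2 t h, hg2 t h, h0]
        with x e1 e2 e3 e4 e5 e6 e7
      rw [e3, e5, norm_smul, Real.norm_of_nonneg htp.le] at e1
      rw [e4, e6, ← e7, norm_smul, Real.norm_of_nonneg htp.le] at e2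
      have e8 := (norm_sub_le _ _).trans (add_le_add e2 e1)
      have e9 : F (t • h) x - f0 x - t • g1 h x - t ^ 2 • g2 h x -
          (F (t • h) x - f0 x - t • f1 h x - t ^ 2 • f2 h x) =
          t • ((f1 h x - g1 h x) + t • (f2 h x - g2 h x)) := by
        simp only [smul_add, smul_sub, smul_smul, pow_two]; abel
      rw [e9, norm_smul, Real.norm_of_nonneg htp.le] at e8
      refine le_of_mul_le_mul_left (e8.trans (le_of_eq ?_)) htp
      ring
    choose K hK using hm
    have hall : ∀ᵐ x ∂μ, ∀ m : ℕ, ∀ k ≥ K m,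
        ‖(f1 h x - g1 h x) + ((k : ℝ) + 1)⁻¹ • (f2 h x - g2 h x)‖ ≤
          2 * ((m : ℝ) + 1)⁻¹ * ((k : ℝ) + 1)⁻¹ * ‖h‖ ^ 2 :=
      ae_all_iff.2 fun m => ae_all_iff.2 fun k => by
        by_cases hk : k ≥ K m
        · filter_upwards [hK m k hk] with x hx _ using hx
        · exact .of_forall fun x hx => absurd hx hk
    have lim0 : Filter.Tendsto (fun k : ℕ => ((k : ℝ) + 1)⁻¹) Filter.atTop (𝓝 0) := by
      simpa using tendsto_one_div_add_atTop_nhds_zero_nat (𝕜 := ℝ)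
    filter_upwards [hall] with x hx
    -- Accuracy fixed, `k → ∞`: both the quadratic contribution and the error tend to zero.
    have d1 : f1 h x - g1 h x = 0 := by
      have l1 : Filter.Tendsto (fun k : ℕ => ‖(f1 h x - g1 h x) + ((k : ℝ) + 1)⁻¹ •
          (f2 h x - g2 h x)‖) Filter.atTop (𝓝 ‖(f1 h x - g1 h x) + (0:ℝ) • (f2 h x - g2 h x)‖) :=
        (tendsto_const_nhds.add (lim0.smul_const _)).norm
      have l2 : Filter.Tendsto (fun k : ℕ => 2 * (((0:ℕ) : ℝ) + 1)⁻¹ * ((k : ℝ) + 1)⁻¹ * ‖h‖ ^ 2)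
          Filter.atTop (𝓝 (2 * (((0:ℕ) : ℝ) + 1)⁻¹ * 0 * ‖h‖ ^ 2)) :=
        (lim0.const_mul _).mul_const _
      have := le_of_tendsto_of_tendsto l1 l2 (Filter.eventually_atTop.2 ⟨K 0, hx 0⟩)
      simpa using this
    -- With equal linear terms another factor `t` cancels, and the accuracy can be sent to zero, `m
    -- → ∞`, along the indices `K m`.
    have d2 : f2 h x - g2 h x = 0 := by
      have l1 : Filter.Tendsto (fun m : ℕ => 2 * ((m : ℝ) + 1)⁻¹ * ‖h‖ ^ 2)
          Filter.atTop (𝓝 (2 * 0 * ‖h‖ ^ 2)) := (lim0.const_mul _).mul_const _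
      have : ‖f2 h x - g2 h x‖ ≤ 2 * 0 * ‖h‖ ^ 2 := ge_of_tendsto' l1 fun m => by
        have h1 := hx m (K m) le_rfl
        have htp : (0:ℝ) < ((K m : ℝ) + 1)⁻¹ := by positivity
        rw [d1, zero_add, norm_smul, Real.norm_of_nonneg htp.le] at h1
        refine le_of_mul_le_mul_left (h1.trans (le_of_eq ?_)) htp
        ring
      simpa using this
    exact ⟨sub_eq_zero.1 d1, sub_eq_zero.1 d2⟩
  exact ⟨h0, fun h => by filter_upwards [key h] with x hx using hx.1,
    fun h => by filter_upwards [key h] with x hx using hx.2⟩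

lemma HasExp.congr {F G : V → X → E} {f0 g0 : X → E} {f1 f2 g1 g2 : V → X → E}
    (hf : HasExp μ F f0 f1 f2) (hF : ∀ᶠ h in 𝓝 (0 : V), ∀ᵐ x ∂μ, F h x = G h x)
    (h0 : ∀ᵐ x ∂μ, f0 x = g0 x) (h1 : ∀ h, ∀ᵐ x ∂μ, f1 h x = g1 h x)
    (h2 : ∀ h, ∀ᵐ x ∂μ, f2 h x = g2 h x) : HasExp μ G g0 g1 g2 where
  meas := by
    filter_upwards [hf.meas, hF] with h h3 h4 using h3.congr h4
  zero := (memLp_congr_ae h0).1 hf.zero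
  one := hf.one.congr h1
  two := hf.two.congr h2
  rem := fun ε hε => by
    filter_upwards [hf.rem ε hε, hF] with h h3 h4
    filter_upwards [h3, h4, h0, h1 h, h2 h] with x e3 e4 e0 e1 e2
    rw [← e4, ← e0, ← e1, ← e2]; exact e3

lemma HasExp.polynomial {f0 : X → E} {f1 f2 : V → X → E} (h0 : MemLp f0 ⊤ μ) (h1 : IsLin μ f1)
    (h2 : IsQuad μ f2) : HasExp μ (fun h x => f0 x + f1 h x + f2 h x) f0 f1 f2 where
  meas := .of_forall fun h => (h0.1.add (h1.memLp h).1).add (h2.memLp h).1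
  zero := h0
  one := h1
  two := h2
  rem := fun ε hε => .of_forall fun h => .of_forall fun x => by
    have : f0 x + f1 h x + f2 h x - f0 x - f1 h x - f2 h x = 0 := by abel
    rw [this, norm_zero]; positivity

lemma HasExp.const {f0 : X → E} (h0 : MemLp f0 ⊤ μ) :
    HasExp μ (fun _ => f0) f0 (fun _ _ => 0) (fun _ _ => 0) := by
  simpa using HasExp.polynomial h0 IsLin.zero IsQuad.zero

lemma HasExp.clm (L : E →L[ℝ] E') {F : V → X → E} {f0 : X → E} {f1 f2 : V → X → E}
    (hf : HasExp μ F f0 f1 f2) :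
    HasExp μ (fun h x => L (F h x)) (fun x => L (f0 x)) (fun h x => L (f1 h x))
      (fun h x => L (f2 h x)) where
  meas := by
    filter_upwards [hf.meas] with h h1 using L.continuous.comp_aestronglyMeasurable h1
  zero := memLp_top_clm L hf.zero
  one := hf.one.clm L
  two := hf.two.clm L
  rem := fun ε hε => by
    filter_upwards [hf.rem (ε / (‖L‖ + 1)) (by positivity)] with h h1
    filter_upwards [h1] with x h2
    rw [← map_sub, ← map_sub, ← map_sub]
    refine (L.le_opNorm _).trans ?_
    calc ‖L‖ * _ ≤ (‖L‖ + 1) * (ε / (‖L‖ + 1) * ‖h‖ ^ 2) := by gcongr; linarith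
      _ = ε * ‖h‖ ^ 2 := by field_simp

lemma HasExp.sub {F G : V → X → E} {f0 g0 : X → E} {f1 f2 g1 g2 : V → X → E}
    (hf : HasExp μ F f0 f1 f2) (hg : HasExp μ G g0 g1 g2) :
    HasExp μ (fun h x => F h x - G h x) (fun x => f0 x - g0 x) (fun h x => f1 h x - g1 h x)
      (fun h x => f2 h x - g2 h x) where
  meas := by filter_upwards [hf.meas, hg.meas] with h h1 h2 using h1.sub h2
  zero := hf.zero.sub hg.zero
  one := by simpa only [sub_eq_add_neg] using hf.one.add hg.one.neg
  two := by simpa only [sub_eq_add_neg] using hf.two.add hg.two.neg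
  rem := fun ε hε => by
    filter_upwards [hf.rem (ε / 2) (by positivity), hg.rem (ε / 2) (by positivity)] with h h1 h2
    filter_upwards [h1, h2] with x e1 e2
    have e3 := (norm_sub_le _ _).trans (add_le_add e1 e2)
    have e4 : F h x - G h x - (f0 x - g0 x) - (f1 h x - g1 h x) - (f2 h x - g2 h x) =
      F h x - f0 x - f1 h x - f2 h x - (G h x - g0 x - g1 h x - g2 h x) := by abel
    rw [e4]; exact e3.trans (le_of_eq (by ring))

lemma HasExp.add {F G : V → X → E} {f0 g0 : X → E} {f1 f2 g1 g2 : V → X → E}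
    (hf : HasExp μ F f0 f1 f2) (hg : HasExp μ G g0 g1 g2) :
    HasExp μ (fun h x => F h x + G h x) (fun x => f0 x + g0 x) (fun h x => f1 h x + g1 h x)
      (fun h x => f2 h x + g2 h x) := by
  simpa using hf.sub (hg.clm (-ContinuousLinearMap.id ℝ E))

omit [NormedAlgebra ℝ E] in
-- The error of a product is rF·G + (f0 + f1 + f2)·rG plus the products of total degree at least
-- three. The first two are of size `η n²`, the others of size `n³`.
lemma norm_mul_remainder_le {f0 f1 f2 F g0 g1 g2 G : E} {C η n : ℝ} (hC : 0 ≤ C)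
    (hη : η ≤ 1) (hη0 : 0 ≤ η) (hn0 : 0 ≤ n) (hn : n ≤ 1)
    (hf0 : ‖f0‖ ≤ C) (hf1 : ‖f1‖ ≤ C * n) (hf2 : ‖f2‖ ≤ C * n ^ 2)
    (hF : ‖F - f0 - f1 - f2‖ ≤ η * n ^ 2)
    (hg0 : ‖g0‖ ≤ C) (hg1 : ‖g1‖ ≤ C * n) (hg2 : ‖g2‖ ≤ C * n ^ 2)
    (hG : ‖G - g0 - g1 - g2‖ ≤ η * n ^ 2) :
    ‖F * G - f0 * g0 - (f0 * g1 + f1 * g0) - (f0 * g2 + f1 * g1 + f2 * g0)‖ ≤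
      (η * (6 * C + 1) + 3 * C ^ 2 * n) * n ^ 2 := by
  set rF := F - f0 - f1 - f2
  set rG := G - g0 - g1 - g2
  have hn2 : n ^ 2 ≤ 1 := pow_le_one₀ hn0 hn
  have eG : ‖G‖ ≤ 3 * C + 1 := by
    have : G = g0 + g1 + g2 + rG := by simp only [rG]; abel
    rw [this]
    have := norm_add₄_le (a := g0) (b := g1) (c := g2) (d := rG)
    nlinarith
  have e : F * G - f0 * g0 - (f0 * g1 + f1 * g0) - (f0 * g2 + f1 * g1 + f2 * g0) =
      rF * G + (f0 + f1 + f2) * rG + (f1 * g2 + f2 * (g1 + g2)) := by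
    simp only [rF, rG]; noncomm_ring
  have b1 : ‖rF * G‖ ≤ η * n ^ 2 * (3 * C + 1) :=
    (norm_mul_le _ _).trans (mul_le_mul hF eG (norm_nonneg _) (by positivity))
  have b2 : ‖(f0 + f1 + f2) * rG‖ ≤ 3 * C * (η * n ^ 2) := by
    refine (norm_mul_le _ _).trans (mul_le_mul ?_ hG (norm_nonneg _) (by positivity))
    refine (norm_add₃_le).trans ?_
    nlinarith
  have b3 : ‖f1 * g2‖ ≤ C * n * (C * n ^ 2) :=
    (norm_mul_le _ _).trans (mul_le_mul hf1 hg2 (norm_nonneg _) (by positivity))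
  have b4 : ‖f2 * (g1 + g2)‖ ≤ C * n ^ 2 * (2 * C * n) := by
    refine (norm_mul_le _ _).trans (mul_le_mul hf2 ?_ (norm_nonneg _) (by positivity))
    refine (norm_add_le _ _).trans ?_
    nlinarith [mul_nonneg hC hn0]
  rw [e]
  refine (norm_add₃_le).trans ?_
  have b5 := (norm_add_le (f1 * g2) (f2 * (g1 + g2))).trans (add_le_add b3 b4)
  refine (add_le_add (add_le_add b1 b2) b5).trans (le_of_eq ?_)
  ring

lemma HasExp.mul {F G : V → X → E} {f0 g0 : X → E} {f1 f2 g1 g2 : V → X → E}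
    (hf : HasExp μ F f0 f1 f2) (hg : HasExp μ G g0 g1 g2) :
    HasExp μ (fun h x => F h x * G h x) (fun x => f0 x * g0 x)
      (fun h x => f0 x * g1 h x + f1 h x * g0 x)
      (fun h x => f0 x * g2 h x + f1 h x * g1 h x + f2 h x * g0 x) where
  meas := by filter_upwards [hf.meas, hg.meas] with h h1 h2 using h1.mul h2
  zero := memLp_top_mul hf.zero hg.zero
  one := (hg.one.mul_left hf.zero).add (hf.one.mul_right hg.zero)
  two := ((hg.two.mul_left hf.zero).add (hf.one.mul hg.one)).add (hf.two.mul_right hg.zero)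
  rem := fun ε hε => by
    obtain ⟨A0, _, a0⟩ := exists_bound_of_memLp_top hf.zero
    obtain ⟨A1, _, a1⟩ := hf.one.bound
    obtain ⟨A2, _, a2⟩ := hf.two.bound
    obtain ⟨B0, _, b0⟩ := exists_bound_of_memLp_top hg.zero
    obtain ⟨B1, _, b1⟩ := hg.one.bound
    obtain ⟨B2, _, b2⟩ := hg.two.bound
    set C := A0 + A1 + A2 + B0 + B1 + B2
    have hC : 0 ≤ C := by positivity
    -- The accuracy `η` and the radius of the ball below make each half of the bound `η (6C + 1) +
    -- 3C²‖h‖` at most `ε / 2`; the minima with 1 meet the smallness hypotheses of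
    -- `norm_mul_remainder_le`.
    set η := min 1 (ε / (2 * (6 * C + 1)))
    have hη : 0 < η := lt_min one_pos (by positivity)
    have hball : ∀ᶠ h : V in 𝓝 0, ‖h‖ < min 1 (ε / (2 * (3 * C ^ 2 + 1))) := by
      have := Metric.ball_mem_nhds (0 : V)
        (show 0 < min 1 (ε / (2 * (3 * C ^ 2 + 1))) from lt_min one_pos (by positivity))
      filter_upwards [this] with h hh
      simpa using hh
    filter_upwards [hf.rem η hη, hg.rem η hη, hball] with h h1 h2 h3
    have h4 : ‖h‖ ≤ 1 := h3.le.trans (min_le_left _ _)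
    have h5 : ‖h‖ ≤ ε / (2 * (3 * C ^ 2 + 1)) := h3.le.trans (min_le_right _ _)
    filter_upwards [h1, h2, a0, a1 h, a2 h, b0, b1 h, b2 h] with x e1 e2 e3 e4 e5 e6 e7 e8
    refine (norm_mul_remainder_le (C := C) hC (min_le_left _ _) hη.le (norm_nonneg h) h4
      (e3.trans ?_) (e4.trans ?_) (e5.trans ?_) e1 (e6.trans ?_) (e7.trans ?_) (e8.trans ?_)
      e2).trans ?_
    · simp only [C]; linarith
    · gcongr; simp only [C]; linarith
    · gcongr; simp only [C]; linarith
    · simp only [C]; linarith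
    · gcongr; simp only [C]; linarith
    · gcongr; simp only [C]; linarith
    · gcongr
      have c1 : η * (6 * C + 1) ≤ ε / 2 := by
        calc η * (6 * C + 1) ≤ ε / (2 * (6 * C + 1)) * (6 * C + 1) := by
              gcongr; exact min_le_right _ _
          _ = ε / 2 := by field_simp
      have c2 : 3 * C ^ 2 * ‖h‖ ≤ ε / 2 := by
        calc 3 * C ^ 2 * ‖h‖ ≤ (3 * C ^ 2 + 1) * (ε / (2 * (3 * C ^ 2 + 1))) := by
              gcongr; linarith
          _ = ε / 2 := by field_simp
      linarith

/-- No Neumann series is summed. If `B` is the candidate polynomial, the product rule gives F·B = 1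
+ o(|h|²), and G − B = −G(F·B − 1) because `G` is a left inverse; boundedness of `G` preserves the
order of the error. -/
lemma HasExp.inv {F G : V → X → E} {f0 g0 : X → E} {f1 f2 : V → X → E} {C : ℝ}
    (hf : HasExp μ F f0 f1 f2) (hm : ∀ᶠ h in 𝓝 (0 : V), AEStronglyMeasurable (G h) μ)
    (hG : ∀ᶠ h in 𝓝 (0 : V), ∀ᵐ x ∂μ, G h x * F h x = 1 ∧ ‖G h x‖ ≤ C)
    (hg0 : MemLp g0 ⊤ μ) (hfg : ∀ᵐ x ∂μ, f0 x * g0 x = 1) :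
    HasExp μ G g0 (fun h x => -(g0 x * f1 h x * g0 x))
      (fun h x => g0 x * f1 h x * g0 x * f1 h x * g0 x - g0 x * f2 h x * g0 x) := by
  have h1 : IsLin μ fun h x => -(g0 x * f1 h x * g0 x) :=
    ((hf.one.mul_left hg0).mul_right hg0).neg
  have h2 : IsQuad μ fun h x => g0 x * f1 h x * g0 x * f1 h x * g0 x - g0 x * f2 h x * g0 x := by
    have a := ((((hf.one.mul_left hg0).mul_right hg0).mul hf.one).mul_right hg0).add
      ((hf.two.mul_left hg0).mul_right hg0).neg
    simpa only [← sub_eq_add_neg] using a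
  refine ⟨hm, hg0, h1, h2, fun ε hε => ?_⟩
  have hp := hf.mul (HasExp.polynomial hg0 h1 h2)
  filter_upwards [hp.rem (ε / (|C| + 1)) (by positivity), hG] with h h3 h4
  filter_upwards [h3, h4, hfg] with x e1 e2 e3
  set B := g0 x + -(g0 x * f1 h x * g0 x) +
    (g0 x * f1 h x * g0 x * f1 h x * g0 x - g0 x * f2 h x * g0 x) with hB
  have e4 : G h x - g0 x - -(g0 x * f1 h x * g0 x) -
      (g0 x * f1 h x * g0 x * f1 h x * g0 x - g0 x * f2 h x * g0 x) =
      - (G h x * (F h x * B - 1)) := by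
    have : G h x * (F h x * B - 1) = B - G h x := by
      rw [mul_sub, ← mul_assoc, e2.1, one_mul, mul_one]
    rw [this, hB]; abel
  have e5 : F h x * B - f0 x * g0 x - (f0 x * -(g0 x * f1 h x * g0 x) + f1 h x * g0 x) -
      (f0 x * (g0 x * f1 h x * g0 x * f1 h x * g0 x - g0 x * f2 h x * g0 x) +
        f1 h x * -(g0 x * f1 h x * g0 x) + f2 h x * g0 x) = F h x * B - 1 := by
    simp only [mul_neg, mul_sub, ← mul_assoc, e3, one_mul]; abel
  rw [e5] at e1
  rw [e4, norm_neg]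
  refine (norm_mul_le _ _).trans ?_
  calc ‖G h x‖ * ‖F h x * B - 1‖ ≤ (|C| + 1) * (ε / (|C| + 1) * ‖h‖ ^ 2) := by
        gcongr
        exact e2.2.trans ((le_abs_self C).trans (by linarith))
    _ = ε * ‖h‖ ^ 2 := by field_simp

omit [NormedAlgebra ℝ E] in
lemma memLp_top_mono {f : X → E} (h : ν ≪ μ) (hf : MemLp f ⊤ μ) : MemLp f ⊤ ν := by
  obtain ⟨C, -, hC⟩ := exists_bound_of_memLp_top hf
  exact memLp_top_of_bound (hf.1.mono_ac h) C (h.ae_le hC)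

lemma HasExp.mono {F : V → X → E} {f0 : X → E} {f1 f2 : V → X → E}
    (hf : HasExp μ F f0 f1 f2) (h : ν ≪ μ) : HasExp ν F f0 f1 f2 where
  meas := by filter_upwards [hf.meas] with k hk using hk.mono_ac h
  zero := memLp_top_mono h hf.zero
  one := by
    obtain ⟨φ, h1, h2⟩ := hf.one
    exact ⟨φ, fun i => memLp_top_mono h (h1 i), fun k => h.ae_le (h2 k)⟩
  two := by
    obtain ⟨φ, h1, h2⟩ := hf.two
    exact ⟨φ, fun i j => memLp_top_mono h (h1 i j), fun k => h.ae_le (h2 k)⟩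
  rem := fun ε hε => by filter_upwards [hf.rem ε hε] with k hk using h.ae_le hk

lemma HasExp.eventually_integrable [IsFiniteMeasure μ] {F : V → X → E} {f0 : X → E}
    {f1 f2 : V → X → E} (hf : HasExp μ F f0 f1 f2) :
    ∀ᶠ h in 𝓝 (0 : V), Integrable (F h) μ := by
  filter_upwards [hf.rem 1 one_pos, hf.meas] with h h1 h2
  have i0 := hf.zero.integrable le_top
  have i1 := (hf.one.memLp h).integrable le_top
  have i2 := (hf.two.memLp h).integrable le_top
  have ir : Integrable (fun x => F h x - f0 x - f1 h x - f2 h x) μ :=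
    Integrable.of_bound (((h2.sub i0.1).sub i1.1).sub i2.1) _ h1
  refine (((ir.add i2).add i1).add i0).congr (.of_forall fun x => ?_)
  simp

/-- Averages of expansions. -/
lemma HasExp.integral [IsProbabilityMeasure μ] [CompleteSpace E] {F : V → X → E} {f0 : X → E}
    {f1 f2 : V → X → E} (hf : HasExp μ F f0 f1 f2) :
    HasExp (Measure.dirac ()) (fun h _ => ∫ x, F h x ∂μ) (fun _ => ∫ x, f0 x ∂μ)
      (fun h _ => ∫ x, f1 h x ∂μ) (fun h _ => ∫ x, f2 h x ∂μ) where
  meas := .of_forall fun h => aestronglyMeasurable_const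
  zero := memLp_top_const _
  one := by
    obtain ⟨φ, h1, h2⟩ := hf.one
    refine ⟨fun i _ => ∫ x, φ i x ∂μ, fun i => memLp_top_const _, fun h => .of_forall fun _ => ?_⟩
    beta_reduce
    rw [integral_congr_ae (h2 h), integral_finsetSum]
    · simp_rw [integral_smul]
    · exact fun i _ => ((h1 i).integrable le_top).smul (h i)
  two := by
    obtain ⟨φ, h1, h2⟩ := hf.two
    refine ⟨fun i j _ => ∫ x, φ i j x ∂μ, fun i j => memLp_top_const _,
      fun h => .of_forall fun _ => ?_⟩
    beta_reduce
    rw [integral_congr_ae (h2 h), integral_finsetSum]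
    · refine Finset.sum_congr rfl fun i _ => ?_
      rw [integral_finsetSum]
      · simp_rw [integral_smul]
      · exact fun j _ => ((h1 i j).integrable le_top).smul (h i * h j)
    · exact fun i _ => integrable_finsetSum _ fun j _ =>
        ((h1 i j).integrable le_top).smul (h i * h j)
  rem := fun ε hε => by
    filter_upwards [hf.rem ε hε, hf.eventually_integrable] with h h1 iF
    refine .of_forall fun _ => ?_
    have i0 := hf.zero.integrable le_top
    have i1 := (hf.one.memLp h).integrable le_top
    have i2 := (hf.two.memLp h).integrable le_top
    have e : ∫ x, (F h x - f0 x - f1 h x - f2 h x) ∂μ =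
        ∫ x, F h x ∂μ - ∫ x, f0 x ∂μ - ∫ x, f1 h x ∂μ - ∫ x, f2 h x ∂μ := by
      rw [integral_sub (f := fun x => F h x - f0 x - f1 h x) ((iF.sub i0).sub i1) i2,
        integral_sub (f := fun x => F h x - f0 x) (iF.sub i0) i1,
        integral_sub iF i0]
    rw [← e]
    simpa using norm_integral_le_of_norm_le_const h1

end expansion

/-! ### Matrix valued expansions -/

/-- The algebra of `3 × 3` matrices as an algebra of operators, which is normed. -/
noncomputable def toOp : Mat ≃ₐ[ℝ] (V →L[ℝ] V) :=
  (Matrix.toEuclideanCLM (n := Fin 3) (𝕜 := ℝ)).toAlgEquiv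

/-- The matrix coefficient functionals. -/
noncomputable def entryL (i j : Fin 3) : (V →L[ℝ] V) →L[ℝ] ℝ :=
  (EuclideanSpace.proj i : V →L[ℝ] ℝ).comp
    (ContinuousLinearMap.apply ℝ V (EuclideanSpace.single j (1 : ℝ)))

@[simp] lemma entryL_toOp (i j : Fin 3) (M : Mat) : entryL i j (toOp M) = M i j := by
  simp [entryL, toOp]

lemma abs_entry_le (M : Mat) (i j : Fin 3) : |M i j| ≤ ‖toOp M‖ := by
  rw [← entryL_toOp i j M]
  refine (PiLp.norm_apply_le (toOp M (EuclideanSpace.single j (1 : ℝ))) i).trans ?_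
  simpa using (toOp M).le_opNorm (EuclideanSpace.single j (1 : ℝ))

lemma toOp_eq_sum (M : Mat) : toOp M = ∑ i, ∑ j, M i j • toOp (Matrix.single i j (1 : ℝ)) := by
  simp_rw [← map_smul, ← map_sum]
  congr 1
  conv_lhs => rw [Matrix.matrix_eq_sum_single M]
  simp [Matrix.smul_single]

section matrix

variable {X : Type*} [MeasurableSpace X] {μ : Measure X}

lemma exists_norm_le_of_entries :
    ∃ K : ℝ, 0 < K ∧ ∀ (M : Mat) (ε : ℝ), (∀ i j, |M i j| ≤ ε) → ‖toOp M‖ ≤ K * ε := by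
  refine ⟨∑ i : Fin 3, ∑ j : Fin 3, ‖toOp (Matrix.single i j (1 : ℝ))‖ + 1, by positivity,
    fun M ε h => ?_⟩
  have hε : 0 ≤ ε := (abs_nonneg _).trans (h 0 0)
  have : ‖toOp M‖ ≤ (∑ i : Fin 3, ∑ j : Fin 3, ‖toOp (Matrix.single i j (1 : ℝ))‖) * ε := by
    rw [toOp_eq_sum M, Finset.sum_mul]
    refine norm_sum_le_of_le _ fun i _ => ?_
    rw [Finset.sum_mul]
    refine norm_sum_le_of_le _ fun j _ => ?_
    rw [norm_smul, mul_comm]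
    exact mul_le_mul_of_nonneg_left (h i j) (norm_nonneg _)
  linarith

lemma aestronglyMeasurable_toOp {F : X → Mat} :
    AEStronglyMeasurable (fun x => toOp (F x)) μ ↔
      ∀ i j, AEStronglyMeasurable (fun x => F x i j) μ := by
  refine ⟨fun h i j => ?_, fun h => ?_⟩
  · simpa using (entryL i j).continuous.comp_aestronglyMeasurable h
  · simp_rw [toOp_eq_sum (F _)]
    exact Finset.aestronglyMeasurable_fun_sum _ fun i _ =>
      Finset.aestronglyMeasurable_fun_sum _ fun j _ => (h i j).smul_const _

/-- Entrywise boundedness. -/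
def MatBdd (μ : Measure X) (F : X → Mat) : Prop := ∀ i j, MemLp (fun x => F x i j) ⊤ μ

lemma matBdd_iff {F : X → Mat} : MatBdd μ F ↔ MemLp (fun x => toOp (F x)) ⊤ μ := by
  constructor
  · intro h
    choose C hC0 hC using fun i j => exists_bound_of_memLp_top (h i j)
    obtain ⟨K, hK, hK'⟩ := exists_norm_le_of_entries
    refine memLp_top_of_bound (aestronglyMeasurable_toOp.2 fun i j => (h i j).1)
      (K * ∑ i, ∑ j, C i j) ?_
    filter_upwards [ae_all_iff.2 fun i => ae_all_iff.2 (hC i)] with x hx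
    refine hK' _ _ fun i j => (hx i j).trans ?_
    have h1 := Finset.single_le_sum (f := fun j => C i j) (fun _ _ => hC0 _ _)
      (Finset.mem_univ j)
    have h2 := Finset.single_le_sum (f := fun i => ∑ j, C i j)
      (fun _ _ => Finset.sum_nonneg fun _ _ => hC0 _ _) (Finset.mem_univ i)
    linarith
  · intro h i j
    obtain ⟨C, -, hC⟩ := exists_bound_of_memLp_top h
    refine memLp_top_of_bound (aestronglyMeasurable_toOp.1 h.1 i j) C ?_
    filter_upwards [hC] with x hx
    exact (abs_entry_le (F x) i j).trans hx

/-- Linear matrix valued functions with bounded coefficients. -/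
def MatLin (μ : Measure X) (f : V → X → Mat) : Prop := IsLin μ fun h x => toOp (f h x)

/-- Quadratic matrix valued functions with bounded coefficients. -/
def MatQuad (μ : Measure X) (f : V → X → Mat) : Prop := IsQuad μ fun h x => toOp (f h x)

/-- The remainder estimate of a matrix valued expansion. -/
def MatRem (μ : Measure X) (F : V → X → Mat) (f0 : X → Mat) (f1 f2 : V → X → Mat) : Prop :=
  ExpRem μ (fun h x => toOp (F h x)) (fun x => toOp (f0 x)) (fun h x => toOp (f1 h x))
    (fun h x => toOp (f2 h x))

/-- Second order expansions of matrix valued functions. -/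
def MatExp (μ : Measure X) (F : V → X → Mat) (f0 : X → Mat) (f1 f2 : V → X → Mat) : Prop :=
  HasExp μ (fun h x => toOp (F h x)) (fun x => toOp (f0 x)) (fun h x => toOp (f1 h x))
    (fun h x => toOp (f2 h x))

lemma matRem_iff {F : V → X → Mat} {f0 : X → Mat} {f1 f2 : V → X → Mat} :
    MatRem μ F f0 f1 f2 ↔ ∀ ε : ℝ, 0 < ε → ∀ᶠ h : V in 𝓝 0, ∀ᵐ x ∂μ, ∀ i j,
      |(F h x - f0 x - f1 h x - f2 h x) i j| ≤ ε * ‖h‖ ^ 2 := by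
  constructor
  · intro H ε hε
    filter_upwards [H ε hε] with h hh
    filter_upwards [hh] with x hx i j
    simp only [← map_sub] at hx
    exact (abs_entry_le _ i j).trans hx
  · intro H ε hε
    obtain ⟨K, hK, hK'⟩ := exists_norm_le_of_entries
    filter_upwards [H (ε / K) (by positivity)] with h hh
    filter_upwards [hh] with x hx
    simp only [← map_sub]
    refine (hK' _ _ hx).trans (le_of_eq ?_)
    field_simp

lemma MatExp.hasLinftyExpansion {F : V → V → Mat} {F0 : V → Mat} {F1 F2 : V → V → Mat}
    (h : MatExp volume F F0 F1 F2) : HasLinftyExpansion F F0 F1 F2 :=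
  ⟨matBdd_iff.2 h.zero, fun k => matBdd_iff.2 (h.one.memLp k),
    fun k => matBdd_iff.2 (h.two.memLp k), matRem_iff.1 h.rem⟩

lemma vec_eq_sum (h : V) : h = ∑ i, h i • EuclideanSpace.single i (1 : ℝ) := by
  ext j
  simp [Pi.single_apply]

/-- A linear function of `h`, entrywise bounded for each `h`. -/
lemma matLin_of_linearMap {L : V →ₗ[ℝ] (X → Mat)} (hL : ∀ h, MatBdd μ (L h)) :
    MatLin μ fun h => L h := by
  refine ⟨fun i x => toOp (L (EuclideanSpace.single i 1) x), fun i => matBdd_iff.1 (hL _),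
    fun h => .of_forall fun x => ?_⟩
  simp_rw [← map_smul, ← map_sum]
  congr 1
  conv_lhs => rw [vec_eq_sum h]
  simp

/-- Boundedness is known on the diagonal only, so the coefficients are produced by polarization.
They are those of the symmetric part of `B`, which has the same diagonal. -/
lemma matQuad_of_bilinear {B : V →ₗ[ℝ] V →ₗ[ℝ] (X → Mat)} (hB : ∀ h, MatBdd μ (B h h)) :
    MatQuad μ fun h => B h h := by
  set e : Fin 3 → V := fun i => EuclideanSpace.single i 1
  refine ⟨fun i j x => toOp ((1 / 2 : ℝ) • (B (e i + e j) (e i + e j) x - B (e i) (e i) x -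
    B (e j) (e j) x : Mat)), fun i j => matBdd_iff.1 fun k l =>
      (((hB (e i + e j) k l).sub (hB (e i) k l)).sub (hB (e j) k l)).const_smul (1 / 2 : ℝ),
    fun h => .of_forall fun x => ?_⟩
  simp_rw [← map_smul, ← map_sum]
  congr 1
  have e1 : B h h x = ∑ i, ∑ j, (h i * h j) • B (e i) (e j) x := by
    conv_lhs => rw [vec_eq_sum h]
    simp only [map_sum, map_smul, LinearMap.sum_apply, LinearMap.smul_apply, Finset.sum_apply,
      Pi.smul_apply, Finset.smul_sum, smul_smul, e]
    rw [Finset.sum_comm]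
    simp only [mul_comm]
  rw [e1]
  simp only [map_add, LinearMap.add_apply, Pi.add_apply, Fin.sum_univ_three]
  module

/-- A quadratic function is the diagonal of a bilinear one. -/
lemma MatQuad.exists_bilinear {f : V → X → Mat} (hf : MatQuad μ f) :
    ∃ B : V →ₗ[ℝ] V →ₗ[ℝ] (X → Mat), ∀ h, ∀ᵐ x ∂μ, f h x = B h h x := by
  obtain ⟨φ, -, h2⟩ := hf
  refine ⟨LinearMap.mk₂ ℝ (fun h k x => ∑ i, ∑ j, (h i * k j) • toOp.symm (φ i j x))
    ?_ ?_ ?_ ?_, fun h => ?_⟩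
  · intro u v w; ext1 x
    simp [add_mul, add_smul, Finset.sum_add_distrib]
  · intro c u v; ext1 x
    simp [Finset.smul_sum, smul_smul, mul_assoc]
  · intro u v w; ext1 x
    simp [mul_add, add_smul, Finset.sum_add_distrib]
  · intro c u v; ext1 x
    simp [Finset.smul_sum, smul_smul, mul_left_comm]
  · filter_upwards [h2 h] with x hx
    apply toOp.injective
    rw [hx]
    simp

section ops

variable {F G : V → X → Mat} {f0 g0 : X → Mat} {f1 f2 g1 g2 : V → X → Mat}

lemma MatExp.congr (hf : MatExp μ F f0 f1 f2)
    (hF : ∀ᶠ h in 𝓝 (0 : V), ∀ᵐ x ∂μ, F h x = G h x)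
    (h0 : ∀ᵐ x ∂μ, f0 x = g0 x) (h1 : ∀ h, ∀ᵐ x ∂μ, f1 h x = g1 h x)
    (h2 : ∀ h, ∀ᵐ x ∂μ, f2 h x = g2 h x) : MatExp μ G g0 g1 g2 := by
  refine HasExp.congr hf ?_ ?_ (fun h => ?_) fun h => ?_
  · filter_upwards [hF] with h hh
    filter_upwards [hh] with x hx using congrArg toOp hx
  · filter_upwards [h0] with x hx using congrArg toOp hx
  · filter_upwards [h1 h] with x hx using congrArg toOp hx
  · filter_upwards [h2 h] with x hx using congrArg toOp hx

lemma MatExp.const (h0 : MatBdd μ f0) :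
    MatExp μ (fun _ => f0) f0 (fun _ _ => 0) (fun _ _ => 0) := by
  simpa only [MatExp, map_zero] using HasExp.const (matBdd_iff.1 h0)

lemma MatExp.linearMap (L : Mat →ₗ[ℝ] Mat) (hf : MatExp μ F f0 f1 f2) :
    MatExp μ (fun h x => L (F h x)) (fun x => L (f0 x)) (fun h x => L (f1 h x))
      (fun h x => L (f2 h x)) := by
  have := HasExp.clm (LinearMap.toContinuousLinearMap
    (toOp.toLinearMap ∘ₗ L ∘ₗ toOp.symm.toLinearMap)) hf
  simpa [MatExp] using this

lemma MatExp.sub (hf : MatExp μ F f0 f1 f2) (hg : MatExp μ G g0 g1 g2) :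
    MatExp μ (fun h x => F h x - G h x) (fun x => f0 x - g0 x) (fun h x => f1 h x - g1 h x)
      (fun h x => f2 h x - g2 h x) := by
  simpa only [MatExp, map_sub] using HasExp.sub hf hg

lemma MatExp.add (hf : MatExp μ F f0 f1 f2) (hg : MatExp μ G g0 g1 g2) :
    MatExp μ (fun h x => F h x + G h x) (fun x => f0 x + g0 x) (fun h x => f1 h x + g1 h x)
      (fun h x => f2 h x + g2 h x) := by
  simpa only [MatExp, map_add] using HasExp.add hf hg

lemma MatExp.mul (hf : MatExp μ F f0 f1 f2) (hg : MatExp μ G g0 g1 g2) :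
    MatExp μ (fun h x => F h x * G h x) (fun x => f0 x * g0 x)
      (fun h x => f0 x * g1 h x + f1 h x * g0 x)
      (fun h x => f0 x * g2 h x + f1 h x * g1 h x + f2 h x * g0 x) := by
  simpa only [MatExp, map_add, map_mul] using HasExp.mul hf hg

lemma MatExp.inv {C : ℝ} (hf : MatExp μ F f0 f1 f2)
    (hm : ∀ᶠ h in 𝓝 (0 : V), ∀ i j, AEStronglyMeasurable (fun x => G h x i j) μ)
    (hG : ∀ᶠ h in 𝓝 (0 : V), ∀ᵐ x ∂μ, G h x * F h x = 1 ∧ ∀ i j, |G h x i j| ≤ C)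
    (hg0 : MatBdd μ g0) (hfg : ∀ᵐ x ∂μ, f0 x * g0 x = 1) :
    MatExp μ G g0 (fun h x => -(g0 x * f1 h x * g0 x))
      (fun h x => g0 x * f1 h x * g0 x * f1 h x * g0 x - g0 x * f2 h x * g0 x) := by
  obtain ⟨K, hK, hK'⟩ := exists_norm_le_of_entries
  have := HasExp.inv (C := K * C) (G := fun h x => toOp (G h x)) (g0 := fun x => toOp (g0 x)) hf
    (by filter_upwards [hm] with h hh using aestronglyMeasurable_toOp.2 hh)
    (by
      filter_upwards [hG] with h hh
      filter_upwards [hh] with x hx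
      exact ⟨by rw [← map_mul, hx.1, map_one], hK' _ _ hx.2⟩)
    (matBdd_iff.1 hg0) (by filter_upwards [hfg] with x hx; rw [← map_mul, hx, map_one])
  simpa only [MatExp, map_sub, map_neg, map_mul] using this

lemma MatRem.unique (hf : MatRem μ F f0 f1 f2) (hg : MatRem μ F g0 g1 g2)
    (hf1 : ∀ (c : ℝ) h, ∀ᵐ x ∂μ, f1 (c • h) x = c • f1 h x)
    (hf2 : ∀ (c : ℝ) h, ∀ᵐ x ∂μ, f2 (c • h) x = c ^ 2 • f2 h x)
    (hg1 : ∀ (c : ℝ) h, ∀ᵐ x ∂μ, g1 (c • h) x = c • g1 h x)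
    (hg2 : ∀ (c : ℝ) h, ∀ᵐ x ∂μ, g2 (c • h) x = c ^ 2 • g2 h x) :
    (∀ᵐ x ∂μ, f0 x = g0 x) ∧ (∀ h, ∀ᵐ x ∂μ, f1 h x = g1 h x) ∧
      ∀ h, ∀ᵐ x ∂μ, f2 h x = g2 h x := by
  have key : ∀ {f : V → X → Mat} {c d : ℝ} {h : V}, (∀ᵐ x ∂μ, f (c • h) x = d • f h x) →
      ∀ᵐ x ∂μ, toOp (f (c • h) x) = d • toOp (f h x) := fun {f c d h} H => by
    filter_upwards [H] with x hx
    rw [hx, map_smul]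
  have := ExpRem.unique hf hg (fun c h => key (hf1 c h)) (fun c h => key (hf2 c h))
    (fun c h => key (hg1 c h)) (fun c h => key (hg2 c h))
  simpa only [toOp.injective.eq_iff] using this

lemma MatLin.smul (hf : MatLin μ f1) (c : ℝ) (h : V) : ∀ᵐ x ∂μ, f1 (c • h) x = c • f1 h x := by
  filter_upwards [IsLin.smul hf c h] with x hx
  exact toOp.injective (by rw [hx, map_smul])

lemma MatQuad.smul (hf : MatQuad μ f2) (c : ℝ) (h : V) :
    ∀ᵐ x ∂μ, f2 (c • h) x = c ^ 2 • f2 h x := by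
  filter_upwards [IsQuad.smul hf c h] with x hx
  exact toOp.injective (by rw [hx, map_smul])

end ops

lemma crossMat_add (u v : V) : crossMat (u + v) = crossMat u + crossMat v := by
  ext i j; fin_cases i <;> fin_cases j <;> simp [crossMat] <;> ring

lemma crossMat_smul (c : ℝ) (u : V) : crossMat (c • u) = c • crossMat u := by
  ext i j; fin_cases i <;> fin_cases j <;> simp [crossMat]

/-! ### Averages over the cell -/

/-- The normalized Lebesgue measure on the period cell. -/
noncomputable def cellMeas (b : Module.Basis (Fin 3) ℝ V) : Measure V :=
  ((volume.restrict (ZSpan.fundamentalDomain b)) Set.univ)⁻¹ •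
    volume.restrict (ZSpan.fundamentalDomain b)

variable (b : Module.Basis (Fin 3) ℝ V)

instance : IsProbabilityMeasure (cellMeas b) := isProbabilityMeasureSMul

lemma cellMeas_ac : cellMeas b ≪ volume :=
  Measure.smul_absolutelyContinuous.trans Measure.restrict_le_self.absolutelyContinuous

lemma cellMeas_ac_restrict : cellMeas b ≪ volume.restrict (ZSpan.fundamentalDomain b) :=
  Measure.smul_absolutelyContinuous

lemma ae_cellMeas {p : V → Prop} (h : ∀ᵐ y : V, p y) : ∀ᵐ y ∂cellMeas b, p y :=
  (cellMeas_ac b).ae_le h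

lemma setAverage_eq_integral_cellMeas {f : V → ℝ} :
    ⨍ y in ZSpan.fundamentalDomain b, f y = ∫ y, f y ∂cellMeas b := rfl

/-- The average is defined entry by entry, whereas expansions live in the normed algebra of
operators. The two integrals agree because coefficient functionals are continuous. -/
lemma toOp_cellAvg {F : V → Mat} (hF : Integrable (fun y => toOp (F y)) (cellMeas b)) :
    toOp (cellAvg b F) = ∫ y, toOp (F y) ∂cellMeas b := by
  rw [← toOp.apply_symm_apply (∫ y, toOp (F y) ∂cellMeas b)]
  congr 1
  ext i j
  have := (entryL i j).integral_comp_comm hF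
  rw [← entryL_toOp i j (cellAvg b F), ← entryL_toOp i j (toOp.symm _), toOp.apply_symm_apply, ← this]
  simp only [entryL_toOp]
  rfl

lemma cellAvg_congr {F G : V → Mat} (h : ∀ᵐ y ∂cellMeas b, F y = G y) :
    cellAvg b F = cellAvg b G := by
  ext i j
  change ∫ y, F y i j ∂cellMeas b = ∫ y, G y i j ∂cellMeas b
  exact integral_congr_ae (by filter_upwards [h] with y hy; rw [hy])

/-- The average of an expansion over the cell. -/
lemma MatExp.cellAvg {F : V → V → Mat} {f0 : V → Mat} {f1 f2 : V → V → Mat}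
    (hf : MatExp volume F f0 f1 f2) :
    MatExp (Measure.dirac ()) (fun h _ => cellAvg b (F h)) (fun _ => HallLaminate.cellAvg b f0)
      (fun h _ => HallLaminate.cellAvg b (f1 h)) (fun h _ => HallLaminate.cellAvg b (f2 h)) := by
  have hg := HasExp.mono hf (cellMeas_ac b)
  refine HasExp.congr hg.integral ?_ (.of_forall fun _ => ?_)
    (fun h => .of_forall fun _ => ?_) (fun h => .of_forall fun _ => ?_)
  · filter_upwards [hg.eventually_integrable] with h hh
    exact .of_forall fun _ => (toOp_cellAvg b hh).symm
  · exact (toOp_cellAvg b (hg.zero.integrable le_top)).symm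
  · exact (toOp_cellAvg b ((hg.one.memLp h).integrable le_top)).symm
  · exact (toOp_cellAvg b ((hg.two.memLp h).integrable le_top)).symm

/-! ### Bounds for conductivities -/

/-- Inversion exchanges the two quadratic bounds; measurability is read off the cofactor formula. -/
lemma MemM.inv {α β : ℝ} {A : V → Mat} (hA : MemM α β A) : MemM β⁻¹ α⁻¹ fun y => (A y)⁻¹ where
  measurable := fun i j => by
    have h1 : Measurable (β := Fin 3 → Fin 3 → ℝ) fun y => A y :=
      measurable_pi_iff.2 fun i => measurable_pi_iff.2 fun j => hA.measurable i j
    have h2 : Continuous fun M : Fin 3 → Fin 3 → ℝ => Matrix.det (M : Mat) :=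
      Continuous.matrix_det (A := fun M : Mat => M) continuous_id
    have h3 : Continuous fun M : Fin 3 → Fin 3 → ℝ => Matrix.adjugate (M : Mat) i j :=
      (Continuous.matrix_adjugate (A := fun M : Mat => M) continuous_id).matrix_elem i j
    have h4 := ((h2.measurable.comp h1).inv).mul (h3.measurable.comp h1)
    have h5 : (fun y => (A y)⁻¹ i j) = fun y => (A y).det⁻¹ * (A y).adjugate i j := by
      ext y
      simp [Matrix.inv_def]
    rw [h5]
    exact h4
  bounds := by
    filter_upwards [hA.bounds] with y hy
    obtain ⟨h1, h2, h3⟩ := hy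
    refine ⟨by rw [Matrix.isUnit_nonsing_inv_det_iff]; exact h1, h3, ?_⟩
    rwa [Matrix.nonsing_inv_nonsing_inv _ h1, inv_inv]

end matrix

/-! ### Algebra of the cross product -/

/-- The matrix `u vᵀ`. -/
def outer (u v : V) : Mat := Matrix.of fun i j => u i * v j

lemma outer_apply (u v : V) (i j : Fin 3) : outer u v i j = u i * v j := rfl

lemma inner_eq_sum (u v : V) : inner ℝ u v = u 0 * v 0 + u 1 * v 1 + u 2 * v 2 := by
  simp [PiLp.inner_apply, Fin.sum_univ_three, mul_comm]

lemma cross_apply_zero (u v : V) : cross u v 0 = u 1 * v 2 - u 2 * v 1 := by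
  simp [cross, crossProduct]

lemma cross_apply_one (u v : V) : cross u v 1 = u 2 * v 0 - u 0 * v 2 := by
  simp [cross, crossProduct]

lemma cross_apply_two (u v : V) : cross u v 2 = u 0 * v 1 - u 1 * v 0 := by
  simp [cross, crossProduct]

lemma outer_mul_outer (u v w x : V) : outer u v * outer w x = inner ℝ v w • outer u x := by
  ext i j
  simp only [outer, Matrix.mul_apply, Matrix.of_apply, Fin.sum_univ_three, Matrix.smul_apply,
    smul_eq_mul, inner_eq_sum]
  ring

lemma crossMat_mul_outer (η u v : V) : crossMat η * outer u v = outer (cross η u) v := by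
  ext i j
  fin_cases i <;> simp [outer, Matrix.mul_apply, Fin.sum_univ_three, crossMat, cross_apply_zero,
    cross_apply_one, cross_apply_two] <;> ring

lemma outer_mul_crossMat (η u v : V) : outer u v * crossMat η = - outer u (cross η v) := by
  ext i j
  fin_cases j <;> simp [outer, Matrix.mul_apply, Fin.sum_univ_three, crossMat, cross_apply_zero,
    cross_apply_one, cross_apply_two] <;> ring

lemma outer_zero_left (v : V) : outer 0 v = 0 := by ext i j; simp [outer]

lemma outer_zero_right (v : V) : outer v 0 = 0 := by ext i j; simp [outer]

lemma cross_self (u : V) : cross u u = 0 := by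
  ext i; fin_cases i <;> simp [cross_apply_zero, cross_apply_one, cross_apply_two] <;> ring

lemma cross_anticomm (u v : V) : cross u v = - cross v u := by
  ext i; fin_cases i <;> simp [cross_apply_zero, cross_apply_one, cross_apply_two] <;> ring

lemma inner_cross_left (u v : V) : inner ℝ u (cross u v) = 0 := by
  rw [inner_eq_sum, cross_apply_zero, cross_apply_one, cross_apply_two]; ring

lemma inner_cross_right (u v : V) : inner ℝ v (cross u v) = 0 := by
  rw [inner_eq_sum, cross_apply_zero, cross_apply_one, cross_apply_two]; ring

lemma cross_cross_self (u v : V) :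
    cross u (cross v u) = inner ℝ u u • v - inner ℝ v u • u := by
  rw [inner_eq_sum u u, inner_eq_sum v u]
  ext i
  fin_cases i <;> simp [cross_apply_zero, cross_apply_one, cross_apply_two] <;> ring

lemma inner_cross_cross (u v w : V) : inner ℝ (cross u v) (cross u w) =
    inner ℝ u u * inner ℝ v w - inner ℝ u v * inner ℝ u w := by
  simp only [inner_eq_sum, cross_apply_zero, cross_apply_one, cross_apply_two]; ring

lemma crossMat_mul_self (u : V) : crossMat u * crossMat u = outer u u - inner ℝ u u • 1 := by
  rw [inner_eq_sum u u]
  ext i j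
  fin_cases i <;> fin_cases j <;> simp [crossMat, outer_apply, Matrix.mul_apply,
    Fin.sum_univ_three] <;> ring

lemma outer_transpose (u v : V) : (outer u v)ᵀ = outer v u := by
  ext i j; simp [outer, mul_comm]

/-- The quadratic form `M ↦ ξ · M ξ`. -/
def normalPart (ξ : V) : Mat →ₗ[ℝ] ℝ where
  toFun M := ∑ i, ∑ j, ξ i * M i j * ξ j
  map_add' M N := by simp [mul_add, add_mul, Finset.sum_add_distrib]
  map_smul' c M := by
    simp only [Matrix.smul_apply, smul_eq_mul, Finset.mul_sum, RingHom.id_apply]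
    exact Finset.sum_congr rfl fun i _ => Finset.sum_congr rfl fun j _ => by ring

lemma normalPart_apply (ξ : V) (M : Mat) : normalPart ξ M = ∑ i, ∑ j, ξ i * M i j * ξ j := rfl

lemma outer_mul_mul_outer (ξ : V) (M : Mat) :
    outer ξ ξ * M * outer ξ ξ = normalPart ξ M • outer ξ ξ := by
  ext i j
  simp only [outer, Matrix.mul_apply, Matrix.of_apply, Fin.sum_univ_three, Matrix.smul_apply,
    smul_eq_mul, normalPart_apply]
  ring

section unit

variable {ξ h : V}

lemma inner_self_of_unit (hξ : ‖ξ‖ = 1) : inner ℝ ξ ξ = 1 := by simp [hξ]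

lemma outer_sq_of_unit (hξ : ‖ξ‖ = 1) : outer ξ ξ * outer ξ ξ = outer ξ ξ := by
  rw [outer_mul_outer, inner_self_of_unit hξ, one_smul]

lemma normalPart_one (hξ : ‖ξ‖ = 1) : normalPart ξ 1 = 1 := by
  have := inner_self_of_unit hξ
  rw [inner_eq_sum] at this
  simp [normalPart_apply, Matrix.one_apply, Fin.sum_univ_three]
  linarith

lemma normalPart_crossMat : normalPart ξ (crossMat h) = 0 := by
  simp [normalPart_apply, crossMat, Fin.sum_univ_three]; ring

/-- The decomposition of `𝓔(h)` with respect to a unit vector. -/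
lemma crossMat_eq (hξ : ‖ξ‖ = 1) : crossMat h =
    inner ℝ h ξ • crossMat ξ + outer (cross h ξ) ξ - outer ξ (cross h ξ) := by
  have h1 := inner_self_of_unit hξ
  rw [inner_eq_sum] at h1
  ext i j
  fin_cases i <;> fin_cases j <;> simp [crossMat, outer_apply, cross_apply_zero, cross_apply_one,
    cross_apply_two, inner_eq_sum]
  · ring
  · linear_combination h 2 * h1
  · linear_combination (-h 1) * h1
  · linear_combination (-h 2) * h1
  · ring
  · linear_combination (h 0) * h1
  · linear_combination (h 1) * h1
  · linear_combination (-h 0) * h1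
  · ring

/-- The component of `h` orthogonal to `ξ`. -/
noncomputable def tang (ξ h : V) : V := h - inner ℝ h ξ • ξ

lemma cross_cross_of_unit (hξ : ‖ξ‖ = 1) : cross ξ (cross h ξ) = tang ξ h := by
  rw [cross_cross_self, inner_self_of_unit hξ, one_smul]; rfl

lemma inner_tang (hξ : ‖ξ‖ = 1) : inner ℝ ξ (tang ξ h) = 0 := by
  rw [← cross_cross_of_unit hξ, inner_cross_left]

/-- The quadratic part of the gap, as an identity between matrices. -/
lemma gap_identity (hξ : ‖ξ‖ = 1) (am sm u v v2 v3 c0 : ℝ) :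
    (sm • (crossMat h - crossMat h * outer ξ ξ - outer ξ ξ * crossMat h) +
        (c0 * u) • (crossMat h * outer ξ ξ + outer ξ ξ * crossMat h)) *
      (am⁻¹ • (1 - outer ξ ξ) + c0⁻¹ • outer ξ ξ) *
      (sm • (crossMat h - crossMat h * outer ξ ξ - outer ξ ξ * crossMat h) +
        (c0 * u) • (crossMat h * outer ξ ξ + outer ξ ξ * crossMat h)) +
      (v - c0 * u ^ 2) • (crossMat h * outer ξ ξ * crossMat h) -
      (v • ((1 - outer ξ ξ) * (crossMat h * crossMat h) * (1 - outer ξ ξ)) +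
        (c0 * v2) • ((1 - outer ξ ξ) * (crossMat h * crossMat h) * outer ξ ξ +
          outer ξ ξ * (crossMat h * crossMat h) * (1 - outer ξ ξ)) +
        (c0 ^ 2 * v3) • (outer ξ ξ * (crossMat h * crossMat h) * outer ξ ξ)) =
    ((v - am⁻¹ * sm ^ 2) * inner ℝ h ξ ^ 2) • (1 - outer ξ ξ) +
      (c0 ^ 2 * (v3 - am⁻¹ * u ^ 2) * ‖cross h ξ‖ ^ 2) • outer ξ ξ -
      (c0 * (v2 - am⁻¹ * u * sm) * inner ℝ h ξ) • (outer (tang ξ h) ξ + outer ξ (tang ξ h)) := by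
  set p : ℝ := inner ℝ h ξ with hp
  set k := cross h ξ with hk
  set g := tang ξ h with hg
  have kξ : inner ℝ ξ k = 0 := inner_cross_right h ξ
  have ξk : inner ℝ k ξ = 0 := by rw [real_inner_comm]; exact kξ
  have kk : inner ℝ k k = ‖k‖ ^ 2 := real_inner_self_eq_norm_sq k
  have gξ : inner ℝ ξ g = 0 := inner_tang hξ
  have ξg : inner ℝ g ξ = 0 := by rw [real_inner_comm]; exact gξ
  have Xk : cross ξ k = g := cross_cross_of_unit hξ
  have X2 : crossMat ξ * crossMat ξ = outer ξ ξ - 1 := by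
    rw [crossMat_mul_self, inner_self_of_unit hξ, one_smul]
  have hE : crossMat h = p • crossMat ξ + outer k ξ - outer ξ k := crossMat_eq hξ
  have hEX : crossMat h * outer ξ ξ = outer k ξ := crossMat_mul_outer h ξ ξ
  have hXE : outer ξ ξ * crossMat h = - outer ξ k := outer_mul_crossMat h ξ ξ
  -- 𝓔(h) has no normal-normal component, so removing its normal column and row leaves the
  -- tangential block, which is a rotation generator about ξ.
  have hG : crossMat h - crossMat h * outer ξ ξ - outer ξ ξ * crossMat h = p • crossMat ξ := by
    rw [hEX, hXE, hE]; abel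
  have hE2 : crossMat h * crossMat h = p ^ 2 • (outer ξ ξ - 1) + p • (outer g ξ + outer ξ g)
      - outer k k - ‖k‖ ^ 2 • outer ξ ξ := by
    rw [hE]
    simp only [add_mul, mul_add, sub_mul, mul_sub, smul_mul_assoc, mul_smul_comm, X2,
      crossMat_mul_outer, outer_mul_crossMat, outer_mul_outer, Xk, cross_self, kξ, ξk, kk,
      inner_self_of_unit hξ, outer_zero_left, outer_zero_right,
      zero_smul, smul_zero, sub_zero, add_zero, zero_add, neg_zero]
    module
  have hEE : crossMat h * outer ξ ξ * crossMat h = - outer k k := by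
    rw [hEX, outer_mul_crossMat]
  -- Both sides are now combinations of the identity and of outer products of ξ, `k`, `g`. The terms
  -- `outer k k` cancel: `-c0 u²` from the first-order product against `c0 u²`, and `-v` against `v`
  -- from the tangential block of 𝓔(h)².
  rw [hG, hEE, hE2, hEX, hXE]
  simp only [add_mul, mul_add, sub_mul, mul_sub, smul_mul_assoc, mul_smul_comm, X2,
    crossMat_mul_outer, outer_mul_crossMat, outer_mul_outer, Xk, cross_self, kξ, ξk, kk, gξ, ξg,
    inner_self_of_unit hξ, outer_zero_left, outer_zero_right, mul_one, one_mul, mul_neg, neg_mul,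
    zero_smul, smul_zero, sub_zero, add_zero, zero_add, neg_zero]
  match_scalars <;> field_simp <;> ring

end unit

/-! ### The corrector and the effective conductivity of a laminate -/

lemma normalPart_eq_inner (ξ : V) (M : Mat) : normalPart ξ M = inner ℝ (mulV M ξ) ξ := by
  simp only [inner_mulV, normalPart_apply, Fin.sum_univ_three]
  ring

lemma MemM.normalPart_bounds {α β : ℝ} (hβ : 0 < β) {A : V → Mat} (hA : MemM α β A) {ξ : V}
    (hξ : ‖ξ‖ = 1) : ∀ᵐ y, α ≤ normalPart ξ (A y) ∧ normalPart ξ (A y) ≤ β := by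
  filter_upwards [hA.bounds, hA.norm_mulV_le hβ] with y h1 h2
  rw [normalPart_eq_inner]
  refine ⟨by simpa [hξ] using h1.2.1 ξ, (real_inner_le_norm _ _).trans ?_⟩
  simpa [hξ] using h2 ξ

lemma MemM.matBdd {α β : ℝ} (hβ : 0 < β) {A : V → Mat} (hA : MemM α β A) : MatBdd volume A :=
  fun i j => memLp_top_of_bound (hA.measurable i j).aestronglyMeasurable β (by
    filter_upwards [hA.abs_le hβ] with y hy using hy i j)

lemma measurable_normalPart {X : Type*} [MeasurableSpace X] {A : X → Mat}
    (hA : ∀ i j, Measurable fun y => A y i j) (ξ : V) : Measurable fun y => normalPart ξ (A y) := by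
  simp only [normalPart_apply]
  exact Finset.measurable_fun_sum _ fun i _ => Finset.measurable_fun_sum _ fun j _ =>
    ((hA i j).const_mul _).mul_const _

lemma MemM.memLp_normalPart_inv {α β : ℝ} (hα : 0 < α) (hβ : 0 < β) {A : V → Mat}
    (hA : MemM α β A) {ξ : V} (hξ : ‖ξ‖ = 1) :
    MemLp (fun y => (normalPart ξ (A y))⁻¹) ⊤ volume :=
  memLp_top_of_bound (measurable_normalPart hA.measurable ξ).inv.aestronglyMeasurable α⁻¹ (by
    filter_upwards [hA.normalPart_bounds hβ hξ] with y hy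
    rw [Real.norm_of_nonneg (inv_nonneg.2 (hα.le.trans hy.1))]
    exact inv_anti₀ hα hy.1)

lemma MatBdd.smul {X : Type*} [MeasurableSpace X] {μ : Measure X} {f : X → ℝ} {F : X → Mat}
    (hf : MemLp f ⊤ μ) (hF : MatBdd μ F) : MatBdd μ fun x => f x • F x :=
  fun i j => memLp_top_mul hf (hF i j)

lemma MatBdd.linearMap {X : Type*} [MeasurableSpace X] {μ : Measure X} (L : Mat →ₗ[ℝ] Mat)
    {F : X → Mat} (hF : MatBdd μ F) : MatBdd μ fun x => L (F x) := by
  rw [matBdd_iff] at hF ⊢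
  have := memLp_top_clm (LinearMap.toContinuousLinearMap
    (toOp.toLinearMap ∘ₗ L ∘ₗ toOp.symm.toLinearMap)) hF
  simpa using this

lemma MatBdd.mul {X : Type*} [MeasurableSpace X] {μ : Measure X}
    {F G : X → Mat} (hF : MatBdd μ F) (hG : MatBdd μ G) : MatBdd μ fun x => F x * G x := by
  rw [matBdd_iff] at hF hG ⊢
  simpa using memLp_top_mul hF hG

lemma MatBdd.add {X : Type*} [MeasurableSpace X] {μ : Measure X}
    {F G : X → Mat} (hF : MatBdd μ F) (hG : MatBdd μ G) : MatBdd μ fun x => F x + G x :=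
  fun i j => (hF i j).add (hG i j)

lemma MatBdd.sub {X : Type*} [MeasurableSpace X] {μ : Measure X}
    {F G : X → Mat} (hF : MatBdd μ F) (hG : MatBdd μ G) : MatBdd μ fun x => F x - G x :=
  fun i j => (hF i j).sub (hG i j)

lemma MatBdd.const {X : Type*} [MeasurableSpace X] {μ : Measure X} (M : Mat) :
    MatBdd μ fun _ => M :=
  fun i j => memLp_top_const (M i j)

section cell

variable (b : Module.Basis (Fin 3) ℝ V)

lemma integrable_cell {f : V → ℝ} (hf : MemLp f ⊤ volume) : Integrable f (cellMeas b) :=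
  (memLp_top_mono (cellMeas_ac b) hf).integrable le_top

lemma integrable_toOp_cell {F : V → Mat} (hF : MatBdd volume F) :
    Integrable (fun y => toOp (F y)) (cellMeas b) :=
  (memLp_top_mono (cellMeas_ac b) (matBdd_iff.1 hF)).integrable le_top

lemma cellAvg_add {F G : V → Mat} (hF : MatBdd volume F) (hG : MatBdd volume G) :
    cellAvg b (fun y => F y + G y) = cellAvg b F + cellAvg b G := by
  ext i j
  exact integral_add (integrable_cell b (hF i j)) (integrable_cell b (hG i j))

lemma cellAvg_sub {F G : V → Mat} (hF : MatBdd volume F) (hG : MatBdd volume G) :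
    cellAvg b (fun y => F y - G y) = cellAvg b F - cellAvg b G := by
  ext i j
  exact integral_sub (integrable_cell b (hF i j)) (integrable_cell b (hG i j))

lemma cellAvg_linearMap (L : Mat →ₗ[ℝ] Mat) {F : V → Mat} (hF : MatBdd volume F) :
    cellAvg b (fun y => L (F y)) = L (cellAvg b F) := by
  apply toOp.injective
  rw [toOp_cellAvg b (integrable_toOp_cell b (hF.linearMap L))]
  have := (LinearMap.toContinuousLinearMap
    (toOp.toLinearMap ∘ₗ L ∘ₗ toOp.symm.toLinearMap)).integral_comp_comm
      (integrable_toOp_cell b hF)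
  rw [← toOp_cellAvg b (integrable_toOp_cell b hF)] at this
  simpa using this

lemma cellAvg_smul_const (f : V → ℝ) (M : Mat) :
    cellAvg b (fun y => f y • M) = (⨍ y in ZSpan.fundamentalDomain b, f y) • M := by
  ext i j
  exact integral_mul_const (M i j) f

end cell

/-- Since |ξ| = 1, the profile is recovered by restricting the field to the line spanned by ξ. -/
lemma measurable_of_layered {ξ : V} (hξ : ‖ξ‖ = 1) {B : ℝ → Mat}
    (hB : ∀ i j, Measurable fun y => layered ξ B y i j) (i j : Fin 3) :
    Measurable fun t => B t i j := by
  have h : Measurable fun t : ℝ => t • ξ := measurable_id.smul_const ξ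
  have := (hB i j).comp h
  simpa [Function.comp_def, layered, inner_smul_right, hξ] using this

lemma periodic_of_layered {X : Type*} {ξ : V} (hξ : ‖ξ‖ = 1) {B : ℝ → X} {z : V}
    (hB : ∀ y, layered ξ B (y + z) = layered ξ B y) : Function.Periodic B (inner ℝ ξ z) := by
  intro t
  simpa [layered, inner_add_right, inner_smul_right, hξ] using hB (t • ξ)

lemma rankOneGrad_eq (ξ w : V) : rankOneGrad ξ w = 1 + outer ξ w := by
  ext i j
  simp [rankOneGrad, outer_apply, Matrix.one_apply]

/-- The average of `S / (ξ · S ξ)`. -/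
noncomputable def normalizedAvg (b : Module.Basis (Fin 3) ℝ V) (ξ : V) (S : V → Mat) : Mat :=
  cellAvg b fun y => (normalPart ξ (S y))⁻¹ • S y

/-- The average of `1 / (ξ · S ξ)`. -/
noncomputable def invNormalAvg (b : Module.Basis (Fin 3) ℝ V) (ξ : V) (S : V → Mat) : ℝ :=
  ⨍ y in ZSpan.fundamentalDomain b, (normalPart ξ (S y))⁻¹

/-- The gradient of the corrector of a laminate. -/
noncomputable def laminateGrad (b : Module.Basis (Fin 3) ℝ V) (ξ : V) (S : V → Mat) (y : V) : Mat :=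
  1 + (normalPart ξ (S y))⁻¹ • ((invNormalAvg b ξ S)⁻¹ • (outer ξ ξ * normalizedAvg b ξ S) -
    outer ξ ξ * S y)

/-- The effective conductivity of a laminate. -/
noncomputable def laminateCond (b : Module.Basis (Fin 3) ℝ V) (ξ : V) (S : V → Mat) : Mat :=
  cellAvg b (fun y => S y - ((normalPart ξ (S y))⁻¹ • S y) * outer ξ ξ * S y) +
    (invNormalAvg b ξ S)⁻¹ • (normalizedAvg b ξ S * outer ξ ξ * normalizedAvg b ξ S)

lemma MemM.invNormalAvg_bounds (b : Module.Basis (Fin 3) ℝ V) {α β : ℝ} (hα : 0 < α) (hβ : 0 < β)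
    {S : V → Mat} (hS : MemM α β S) {ξ : V} (hξ : ‖ξ‖ = 1) :
    β⁻¹ ≤ invNormalAvg b ξ S := by
  have h1 : ∫ _y, β⁻¹ ∂cellMeas b ≤ ∫ y, (normalPart ξ (S y))⁻¹ ∂cellMeas b := by
    refine integral_mono_ae (integrable_const _)
      (integrable_cell b (hS.memLp_normalPart_inv hα hβ hξ)) ?_
    filter_upwards [ae_cellMeas b (hS.normalPart_bounds hβ hξ)] with y hy
    exact inv_anti₀ (hα.trans_le hy.1) hy.2
  rw [integral_const, probReal_univ, one_smul] at h1
  exact h1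

section laminate

variable {b : Module.Basis (Fin 3) ℝ V} {α β : ℝ} {ξ : V} {B : ℝ → Mat}

/-- With κ = ξ·Bξ, the normal row of B(I + ξwᵀ) is Bᵀξ + κw. It equals a constant c exactly when w =
κ⁻¹(c − Bᵀξ), and ⟨w⟩ = 0 gives c = m⁻¹Tᵀξ with m = ⟨κ⁻¹⟩ and T = ⟨κ⁻¹B⟩. -/
theorem isCorrector_laminateGrad (hα : 0 < α) (hβ : 0 < β) (hξ : ‖ξ‖ = 1)
    (hB : MemM α β (layered ξ B)) (hBp : ∀ i y, layered ξ B (y + b i) = layered ξ B y) :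
    IsCorrector b (layered ξ B) (laminateGrad b ξ (layered ξ B)) := by
  have hξ0 : ξ ≠ 0 := by rintro rfl; simp at hξ
  have hmeas := measurable_of_layered hξ hB.measurable
  have hκm : Measurable fun t => normalPart ξ (B t) := measurable_normalPart hmeas ξ
  have hmp := (inv_pos.2 hβ).trans_le (hB.invNormalAvg_bounds b hα hβ hξ)
  set m := invNormalAvg b ξ (layered ξ B) with hm
  set T := normalizedAvg b ξ (layered ξ B) with hT
  set c : V := WithLp.toLp 2 fun j => m⁻¹ * ∑ i, ξ i * T i j with hc
  have hcj : ∀ j, c j = m⁻¹ * ∑ i, ξ i * T i j := fun j => rfl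
  set w : ℝ → V := fun t => WithLp.toLp 2 fun j =>
    (normalPart ξ (B t))⁻¹ * (c j - ∑ i, ξ i * B t i j) with hw
  have hwj : ∀ t j, w t j = (normalPart ξ (B t))⁻¹ * (c j - ∑ i, ξ i * B t i j) := fun t j => rfl
  have hbd : ∀ᵐ t, ∀ i j, |B t i j| ≤ β := by
    refine (ae_layered_iff hξ0 (p := fun t => ∀ i j, |B t i j| ≤ β) ?_).1 (hB.abs_le hβ)
    simp only [Set.ofPred_forall]
    exact MeasurableSet.iInter fun i => MeasurableSet.iInter fun j =>
      measurableSet_le (hmeas i j).abs measurable_const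
  have hκ : ∀ᵐ t, α ≤ normalPart ξ (B t) := by
    refine (ae_layered_iff hξ0 (p := fun t => α ≤ normalPart ξ (B t))
      (measurableSet_le measurable_const hκm)).1 ?_
    filter_upwards [hB.normalPart_bounds hβ hξ] with y hy using hy.1
  have hP : laminateGrad b ξ (layered ξ B) = layered ξ fun t => rankOneGrad ξ (w t) := by
    ext y i j
    simp only [laminateGrad, layered, rankOneGrad_eq, Matrix.add_apply, Matrix.smul_apply,
      Matrix.sub_apply, Matrix.mul_apply, outer_apply, smul_eq_mul, hwj, hcj, ← hm, ← hT,
      Fin.sum_univ_three]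
    ring
  rw [hP]
  have hξ1 : ∀ i, |ξ i| ≤ 1 := fun i => by simpa [hξ] using PiLp.norm_apply_le ξ i
  refine isCorrector_layered (C := β) (C' := α⁻¹ * (‖c‖ + 3 * β)) (c := c) hξ hmeas hbd
    (fun j => ?_) ?_ (fun i j t => ?_) (fun j => ?_) ?_
  · simp only [hwj]
    exact hκm.inv.mul (measurable_const.sub
      (Finset.measurable_fun_sum _ fun i _ => (hmeas i j).const_mul _))
  · filter_upwards [hbd, hκ] with t h1 h2 j
    rw [hwj, abs_mul, abs_of_nonneg (inv_nonneg.2 (hα.le.trans h2))]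
    refine mul_le_mul (inv_anti₀ hα h2) ?_ (abs_nonneg _) (inv_nonneg.2 hα.le)
    refine (abs_sub _ _).trans (add_le_add (PiLp.norm_apply_le c j) ?_)
    refine (Finset.abs_sum_le_sum_abs _ _).trans ?_
    have : ∀ i ∈ Finset.univ, |ξ i * B t i j| ≤ β := fun i _ => by
      rw [abs_mul]
      nlinarith [hξ1 i, h1 i j, abs_nonneg (ξ i), abs_nonneg (B t i j)]
    simpa using Finset.sum_le_sum this
  · simp only [hwj]
    rw [periodic_of_layered hξ (hBp i) t]
  · have h0 : ⨍ y in ZSpan.fundamentalDomain b, layered ξ (fun t => w t j) y = 0 := by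
      rw [setAverage_eq_integral_cellMeas]
      have hk := hB.memLp_normalPart_inv hα hβ hξ
      have hkB : ∀ i, Integrable (fun y => (normalPart ξ (layered ξ B y))⁻¹ * layered ξ B y i j)
          (cellMeas b) := fun i => integrable_cell b (MatBdd.smul hk (hB.matBdd hβ) i j)
      have e : ∀ y, layered ξ (fun t => w t j) y = c j * (normalPart ξ (layered ξ B y))⁻¹ -
          ∑ i, ξ i * ((normalPart ξ (layered ξ B y))⁻¹ * layered ξ B y i j) := fun y => by
        simp only [layered, hwj, Fin.sum_univ_three]; ring
      simp_rw [e]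
      rw [integral_sub ((integrable_cell b hk).const_mul _)
        (integrable_finsetSum _ fun i _ => (hkB i).const_mul _), integral_const_mul,
        integral_finsetSum _ fun i _ => (hkB i).const_mul _]
      simp_rw [integral_const_mul]
      have e2 : ∫ y, (normalPart ξ (layered ξ B y))⁻¹ ∂cellMeas b = m := rfl
      have e3 : ∀ i, ∫ y, (normalPart ξ (layered ξ B y))⁻¹ * layered ξ B y i j ∂cellMeas b = T i j :=
        fun i => rfl
      simp_rw [e2, e3, hcj]
      field_simp
      ring
    rw [← measure_smul_setAverage _ (cell_finite (b := b)), h0, smul_zero]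
  · filter_upwards [hκ] with t ht j
    have hκ0 : normalPart ξ (B t) ≠ 0 := (hα.trans_le ht).ne'
    have e : ∑ i, ξ i * (B t * rankOneGrad ξ (w t)) i j =
        ∑ i, ξ i * B t i j + normalPart ξ (B t) * w t j := by
      rw [rankOneGrad_eq, mul_add, mul_one]
      simp only [Matrix.add_apply, Matrix.mul_apply, outer_apply, normalPart_apply,
        Fin.sum_univ_three]
      ring
    rw [e, hwj]
    field_simp
    ring

/-- Uniqueness replaces an arbitrary corrector by the explicit one on the cell, which is all that
the average sees. The part of the flux containing averaged quantities is linear in κ⁻¹S, so its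
average is explicit. -/
theorem effCond_eq_laminateCond (hα : 0 < α) (hβ : 0 < β) (hξ : ‖ξ‖ = 1)
    (hB : MemM α β (layered ξ B)) (hBp : ∀ i y, layered ξ B (y + b i) = layered ξ B y)
    {P : V → Mat} (hP : IsCorrector b (layered ξ B) P) :
    (∀ᵐ y ∂cellMeas b, P y = laminateGrad b ξ (layered ξ B) y) ∧
      effCond b (layered ξ B) P = laminateCond b ξ (layered ξ B) := by
  have h1 : ∀ᵐ y ∂cellMeas b, P y = laminateGrad b ξ (layered ξ B) y :=
    (cellMeas_ac_restrict b).ae_le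
      (hP.unique hα hβ hB hBp (isCorrector_laminateGrad hα hβ hξ hB hBp))
  refine ⟨h1, ?_⟩
  set S := layered ξ B with hS
  have hk := hB.memLp_normalPart_inv hα hβ hξ
  have hSb : MatBdd volume S := hB.matBdd hβ
  have hX : MatBdd volume fun y => (normalPart ξ (S y))⁻¹ • S y := hSb.smul hk
  set L : Mat →ₗ[ℝ] Mat := LinearMap.mulRight ℝ
    ((invNormalAvg b ξ S)⁻¹ • (outer ξ ξ * normalizedAvg b ξ S)) with hL
  have e : ∀ y, S y * laminateGrad b ξ S y =
      (S y - ((normalPart ξ (S y))⁻¹ • S y) * outer ξ ξ * S y) +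
        L ((normalPart ξ (S y))⁻¹ • S y) := fun y => by
    simp only [laminateGrad, hL, LinearMap.mulRight_apply, mul_add, mul_sub, mul_one,
      mul_smul_comm, smul_mul_assoc, smul_sub, mul_assoc]
    rw [smul_comm]
    abel
  rw [effCond, cellAvg_congr b (G := fun y => (S y - ((normalPart ξ (S y))⁻¹ • S y) *
    outer ξ ξ * S y) + L ((normalPart ξ (S y))⁻¹ • S y))
    (by filter_upwards [h1] with y hy; rw [hy, e]),
    cellAvg_add b (hSb.sub ((hX.mul (MatBdd.const _)).mul hSb)) (hX.linearMap L),
    cellAvg_linearMap b L hX, laminateCond, hL, LinearMap.mulRight_apply]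
  simp only [normalizedAvg, mul_smul_comm, mul_assoc]

end laminate

/-! ### Expansion of the effective conductivity -/

lemma matExp_unit_congr {F G : V → Mat} {f0 g0 : Mat} {f1 f2 g1 g2 : V → Mat}
    (hf : MatExp (Measure.dirac ()) (fun h _ => F h) (fun _ => f0) (fun h _ => f1 h)
      (fun h _ => f2 h))
    (hF : ∀ h, F h = G h) (h0 : f0 = g0) (h1 : ∀ h, f1 h = g1 h) (h2 : ∀ h, f2 h = g2 h) :
    MatExp (Measure.dirac ()) (fun h _ => G h) (fun _ => g0) (fun h _ => g1 h)
      (fun h _ => g2 h) :=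
  hf.congr (.of_forall fun h => .of_forall fun _ => hF h) (.of_forall fun _ => h0)
    (fun h => .of_forall fun _ => h1 h) (fun h => .of_forall fun _ => h2 h)

section expansion

variable {b : Module.Basis (Fin 3) ℝ V} {α β : ℝ} {ξ : V} {S : V → V → Mat} {a s : V → ℝ}
  {Q : V → V → Mat}

section

variable (hα : 0 < α) (hβ : 0 < β) (hξ : ‖ξ‖ = 1) (hS : ∀ᶠ h in 𝓝 (0 : V), MemM α β (S h))
  (ha : ∀ y, α ≤ a y) (ham : MemLp a ⊤ volume)
  (hexp : MatExp volume S (fun y => a y • (1 : Mat)) (fun h y => s y • crossMat h) Q)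

include hα ha ham in
lemma memLp_inv_of_le : MemLp (fun y => (a y)⁻¹) ⊤ volume :=
  memLp_top_of_bound (ham.1.aemeasurable.inv.aestronglyMeasurable) α⁻¹ (.of_forall fun y => by
    rw [Real.norm_of_nonneg (inv_nonneg.2 (hα.le.trans (ha y)))]
    exact inv_anti₀ hα (ha y))

include hα hβ hξ hS ha ham hexp

/-- Scalars are carried as multiples of the identity, so that the matrix rules for products and
inverses apply. There is no linear term because ξ·𝓔(h)ξ = 0. -/
lemma matExp_normalPart_inv :
    MatExp volume (fun h y => (normalPart ξ (S h y))⁻¹ • (1 : Mat)) (fun y => (a y)⁻¹ • (1 : Mat))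
      (fun _ _ => 0) (fun h y => (-((a y)⁻¹ ^ 2 * normalPart ξ (Q h y))) • (1 : Mat)) := by
  have h1 := hexp.linearMap ((normalPart ξ).smulRight (1 : Mat))
  have h2 := h1.inv (C := α⁻¹) (G := fun h y => (normalPart ξ (S h y))⁻¹ • (1 : Mat))
    (g0 := fun y => (a y)⁻¹ • (1 : Mat)) ?_ ?_
    ((MatBdd.const (1 : Mat)).smul (memLp_inv_of_le hα ha ham)) ?_
  · refine h2.congr (.of_forall fun h => .of_forall fun _ => rfl) (.of_forall fun _ => rfl)
      (fun h => .of_forall fun y => ?_) (fun h => .of_forall fun y => ?_)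
    · simp [normalPart_crossMat]
    · simp only [LinearMap.smulRight_apply, map_smul, normalPart_crossMat, smul_zero, zero_smul,
        mul_zero, zero_sub, mul_smul_comm, mul_one, smul_smul, neg_smul]
      congr 2
      ring
  · filter_upwards [hS] with h hh i j
    exact ((measurable_normalPart hh.measurable ξ).inv.mul_const _).aestronglyMeasurable
  · filter_upwards [hS] with h hh
    filter_upwards [hh.normalPart_bounds hβ hξ] with y hy
    have hp : 0 < normalPart ξ (S h y) := hα.trans_le hy.1
    refine ⟨?_, fun i j => ?_⟩
    · simp only [LinearMap.smulRight_apply, mul_smul_comm, mul_one, smul_smul]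
      rw [mul_inv_cancel₀ hp.ne', one_smul]
    · rw [Matrix.smul_apply, smul_eq_mul, abs_mul, abs_of_pos (inv_pos.2 hp)]
      have h5 : |(1 : Mat) i j| ≤ 1 := by
        rw [Matrix.one_apply]; split_ifs <;> simp
      calc _ ≤ α⁻¹ * 1 := mul_le_mul (inv_anti₀ hα hy.1) h5 (abs_nonneg _) (inv_nonneg.2 hα.le)
        _ = _ := mul_one _
  · refine .of_forall fun y => ?_
    have : a y ≠ 0 := (hα.trans_le (ha y)).ne'
    simp [normalPart_one hξ, this]

lemma matExp_normalized :
    MatExp volume (fun h y => (normalPart ξ (S h y))⁻¹ • S h y) (fun _ => (1 : Mat))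
      (fun h y => ((a y)⁻¹ * s y) • crossMat h)
      (fun h y => (a y)⁻¹ • Q h y - normalPart ξ ((a y)⁻¹ • Q h y) • (1 : Mat)) := by
  refine ((matExp_normalPart_inv hα hβ hξ hS ha ham hexp).mul hexp).congr
    (.of_forall fun h => .of_forall fun y => ?_) (.of_forall fun y => ?_)
    (fun h => .of_forall fun y => ?_) (fun h => .of_forall fun y => ?_)
  · simp
  · have : a y ≠ 0 := (hα.trans_le (ha y)).ne'
    simp [this]
  · simp [smul_smul, mul_comm]
  · have : a y ≠ 0 := (hα.trans_le (ha y)).ne'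
    simp only [smul_mul_assoc, mul_smul_comm, mul_one, one_mul, zero_mul, map_smul, smul_eq_mul]
    match_scalars <;> field_simp

/-- At second order, the contribution of Q is Q − QΞ − ΞQ + (ξ·Qξ)Ξ with Ξ = ξξᵀ. Since ΞQΞ =
(ξ·Qξ)Ξ, this is the tangential block of Q. -/
lemma matExp_schur :
    MatExp volume (fun h y => S h y - ((normalPart ξ (S h y))⁻¹ • S h y) * outer ξ ξ * S h y)
      (fun y => a y • (1 - outer ξ ξ))
      (fun h y => s y • (crossMat h - crossMat h * outer ξ ξ - outer ξ ξ * crossMat h))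
      (fun h y => (1 - outer ξ ξ) * Q h y * (1 - outer ξ ξ) -
        ((a y)⁻¹ * s y ^ 2) • (crossMat h * outer ξ ξ * crossMat h)) := by
  have h1 := hexp.sub ((((matExp_normalized hα hβ hξ hS ha ham hexp).mul
    (MatExp.const (MatBdd.const (outer ξ ξ)))).mul hexp))
  refine h1.congr (.of_forall fun h => .of_forall fun y => rfl) (.of_forall fun y => ?_)
    (fun h => .of_forall fun y => ?_) (fun h => .of_forall fun y => ?_)
  · simp [smul_sub]
  · have : a y ≠ 0 := (hα.trans_le (ha y)).ne'
    simp only [smul_mul_assoc, mul_smul_comm, mul_one, one_mul, mul_zero, zero_add]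
    match_scalars <;> field_simp
  · have h0 : a y ≠ 0 := (hα.trans_le (ha y)).ne'
    have h2 : outer ξ ξ * (Q h y * outer ξ ξ) = normalPart ξ (Q h y) • outer ξ ξ := by
      rw [← mul_assoc, outer_mul_mul_outer]
    simp only [smul_mul_assoc, mul_smul_comm, mul_one, one_mul, mul_zero, zero_add, sub_mul,
      mul_sub, map_smul, smul_eq_mul, mul_assoc, h2, add_zero]
    match_scalars <;> field_simp

end

/-- The second order expansion of the effective conductivity of a laminate. -/
theorem matExp_laminateCond (b : Module.Basis (Fin 3) ℝ V) (hα : 0 < α) (hβ : 0 < β)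
    (hξ : ‖ξ‖ = 1) (hS : ∀ᶠ h in 𝓝 (0 : V), MemM α β (S h))
    (ha : ∀ y, α ≤ a y) (ham : MemLp a ⊤ volume) (hsm : MemLp s ⊤ volume)
    (hexp : MatExp volume S (fun y => a y • (1 : Mat)) (fun h y => s y • crossMat h) Q)
    {am sm u v c0 : ℝ} (hc0 : c0 ≠ 0)
    (eam : ⨍ y in ZSpan.fundamentalDomain b, a y = am)
    (ec0 : ⨍ y in ZSpan.fundamentalDomain b, (a y)⁻¹ = c0⁻¹)
    (esm : ⨍ y in ZSpan.fundamentalDomain b, s y = sm)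
    (eu : ⨍ y in ZSpan.fundamentalDomain b, (a y)⁻¹ * s y = u)
    (ev : ⨍ y in ZSpan.fundamentalDomain b, (a y)⁻¹ * s y ^ 2 = v) :
    MatExp (Measure.dirac ()) (fun h _ => laminateCond b ξ (S h))
      (fun _ => am • (1 - outer ξ ξ) + c0 • outer ξ ξ)
      (fun h _ => sm • (crossMat h - crossMat h * outer ξ ξ - outer ξ ξ * crossMat h) +
        (c0 * u) • (crossMat h * outer ξ ξ + outer ξ ξ * crossMat h))
      (fun h _ => (1 - outer ξ ξ) * cellAvg b (Q h) * (1 - outer ξ ξ) +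
        c0 • ((1 - outer ξ ξ) * cellAvg b (fun y => (a y)⁻¹ • Q h y) * outer ξ ξ +
          outer ξ ξ * cellAvg b (fun y => (a y)⁻¹ • Q h y) * (1 - outer ξ ξ)) +
        c0 ^ 2 • (outer ξ ξ * cellAvg b (fun y => (a y)⁻¹ ^ 2 • Q h y) * outer ξ ξ) -
        (v - c0 * u ^ 2) • (crossMat h * outer ξ ξ * crossMat h)) := by
  have hai := memLp_inv_of_le hα ha ham
  have hQ : ∀ h, MatBdd volume (Q h) := fun h => matBdd_iff.2 (hexp.two.memLp h)
  have hQ1 : ∀ h, MatBdd volume fun y => (a y)⁻¹ • Q h y := fun h => (hQ h).smul hai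
  have hai2 : MemLp (fun y => (a y)⁻¹ ^ 2) ⊤ volume := by
    simpa only [pow_two] using memLp_top_mul hai hai
  have hQ2 : ∀ h, MatBdd volume fun y => (a y)⁻¹ ^ 2 • Q h y := fun h => (hQ h).smul hai2
  have has2 : MemLp (fun y => (a y)⁻¹ * s y ^ 2) ⊤ volume := by
    simpa only [pow_two] using memLp_top_mul hai (memLp_top_mul hsm hsm)
  have hZ : MatExp (Measure.dirac ())
      (fun h _ => cellAvg b fun y =>
        S h y - ((normalPart ξ (S h y))⁻¹ • S h y) * outer ξ ξ * S h y)
      (fun _ => am • (1 - outer ξ ξ))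
      (fun h _ => sm • (crossMat h - crossMat h * outer ξ ξ - outer ξ ξ * crossMat h))
      (fun h _ => (1 - outer ξ ξ) * cellAvg b (Q h) * (1 - outer ξ ξ) -
        v • (crossMat h * outer ξ ξ * crossMat h)) := by
    refine matExp_unit_congr ((matExp_schur hα hβ hξ hS ha ham hexp).cellAvg b) (fun _ => rfl)
      ?_ (fun h => ?_) (fun h => ?_)
    · rw [cellAvg_smul_const, eam]
    · rw [cellAvg_smul_const, esm]
    · have e := cellAvg_linearMap b (LinearMap.mulLeftRight ℝ (1 - outer ξ ξ, 1 - outer ξ ξ))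
        (hQ h)
      have hb := (hQ h).linearMap (LinearMap.mulLeftRight ℝ (1 - outer ξ ξ, 1 - outer ξ ξ))
      simp only [LinearMap.mulLeftRight_apply] at e hb
      rw [cellAvg_sub b hb ((MatBdd.const _).smul has2), e, cellAvg_smul_const, ev]
  have hT : MatExp (Measure.dirac ()) (fun h _ => normalizedAvg b ξ (S h)) (fun _ => 1)
      (fun h _ => u • crossMat h)
      (fun h _ => cellAvg b (fun y => (a y)⁻¹ • Q h y) -
        normalPart ξ (cellAvg b fun y => (a y)⁻¹ • Q h y) • (1 : Mat)) := by
    refine matExp_unit_congr ((matExp_normalized hα hβ hξ hS ha ham hexp).cellAvg b)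
      (fun _ => rfl) ?_ (fun h => ?_) (fun h => ?_)
    · have := cellAvg_smul_const b (fun _ => 1) (1 : Mat)
      simpa [setAverage_eq_integral_cellMeas] using this
    · rw [cellAvg_smul_const, eu]
    · have e := cellAvg_linearMap b ((normalPart ξ).smulRight (1 : Mat)) (hQ1 h)
      have hb := (hQ1 h).linearMap ((normalPart ξ).smulRight (1 : Mat))
      simp only [LinearMap.smulRight_apply] at e hb
      rw [cellAvg_sub b (hQ1 h) hb, e]
  have hm : MatExp (Measure.dirac ()) (fun h _ => invNormalAvg b ξ (S h) • (1 : Mat))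
      (fun _ => c0⁻¹ • (1 : Mat)) (fun _ _ => 0)
      (fun h _ => -(normalPart ξ (cellAvg b fun y => (a y)⁻¹ ^ 2 • Q h y) • (1 : Mat))) := by
    refine matExp_unit_congr ((matExp_normalPart_inv hα hβ hξ hS ha ham hexp).cellAvg b)
      (fun h => ?_) ?_ (fun h => ?_) (fun h => ?_)
    · rw [cellAvg_smul_const]; rfl
    · rw [cellAvg_smul_const, ec0]
    · have := cellAvg_smul_const b (fun _ => 0) (0 : Mat)
      simpa using this
    · have e := cellAvg_linearMap b (-(normalPart ξ).smulRight (1 : Mat)) (hQ2 h)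
      simpa [neg_smul, smul_smul] using e
  -- The inverse is bounded by β because the mean of 1/(ξ·Sξ) is at least β⁻¹.
  have hmi := hm.inv (C := β) (G := fun h _ => (invNormalAvg b ξ (S h))⁻¹ • (1 : Mat))
    (g0 := fun _ => c0 • (1 : Mat))
    (.of_forall fun h i j => aestronglyMeasurable_const) (by
      filter_upwards [hS] with h hh
      refine .of_forall fun _ => ?_
      have h1 := hh.invNormalAvg_bounds b hα hβ hξ
      have h2 : 0 < invNormalAvg b ξ (S h) := (inv_pos.2 hβ).trans_le h1
      refine ⟨by simp [h2.ne'], fun i j => ?_⟩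
      rw [Matrix.smul_apply, smul_eq_mul, abs_mul, abs_of_pos (inv_pos.2 h2)]
      have h5 : |(1 : Mat) i j| ≤ 1 := by
        rw [Matrix.one_apply]; split_ifs <;> simp
      calc _ ≤ β * 1 := mul_le_mul (inv_le_of_inv_le₀ hβ h1) h5 (abs_nonneg _) hβ.le
        _ = _ := mul_one _)
    (MatBdd.const _) (.of_forall fun _ => by simp [hc0])
  have hF := hZ.add (hmi.mul ((hT.mul (MatExp.const (MatBdd.const (outer ξ ξ)))).mul hT))
  refine matExp_unit_congr hF (fun h => ?_) ?_ (fun h => ?_) (fun h => ?_)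
  · simp [laminateCond]
  · simp
  · simp only [smul_mul_assoc, mul_smul_comm, mul_one, one_mul, mul_zero, zero_mul, neg_zero,
      zero_add, smul_zero, add_zero]
    module
  -- By this identity, the scalar subtracted in the second-order term of `hT` leaves only the two
  -- mixed blocks of the average of a⁻¹Q, and the second-order term of `hmi` becomes the normal
  -- block of the average of a⁻²Q.
  · have h2 : ∀ M : Mat, outer ξ ξ * (M * outer ξ ξ) = normalPart ξ M • outer ξ ξ := fun M => by
      rw [← mul_assoc, outer_mul_mul_outer]
    simp only [smul_mul_assoc, mul_smul_comm, mul_one, one_mul, mul_zero, zero_mul, neg_zero,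
      zero_add, smul_zero, add_zero, zero_sub, mul_neg, neg_neg, sub_mul, mul_sub,
      mul_assoc, smul_neg, h2]
    module

end expansion

/-! ### Effective and local Hall expansions -/

lemma ae_unit_iff {p : Unit → Prop} : (∀ᵐ x ∂Measure.dirac (), p x) ↔ p () := by
  simp [ae_dirac_eq]

lemma MatExp.apply_zero {X : Type*} [MeasurableSpace X] {μ : Measure X} {F : V → X → Mat}
    {f0 : X → Mat} {f1 f2 : V → X → Mat} (hf : MatExp μ F f0 f1 f2) : ∀ᵐ x ∂μ, F 0 x = f0 x := by
  filter_upwards [(hf.rem 1 one_pos).self_of_nhds, MatLin.smul hf.one 0 0, MatQuad.smul hf.two 0 0]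
    with x h1 h2 h3
  simp only [smul_zero, zero_smul, ne_eq, OfNat.ofNat_ne_zero, not_false_eq_true, zero_pow]
    at h2 h3
  rw [h2, h3, map_zero] at h1
  simp only [sub_zero, norm_zero, ne_eq, OfNat.ofNat_ne_zero, not_false_eq_true, zero_pow,
    mul_zero, norm_le_zero_iff, sub_eq_zero] at h1
  exact toOp.injective h1

section unit

variable {F : V → Mat} {f0 g0 : Mat} {f1 f2 : V → Mat}

lemma MatExp.tendsto_unit (hf : MatExp (Measure.dirac ()) (fun h _ => F h) (fun _ => f0)
    (fun h _ => f1 h) (fun h _ => f2 h)) (i j : Fin 3) :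
    Filter.Tendsto (fun h => F h i j) (𝓝 0) (𝓝 (f0 i j)) := by
  obtain ⟨C1, hC1, h1⟩ := hf.one.bound
  obtain ⟨C2, hC2, h2⟩ := hf.two.bound
  simp only [ae_unit_iff] at h1 h2
  rw [tendsto_iff_norm_sub_tendsto_zero]
  have hlim : Filter.Tendsto (fun h : V => 1 * ‖h‖ ^ 2 + C1 * ‖h‖ + C2 * ‖h‖ ^ 2) (𝓝 0) (𝓝 0) := by
    have : Continuous fun h : V => 1 * ‖h‖ ^ 2 + C1 * ‖h‖ + C2 * ‖h‖ ^ 2 := by fun_prop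
    simpa using this.tendsto 0
  refine squeeze_zero' (.of_forall fun _ => norm_nonneg _) ?_ hlim
  filter_upwards [hf.rem 1 one_pos] with h h3
  rw [ae_unit_iff] at h3
  have h4 : ‖F h i j - f0 i j‖ ≤ ‖toOp (F h) - toOp (f0)‖ := by
    rw [← map_sub]; exact abs_entry_le (F h - f0) i j
  have e : toOp (F h) - toOp f0 =
      (toOp (F h) - toOp f0 - toOp (f1 h) - toOp (f2 h)) + toOp (f1 h) + toOp (f2 h) := by abel
  rw [e] at h4
  exact h4.trans ((norm_add_le _ _).trans (add_le_add ((norm_add_le _ _).trans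
    (add_le_add h3 (h1 h))) (h2 h)))

/-- An expansion of constants converges entrywise to `f0`, whose determinant is nonzero. Near the
origin `F h` is therefore invertible with bounded inverse, as `MatExp.inv` requires. -/
lemma MatExp.inv_unit (hf : MatExp (Measure.dirac ()) (fun h _ => F h) (fun _ => f0)
    (fun h _ => f1 h) (fun h _ => f2 h)) (hfg : f0 * g0 = 1) :
    MatExp (Measure.dirac ()) (fun h _ => (F h)⁻¹) (fun _ => g0) (fun h _ => -(g0 * f1 h * g0))
      (fun h _ => g0 * f1 h * g0 * f1 h * g0 - g0 * f2 h * g0) := by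
  have hlim : Filter.Tendsto F (𝓝 0) (𝓝 f0) :=
    tendsto_pi_nhds.2 fun i => tendsto_pi_nhds.2 fun j => hf.tendsto_unit i j
  have hdet : f0.det ≠ 0 := fun h0 => by
    have := congrArg Matrix.det hfg
    simp [h0] at this
  have c1 : Continuous fun M : Mat => M.det := Continuous.matrix_det continuous_id
  have hd : Filter.Tendsto (fun h => (F h).det) (𝓝 0) (𝓝 f0.det) := (c1.tendsto f0).comp hlim
  have hne : ∀ᶠ h in 𝓝 (0 : V), (F h).det ≠ 0 := hd.eventually_ne hdet
  have hinv : ∀ i j, Filter.Tendsto (fun h => (F h)⁻¹ i j) (𝓝 0)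
      (𝓝 (f0.det⁻¹ * f0.adjugate i j)) := fun i j => by
    have c2 : Continuous fun M : Mat => M.adjugate i j :=
      (Continuous.matrix_adjugate continuous_id).matrix_elem i j
    have e : (fun h => (F h)⁻¹ i j) = fun h => (F h).det⁻¹ * (F h).adjugate i j := by
      ext h; simp [Matrix.inv_def]
    rw [e]
    exact (hd.inv₀ hdet).mul ((c2.tendsto f0).comp hlim)
  set C : ℝ := ∑ i, ∑ j, (|f0.det⁻¹ * f0.adjugate i j| + 1) with hC
  refine hf.inv (C := C) (g0 := fun _ => g0) (.of_forall fun h i j => aestronglyMeasurable_const)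
    ?_ (MatBdd.const _) (.of_forall fun _ => hfg)
  have hbd : ∀ᶠ h in 𝓝 (0 : V), ∀ i j, |(F h)⁻¹ i j| ≤ C := by
    rw [Filter.eventually_all]; intro i
    rw [Filter.eventually_all]; intro j
    filter_upwards [(hinv i j).abs.eventually_le_const (lt_add_one _)] with h hh
    refine hh.trans ?_
    refine (Finset.single_le_sum (f := fun j => |f0.det⁻¹ * f0.adjugate i j| + 1)
      (fun _ _ => by positivity) (Finset.mem_univ j)).trans ?_
    exact Finset.single_le_sum (f := fun i => ∑ j, (|f0.det⁻¹ * f0.adjugate i j| + 1))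
      (fun _ _ => by positivity) (Finset.mem_univ i)
  filter_upwards [hne, hbd] with h h1 h2
  exact .of_forall fun _ => ⟨Matrix.nonsing_inv_mul _ (isUnit_iff_ne_zero.2 h1), h2⟩

end unit

lemma mulV_smul (R : Mat) (c : ℝ) (u : V) : mulV R (c • u) = c • mulV R u := by
  simp [mulV, Matrix.mulVec_smul]

lemma isEffectiveHall_iff {b : Module.Basis (Fin 3) ℝ V} {σ P : V → V → Mat} {Rs : Mat}
    {Ms : V →ₗ[ℝ] V →ₗ[ℝ] Mat} : IsEffectiveHall b σ P Rs Ms ↔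
      MatRem (Measure.dirac ()) (fun h _ => (effCond b (σ h) (P h))⁻¹)
        (fun _ => (effCond b (σ 0) (P 0))⁻¹) (fun h _ => crossMat (mulV Rs h))
        (fun h _ => Ms h h) := by
  rw [matRem_iff]
  simp only [ae_unit_iff, Filter.eventually_all, IsEffectiveHall, Asymptotics.isLittleO_iff,
    Real.norm_eq_abs, abs_pow, abs_norm]
  exact ⟨fun H ε hε i j => H i j hε, fun H i j ε hε => H ε hε i j⟩

section effective

variable {b : Module.Basis (Fin 3) ℝ V} {σ P : V → V → Mat} {f0 g0 : Mat} {f1 f2 : V → Mat}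
  (hf : MatExp (Measure.dirac ()) (fun h _ => effCond b (σ h) (P h)) (fun _ => f0)
    (fun h _ => f1 h) (fun h _ => f2 h)) (hfg : f0 * g0 = 1)

include hf hfg

lemma exists_isEffectiveHall {Rs : Mat} (hR : ∀ h, -(g0 * f1 h * g0) = crossMat (mulV Rs h)) :
    ∃ Ms : V →ₗ[ℝ] V →ₗ[ℝ] Mat, IsEffectiveHall b σ P Rs Ms := by
  have hi := hf.inv_unit hfg
  obtain ⟨B, hB⟩ := MatQuad.exists_bilinear (μ := Measure.dirac ()) hi.two
  refine ⟨LinearMap.mk₂ ℝ (fun h k => B h k ()) (by simp) (by simp) (by simp) (by simp), ?_⟩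
  rw [isEffectiveHall_iff]
  refine (hi.congr (.of_forall fun h => .of_forall fun _ => rfl) ?_
    (fun h => .of_forall fun _ => hR h) (fun h => ?_)).rem
  · filter_upwards [hi.apply_zero] with _ h using h.symm
  · filter_upwards [hB h] with x hx using hx

/-- By uniqueness of coefficients, the diagonal of `Ms` is the quadratic term g0 f1 g0 f1 g0 − g0 f2
g0 of the inverse. Multiplying by f0 = g0⁻¹ on both sides strips the outer factors. -/
lemma isEffectiveHall_second {Rs : Mat} {Ms : V →ₗ[ℝ] V →ₗ[ℝ] Mat}
    (hE : IsEffectiveHall b σ P Rs Ms) (h : V) :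
    effCond b (σ 0) (P 0) * Ms h h * effCond b (σ 0) (P 0) = f1 h * g0 * f1 h - f2 h := by
  have hi := hf.inv_unit hfg
  have h0 := ae_unit_iff.1 hf.apply_zero
  have hu := ae_unit_iff.1 ((MatRem.unique hi.rem (isEffectiveHall_iff.1 hE) (MatLin.smul hi.one)
    (MatQuad.smul hi.two) (fun c k => .of_forall fun _ => by rw [mulV_smul, crossMat_smul])
    (fun c k => .of_forall fun _ => by simp [smul_smul, pow_two])).2.2 h)
  have hgf : g0 * f0 = 1 := mul_eq_one_comm.1 hfg
  rw [← hu, h0, mul_sub, sub_mul]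
  have e1 : f0 * (g0 * f1 h * g0 * f1 h * g0) * f0 =
      (f0 * g0) * (f1 h * g0 * f1 h) * (g0 * f0) := by simp only [mul_assoc]
  have e2 : f0 * (g0 * f2 h * g0) * f0 = (f0 * g0) * f2 h * (g0 * f0) := by simp only [mul_assoc]
  rw [e1, e2, hfg, hgf, one_mul, one_mul, mul_one, mul_one]

end effective

section resistivity

variable {α β : ℝ} {S : V → V → Mat} {a s : V → ℝ} {Q : V → V → Mat}

lemma crossMat_mulV_smul_one (r : ℝ) (h : V) : crossMat (mulV (r • (1 : Mat)) h) = r • crossMat h := by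
  rw [← crossMat_smul]
  congr 1
  ext i
  simp [mulV, Matrix.smul_mulVec]

variable (hα : 0 < α) (hS : ∀ᶠ h in 𝓝 (0 : V), MemM α β (S h))
  (ha : ∀ y, α ≤ a y) (ham : MemLp a ⊤ volume)
  (hexp : MatExp volume S (fun y => a y • (1 : Mat)) (fun h y => s y • crossMat h) Q)

include hα hS ha ham hexp

lemma matExp_resistivity :
    MatExp volume (fun h y => (S h y)⁻¹) (fun y => (a y)⁻¹ • (1 : Mat))
      (fun h y => (-(s y / a y ^ 2)) • crossMat h)
      (fun h y => ((a y)⁻¹ ^ 3 * s y ^ 2) • (crossMat h * crossMat h) - (a y)⁻¹ ^ 2 • Q h y) := by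
  have h1 := hexp.inv (C := α⁻¹) (G := fun h y => (S h y)⁻¹) (g0 := fun y => (a y)⁻¹ • (1 : Mat))
    ?_ ?_ ((MatBdd.const (1 : Mat)).smul (memLp_inv_of_le hα ha ham)) ?_
  · refine h1.congr (.of_forall fun h => .of_forall fun _ => rfl) (.of_forall fun _ => rfl)
      (fun h => .of_forall fun y => ?_) (fun h => .of_forall fun y => ?_)
    · simp only [smul_mul_assoc, mul_smul_comm, mul_one, one_mul]
      match_scalars
      field_simp
    · simp only [smul_mul_assoc, mul_smul_comm, mul_one, one_mul]
      match_scalars <;> ring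
  · filter_upwards [hS] with h hh i j
    exact (hh.inv.measurable i j).aestronglyMeasurable
  · filter_upwards [hS] with h hh
    filter_upwards [hh.bounds, hh.inv.abs_le (inv_pos.2 hα)] with y h2 h3
    exact ⟨Matrix.nonsing_inv_mul _ h2.1, h3⟩
  · refine .of_forall fun y => ?_
    have : a y ≠ 0 := (hα.trans_le (ha y)).ne'
    simp [this]

lemma exists_isLocalHall {R : V → Mat} (hR : ∀ y, R y = (-(s y / a y ^ 2)) • (1 : Mat)) :
    ∃ M : V →ₗ[ℝ] V →ₗ[ℝ] (V → Mat), IsLocalHall S R M := by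
  have hi := matExp_resistivity hα hS ha ham hexp
  obtain ⟨B, hB⟩ := MatQuad.exists_bilinear (μ := volume) hi.two
  refine ⟨B, (hi.congr (.of_forall fun h => .of_forall fun _ => rfl) ?_
    (fun h => .of_forall fun y => ?_) hB).hasLinftyExpansion⟩
  · filter_upwards [hi.apply_zero] with _ h using h.symm
  · rw [hR, crossMat_mulV_smul_one]

lemma isLocalHall_second {R : V → Mat} {M : V →ₗ[ℝ] V →ₗ[ℝ] (V → Mat)} (hM : IsLocalHall S R M)
    (h : V) : ∀ᵐ y, M h h y =
      ((a y)⁻¹ ^ 3 * s y ^ 2) • (crossMat h * crossMat h) - (a y)⁻¹ ^ 2 • Q h y := by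
  have hi := matExp_resistivity hα hS ha ham hexp
  have := (MatRem.unique (matRem_iff.2 hM.remainder) hi.rem
    (fun c k => .of_forall fun _ => by rw [mulV_smul, crossMat_smul])
    (fun c k => .of_forall fun _ => by simp [smul_smul, pow_two])
    (MatLin.smul hi.one) (MatQuad.smul hi.two)).2.2 h
  exact this

end resistivity

/-! ### The gap of a laminate -/

section gap

variable {b : Module.Basis (Fin 3) ℝ V} {α β : ℝ} {ξ : V} {S P : V → V → Mat} {a s : V → ℝ}
  {Q : V → V → Mat}

lemma laminate_zero_mul_inv (hξ : ‖ξ‖ = 1) {am c0 : ℝ} (ham0 : am ≠ 0) (hc0 : c0 ≠ 0) :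
    (am • (1 - outer ξ ξ) + c0 • outer ξ ξ) * (am⁻¹ • (1 - outer ξ ξ) + c0⁻¹ • outer ξ ξ) = 1 := by
  simp only [add_mul, mul_add, sub_mul, mul_sub, smul_mul_assoc, mul_smul_comm, mul_one, one_mul,
    outer_sq_of_unit hξ, sub_self, smul_zero, zero_add]
  match_scalars <;> field_simp
  ring

/-- This exhibits an effective Hall matrix. The tangential block of 𝓔(h) is 𝓔 of the normal part of
h, the mixed blocks form 𝓔 of its tangential part, and the inverse of the effective conductivity
only scales each of them. -/
lemma laminate_first_order (hξ : ‖ξ‖ = 1) {am c0 : ℝ} (sm u : ℝ) (ham0 : am ≠ 0) (hc0 : c0 ≠ 0)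
    (h : V) :
    -((am⁻¹ • (1 - outer ξ ξ) + c0⁻¹ • outer ξ ξ) *
      (sm • (crossMat h - crossMat h * outer ξ ξ - outer ξ ξ * crossMat h) +
        (c0 * u) • (crossMat h * outer ξ ξ + outer ξ ξ * crossMat h)) *
      (am⁻¹ • (1 - outer ξ ξ) + c0⁻¹ • outer ξ ξ)) =
    crossMat (mulV (-((am⁻¹ ^ 2 * sm) • outer ξ ξ + (am⁻¹ * u) • (1 - outer ξ ξ))) h) := by
  have hR : mulV (-((am⁻¹ ^ 2 * sm) • outer ξ ξ + (am⁻¹ * u) • (1 - outer ξ ξ))) h =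
      (-(am⁻¹ ^ 2 * sm * inner ℝ h ξ)) • ξ + (-(am⁻¹ * u)) • h +
        (am⁻¹ * u * inner ℝ h ξ) • ξ := by
    ext i
    fin_cases i <;> simp [mulV, Matrix.mulVec, dotProduct, Fin.sum_univ_three, outer_apply,
      inner_eq_sum, Matrix.one_apply] <;> ring
  have kξ : inner ℝ ξ (cross h ξ) = 0 := inner_cross_right h ξ
  have ξk : inner ℝ (cross h ξ) ξ = 0 := by rw [real_inner_comm]; exact kξ
  have hG : crossMat h - crossMat h * outer ξ ξ - outer ξ ξ * crossMat h =
      inner ℝ h ξ • crossMat ξ := by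
    rw [crossMat_mul_outer, outer_mul_crossMat, crossMat_eq (h := h) hξ]; abel
  rw [hG, hR, crossMat_add, crossMat_add, crossMat_smul, crossMat_smul, crossMat_smul,
    crossMat_mul_outer, outer_mul_crossMat, crossMat_eq (h := h) hξ]
  simp only [add_mul, mul_add, sub_mul, mul_sub, smul_mul_assoc, mul_smul_comm,
    crossMat_mul_outer, outer_mul_crossMat, outer_mul_outer, cross_self, kξ, ξk,
    inner_self_of_unit hξ, outer_zero_left, outer_zero_right, mul_one, one_mul, mul_neg, neg_mul,
    zero_smul, smul_zero, sub_zero, add_zero, zero_add, neg_zero]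
  match_scalars <;> field_simp <;> ring

variable (hα : 0 < α) (hβ : 0 < β) (hξ : ‖ξ‖ = 1) (hS : ∀ᶠ h in 𝓝 (0 : V), MemM α β (S h))
  (ha : ∀ y, α ≤ a y) (ham : MemLp a ⊤ volume) (hsm : MemLp s ⊤ volume)
  (hexp : MatExp volume S (fun y => a y • (1 : Mat)) (fun h y => s y • crossMat h) Q)
  (hP : ∀ᶠ h in 𝓝 (0 : V), effCond b (S h) (P h) = laminateCond b ξ (S h))
  {am sm u v c0 : ℝ} (ham0 : am ≠ 0) (hc0 : c0 ≠ 0)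
  (eam : ⨍ y in ZSpan.fundamentalDomain b, a y = am)
  (ec0 : ⨍ y in ZSpan.fundamentalDomain b, (a y)⁻¹ = c0⁻¹)
  (esm : ⨍ y in ZSpan.fundamentalDomain b, s y = sm)
  (eu : ⨍ y in ZSpan.fundamentalDomain b, (a y)⁻¹ * s y = u)
  (ev : ⨍ y in ZSpan.fundamentalDomain b, (a y)⁻¹ * s y ^ 2 = v)

include hα hβ hξ hS ha ham hsm hexp hP ham0 hc0 eam ec0 esm eu ev

lemma exists_isEffectiveHall_laminate :
    ∃ (Rs : Mat) (Ms : V →ₗ[ℝ] V →ₗ[ℝ] Mat), IsEffectiveHall b S P Rs Ms := by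
  have hF := (matExp_laminateCond b hα hβ hξ hS ha ham hsm hexp hc0 eam ec0 esm eu ev).congr
    (G := fun h _ => effCond b (S h) (P h))
    (by filter_upwards [hP] with h hh using .of_forall fun _ => hh.symm)
    (.of_forall fun _ => rfl) (fun _ => .of_forall fun _ => rfl) (fun _ => .of_forall fun _ => rfl)
  exact ⟨_, exists_isEffectiveHall hF (laminate_zero_mul_inv hξ ham0 hc0)
    (laminate_first_order hξ sm u ham0 hc0)⟩

/-- The explicit form of the gap of a laminate. -/
theorem gap_laminate (hP0 : ∀ᵐ y ∂cellMeas b, P 0 y = laminateGrad b ξ (S 0) y)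
    {v2 v3 : ℝ}
    (ev2 : ⨍ y in ZSpan.fundamentalDomain b, (a y)⁻¹ ^ 2 * s y ^ 2 = v2)
    (ev3 : ⨍ y in ZSpan.fundamentalDomain b, (a y)⁻¹ ^ 3 * s y ^ 2 = v3)
    {R : V → Mat} {M : V →ₗ[ℝ] V →ₗ[ℝ] (V → Mat)} {Rs : Mat} {Ms : V →ₗ[ℝ] V →ₗ[ℝ] Mat}
    (hM : IsLocalHall S R M) (hMs : IsEffectiveHall b S P Rs Ms) (h : V) :
    gap b S P M Ms h =
      ((v - am⁻¹ * sm ^ 2) * inner ℝ h ξ ^ 2) • (1 - outer ξ ξ) +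
      (c0 ^ 2 * (v3 - am⁻¹ * u ^ 2) * ‖cross h ξ‖ ^ 2) • outer ξ ξ -
      (c0 * (v2 - am⁻¹ * u * sm) * inner ℝ h ξ) • (outer (tang ξ h) ξ + outer ξ (tang ξ h)) := by
  have hF := (matExp_laminateCond b hα hβ hξ hS ha ham hsm hexp hc0 eam ec0 esm eu ev).congr
    (G := fun h _ => effCond b (S h) (P h))
    (by filter_upwards [hP] with h hh using .of_forall fun _ => hh.symm)
    (.of_forall fun _ => rfl) (fun _ => .of_forall fun _ => rfl) (fun _ => .of_forall fun _ => rfl)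
  have hai := memLp_inv_of_le hα ha ham
  have hQ : MatBdd volume (Q h) := matBdd_iff.2 (hexp.two.memLp h)
  have hai2 : MemLp (fun y => (a y)⁻¹ ^ 2) ⊤ volume := by
    simpa only [pow_two] using memLp_top_mul hai hai
  have hs2 : MemLp (fun y => s y ^ 2) ⊤ volume := by
    simpa only [pow_two] using memLp_top_mul hsm hsm
  have has2 : MemLp (fun y => (a y)⁻¹ * s y ^ 2) ⊤ volume := memLp_top_mul hai hs2
  have ha2s2 : MemLp (fun y => (a y)⁻¹ ^ 2 * s y ^ 2) ⊤ volume := memLp_top_mul hai2 hs2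
  have ha3s2 : MemLp (fun y => (a y)⁻¹ ^ 3 * s y ^ 2) ⊤ volume := by
    have := memLp_top_mul hai ha2s2
    refine (memLp_congr_ae (.of_forall fun y => ?_)).1 this
    ring
  have hS0 : ∀ᵐ y ∂cellMeas b, S 0 y = a y • 1 := ae_cellMeas b hexp.apply_zero
  have hm : invNormalAvg b ξ (S 0) = c0⁻¹ := by
    rw [← ec0]
    refine integral_congr_ae ?_
    filter_upwards [hS0] with y hy
    rw [hy, map_smul, normalPart_one hξ, smul_eq_mul, mul_one]
  have hT : normalizedAvg b ξ (S 0) = 1 := by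
    rw [normalizedAvg, cellAvg_congr b (G := fun _ => (1 : ℝ) • (1 : Mat))
      (by
        filter_upwards [hS0] with y hy
        have : a y ≠ 0 := (hα.trans_le (ha y)).ne'
        rw [hy, map_smul, normalPart_one hξ, smul_eq_mul, mul_one, smul_smul,
          inv_mul_cancel₀ this]), cellAvg_smul_const]
    simp
  -- In the unperturbed laminate the corrector acts on the normal direction only, where the flux is
  -- constant and equal to the harmonic mean `c0`.
  have hSP : ∀ᵐ y ∂cellMeas b, S 0 y * P 0 y = a y • (1 - outer ξ ξ) + c0 • outer ξ ξ := by
    filter_upwards [hS0, hP0] with y h1 h2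
    have : a y ≠ 0 := (hα.trans_le (ha y)).ne'
    rw [h2, laminateGrad, hm, hT, h1, map_smul, normalPart_one hξ]
    simp only [smul_eq_mul, mul_one, inv_inv, smul_mul_assoc, one_mul, mul_smul_comm]
    match_scalars <;> field_simp
    ring
  have hN : ∀ᵐ y ∂cellMeas b, M h h y =
      ((a y)⁻¹ ^ 3 * s y ^ 2) • (crossMat h * crossMat h) - (a y)⁻¹ ^ 2 • Q h y :=
    ae_cellMeas b (isLocalHall_second hα hS ha ham hexp hM h)
  set Ξ := outer ξ ξ with hΞ
  set E2 := crossMat h * crossMat h with hE2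
  -- The integrand is sorted into scalars times fixed matrices and linear images of Q, a⁻¹Q and
  -- a⁻²Q. The averages of the latter are exactly the Q-terms of the effective expansion, so they
  -- cancel in the final `module`.
  have hW : ∀ᵐ y ∂cellMeas b, (S 0 y * P 0 y)ᵀ * M h h y * (S 0 y * P 0 y) =
      (((a y)⁻¹ * s y ^ 2) • ((1 - Ξ) * E2 * (1 - Ξ)) +
        (((a y)⁻¹ ^ 2 * s y ^ 2) • (c0 • ((1 - Ξ) * E2 * Ξ + Ξ * E2 * (1 - Ξ))) +
        ((a y)⁻¹ ^ 3 * s y ^ 2) • (c0 ^ 2 • (Ξ * E2 * Ξ)))) -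
      (LinearMap.mulLeftRight ℝ (1 - Ξ, 1 - Ξ) (Q h y) +
        (c0 • (LinearMap.mulLeftRight ℝ (1 - Ξ, Ξ) + LinearMap.mulLeftRight ℝ (Ξ, 1 - Ξ)) :
          Mat →ₗ[ℝ] Mat) ((a y)⁻¹ • Q h y) +
        (c0 ^ 2 • LinearMap.mulLeftRight ℝ (Ξ, Ξ) : Mat →ₗ[ℝ] Mat) ((a y)⁻¹ ^ 2 • Q h y)) := by
    filter_upwards [hSP, hN] with y h1 h2
    have h0 : a y ≠ 0 := (hα.trans_le (ha y)).ne'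
    rw [h1, h2, Matrix.transpose_add, Matrix.transpose_smul, Matrix.transpose_smul,
      Matrix.transpose_sub, Matrix.transpose_one, hΞ, outer_transpose, ← hΞ]
    simp only [LinearMap.smul_apply, LinearMap.add_apply, LinearMap.mulLeftRight_apply]
    generalize 1 - Ξ = T
    simp only [add_mul, mul_add, sub_mul, mul_sub, smul_mul_assoc, mul_smul_comm]
    match_scalars <;> field_simp
  have l1 := hQ.linearMap (LinearMap.mulLeftRight ℝ (1 - Ξ, 1 - Ξ))
  have l2 := (hQ.smul hai).linearMap
    (c0 • (LinearMap.mulLeftRight ℝ (1 - Ξ, Ξ) + LinearMap.mulLeftRight ℝ (Ξ, 1 - Ξ)))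
  have l3 := (hQ.smul hai2).linearMap (c0 ^ 2 • LinearMap.mulLeftRight ℝ (Ξ, Ξ))
  have k1 := (MatBdd.const (μ := (volume : Measure V)) ((1 - Ξ) * E2 * (1 - Ξ))).smul has2
  have k2 := (MatBdd.const (μ := (volume : Measure V))
    (c0 • ((1 - Ξ) * E2 * Ξ + Ξ * E2 * (1 - Ξ)))).smul ha2s2
  have k3 := (MatBdd.const (μ := (volume : Measure V)) (c0 ^ 2 • (Ξ * E2 * Ξ))).smul ha3s2
  rw [gap, isEffectiveHall_second hF (laminate_zero_mul_inv hξ ham0 hc0) hMs h,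
    cellAvg_congr b hW, cellAvg_sub b (k1.add (k2.add k3)) ((l1.add l2).add l3),
    cellAvg_add b k1 (k2.add k3), cellAvg_add b k2 k3, cellAvg_add b (l1.add l2) l3,
    cellAvg_add b l1 l2, cellAvg_linearMap b _ hQ, cellAvg_linearMap b _ (hQ.smul hai),
    cellAvg_linearMap b _ (hQ.smul hai2), cellAvg_smul_const, cellAvg_smul_const,
    cellAvg_smul_const, ev, ev2, ev3, ← gap_identity hξ am sm u v v2 v3 c0]
  simp only [LinearMap.smul_apply, LinearMap.add_apply, LinearMap.mulLeftRight_apply, ← hΞ, ← hE2]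
  module

end gap

/-! ### Functions of one variable -/

section layered

variable {b : Module.Basis (Fin 3) ℝ V} {ξ : V} {a s : ℝ → ℝ}

/-- The coefficients of the expansion of a periodic field are periodic. -/
lemma aePeriodic_coefficients {S : V → V → Mat} {δ : ℝ} (hδ : 0 < δ)
    (hper : ∀ h ∈ Metric.ball (0 : V) δ, ∀ i y, S h (y + b i) = S h y) {a s : V → ℝ}
    {Q : V → V → Mat}
    (hexp : MatExp volume S (fun y => a y • (1 : Mat)) (fun h y => s y • crossMat h) Q) :
    AEPeriodic b a ∧ AEPeriodic b s := by
  have key : ∀ i, (∀ᵐ y, a (y + b i) • (1 : Mat) = a y • (1 : Mat)) ∧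
      ∀ h, ∀ᵐ y, s (y + b i) • crossMat h = s y • crossMat h := fun i => by
    -- Translation by a period gives a second expansion of the same periodic field, and uniqueness
    -- of coefficients identifies the two.
    have hr : MatRem volume S (fun y => a (y + b i) • (1 : Mat))
        (fun h y => s (y + b i) • crossMat h) (fun h y => Q h (y + b i)) := fun ε hε => by
      filter_upwards [hexp.rem ε hε, Metric.ball_mem_nhds 0 hδ] with h h1 h2
      filter_upwards [ae_add_right (b i) h1] with y hy
      rwa [hper h h2 i y] at hy
    have hsm : ∀ (c : ℝ) (h : V), ∀ᵐ y : V, s y • crossMat (c • h) = c • s y • crossMat h :=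
      fun c h => .of_forall fun y => by rw [crossMat_smul, smul_comm]
    have hQ := MatQuad.smul hexp.two
    have hu := MatRem.unique hr hexp.rem (fun c h => ae_add_right (b i) (hsm c h))
      (fun c h => ae_add_right (b i) (hQ c h)) hsm hQ
    exact ⟨hu.1, hu.2.1⟩
  refine ⟨fun i => ?_, fun i => ?_⟩
  · filter_upwards [(key i).1] with y hy
    simpa using congrFun (congrFun hy 0) 0
  · filter_upwards [(key i).2 (EuclideanSpace.single 0 1)] with y hy
    -- The entry (2,1) of 𝓔(e₀) is 1.
    simpa [crossMat] using congrFun (congrFun hy 2) 1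

lemma exists_bound_of_layered (hξ0 : ξ ≠ 0) {f : ℝ → ℝ} (hf : Measurable f)
    (hL : MemLp (layered ξ f) ⊤ volume) : ∃ C, ∀ᵐ t, |f t| ≤ C := by
  obtain ⟨C, -, hC⟩ := exists_bound_of_memLp_top hL
  exact ⟨C, (ae_layered_iff hξ0 (p := fun t => |f t| ≤ C)
    (measurableSet_le hf.abs measurable_const)).1 hC⟩

lemma cellAverage_layered_comp (hξ : ‖ξ‖ = 1) (ha : Measurable a) (hs : Measurable s)
    (haper : Function.Periodic a 1) (hsper : Function.Periodic s 1)
    (hab : AEPeriodic b (layered ξ a)) (hsb : AEPeriodic b (layered ξ s)) {g : ℝ → ℝ → ℝ}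
    (hg : Measurable fun x : ℝ × ℝ => g x.1 x.2)
    (hL : MemLp (fun y => g (layered ξ a y) (layered ξ s y)) ⊤ volume) :
    ⨍ y in ZSpan.fundamentalDomain b, g (layered ξ a y) (layered ξ s y) =
      avg fun t => g (a t) (s t) := by
  have hξ0 : ξ ≠ 0 := by rintro rfl; simp at hξ
  have hf : Measurable fun t => g (a t) (s t) := hg.comp (ha.prodMk hs)
  obtain ⟨C, hC⟩ := exists_bound_of_layered (f := fun t => g (a t) (s t)) hξ0 hf hL
  refine cellAverage_layered hξ hf hC (fun i => ?_) fun t => ?_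
  · filter_upwards [hab i, hsb i] with y h1 h2
    change g (layered ξ a (y + b i)) (layered ξ s (y + b i)) = g (layered ξ a y) (layered ξ s y)
    rw [h1, h2]
  · simp only [haper t, hsper t]

end layered

section weighted

variable {α β : ℝ} {a f : ℝ → ℝ}

lemma ae_of_periodic {c : ℝ} (hf : Function.Periodic f 1)
    (h : ∀ᵐ t ∂volume.restrict (Set.Ioc (0 : ℝ) 1), f t = c) : ∀ᵐ t, f t = c := by
  rw [ae_restrict_iff' measurableSet_Ioc] at h
  have h1 : ∀ n : ℤ, ∀ᵐ t : ℝ, t - n ∈ Set.Ioc (0 : ℝ) 1 → f (t - n) = c := fun n =>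
    (measurePreserving_sub_right volume (n : ℝ)).quasiMeasurePreserving.ae h
  filter_upwards [ae_all_iff.2 h1] with t ht
  -- The shift is `⌈t⌉ - 1` and not `⌊t⌋`, because the reference period is open at 0 and closed at
  -- 1.
  have h2 := ht (⌈t⌉ - 1) (by
    push_cast
    constructor
    · linarith [Int.ceil_lt_add_one t]
    · linarith [Int.le_ceil t])
  rwa [show (((⌈t⌉ - 1 : ℤ)) : ℝ) = ((⌈t⌉ - 1 : ℤ) : ℝ) * 1 by ring, hf.sub_int_mul_eq] at h2

lemma intervalIntegrable_of_bound {C : ℝ} (hf : Measurable f) (hC : ∀ᵐ t, |f t| ≤ C) (x y : ℝ) :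
    IntervalIntegrable f volume x y :=
  (intervalIntegrable_const (c := C)).mono_fun hf.aestronglyMeasurable (by
    filter_upwards [ae_restrict_of_ae hC] with t ht
    exact ht.trans (le_abs_self C))

lemma avg_congr {g : ℝ → ℝ} (h : ∀ᵐ t, f t = g t) : avg f = avg g :=
  intervalIntegral.integral_congr_ae (by filter_upwards [h] with t ht _ using ht)

lemma avg_const_mul (c : ℝ) : avg (fun t => c * f t) = c * avg f :=
  intervalIntegral.integral_const_mul c f

lemma le_avg {C : ℝ} (hf : IntervalIntegrable f volume 0 1) (h : ∀ t, C ≤ f t) : C ≤ avg f := by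
  have := intervalIntegral.integral_mono_on (a := 0) (b := 1) zero_le_one
    (intervalIntegrable_const (c := C)) hf fun t _ => h t
  rwa [intervalIntegral.integral_const, sub_zero, one_smul] at this

/-- Equality in the weighted Cauchy-Schwarz inequality. -/
lemma weighted_variance_eq_zero_iff (hα : 0 < α) (ha : Measurable a)
    (hab : ∀ t, a t ∈ Set.Icc α β) (hf : Measurable f) {C : ℝ} (hC : ∀ᵐ t, |f t| ≤ C)
    (hfp : Function.Periodic f 1) :
    (avg fun t => a t * f t ^ 2) - (avg a)⁻¹ * (avg fun t => a t * f t) ^ 2 = 0 ↔ IsConst f := by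
  have hab' : ∀ t, |a t| ≤ β := fun t => by
    rw [abs_of_pos (hα.trans_le (hab t).1)]; exact (hab t).2
  have ia : IntervalIntegrable a volume 0 1 := intervalIntegrable_of_bound ha (.of_forall hab') 0 1
  have iaf : IntervalIntegrable (fun t => a t * f t) volume 0 1 :=
    intervalIntegrable_of_bound (C := β * C) (ha.mul hf) (by
      filter_upwards [hC] with t ht
      rw [Pi.mul_apply, abs_mul]
      exact mul_le_mul (hab' t) ht (abs_nonneg _) ((abs_nonneg _).trans (hab' t))) 0 1
  have iaf2 : IntervalIntegrable (fun t => a t * f t ^ 2) volume 0 1 :=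
    intervalIntegrable_of_bound (C := β * C ^ 2) (ha.mul (hf.pow_const 2)) (by
      filter_upwards [hC] with t ht
      rw [Pi.mul_apply, abs_mul, abs_pow]
      exact mul_le_mul (hab' t) (pow_le_pow_left₀ (abs_nonneg _) ht 2) (by positivity)
        ((abs_nonneg _).trans (hab' t))) 0 1
  have hpos : 0 < avg a := hα.trans_le (le_avg ia fun t => (hab t).1)
  constructor
  · intro h0
    -- `c` is the mean of `f` for the weight `a`; with this value the left side of `h0` is the
    -- integral of a(f − c)².
    set c := (avg a)⁻¹ * avg (fun t => a t * f t) with hc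
    have e : ∀ t, a t * (f t - c) ^ 2 = a t * f t ^ 2 - 2 * c * (a t * f t) + c ^ 2 * a t :=
      fun t => by ring
    have ii : IntervalIntegrable (fun t => a t * (f t - c) ^ 2) volume 0 1 := by
      simp_rw [e]
      exact (iaf2.sub (iaf.const_mul _)).add (ia.const_mul _)
    have hz : ∫ t in (0:ℝ)..1, a t * (f t - c) ^ 2 = 0 := by
      simp_rw [e]
      rw [intervalIntegral.integral_add (iaf2.sub (iaf.const_mul _)) (ia.const_mul _),
        intervalIntegral.integral_sub iaf2 (iaf.const_mul _), intervalIntegral.integral_const_mul,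
        intervalIntegral.integral_const_mul]
      change avg (fun t => a t * f t ^ 2) - 2 * c * avg (fun t => a t * f t) + c ^ 2 * avg a = 0
      rw [← h0, hc]
      field_simp
      ring
    rw [intervalIntegral.integral_of_le zero_le_one, setIntegral_eq_zero_iff_of_nonneg_ae
      (.of_forall fun t => mul_nonneg (hα.le.trans (hab t).1) (sq_nonneg _)) ii.1] at hz
    refine ⟨c, ae_of_periodic hfp ?_⟩
    filter_upwards [hz] with t ht
    have h1 : a t ≠ 0 := (hα.trans_le (hab t).1).ne'
    simpa [h1, sub_eq_zero] using ht
  · rintro ⟨c, hc⟩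
    have e1 : avg (fun t => a t * f t ^ 2) = c ^ 2 * avg a := by
      rw [← avg_const_mul]
      exact avg_congr (by filter_upwards [hc] with t ht; rw [ht, mul_comm])
    have e2 : avg (fun t => a t * f t) = c * avg a := by
      rw [← avg_const_mul]
      exact avg_congr (by filter_upwards [hc] with t ht; rw [ht, mul_comm])
    rw [e1, e2]
    field_simp
    ring

end weighted

/-! ### Matrices in adapted bases -/

lemma colMat_outer (e : Fin 3 → V) (u w : V) (i j : Fin 3) :
    ((colMat e)ᵀ * outer u w * colMat e) i j = inner ℝ (e i) u * inner ℝ (e j) w := by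
  simp only [colMat, Matrix.mul_apply, Matrix.transpose_apply, Matrix.of_apply, outer_apply,
    Fin.sum_univ_three, inner_eq_sum]
  ring

lemma colMat_one (e : Fin 3 → V) (i j : Fin 3) :
    ((colMat e)ᵀ * (1 : Mat) * colMat e) i j = inner ℝ (e i) (e j) := by
  simp only [mul_one, colMat, Matrix.mul_apply, Matrix.transpose_apply, Matrix.of_apply,
    Fin.sum_univ_three, inner_eq_sum]

section unit

variable {ξ h : V}

lemma norm_tang (hξ : ‖ξ‖ = 1) : inner ℝ (tang ξ h) (tang ξ h) = ‖cross h ξ‖ ^ 2 := by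
  have kξ : inner ℝ ξ (cross h ξ) = 0 := inner_cross_right h ξ
  rw [← cross_cross_of_unit hξ, inner_cross_cross, inner_self_of_unit hξ, kξ,
    real_inner_self_eq_norm_sq]
  ring

lemma parallel_iff (hξ : ‖ξ‖ = 1) : Parallel h ξ ↔ cross h ξ = 0 := by
  constructor
  · rintro ⟨c, rfl⟩
    ext i
    fin_cases i <;> simp [cross_apply_zero, cross_apply_one, cross_apply_two] <;> ring
  · intro h0
    have h1 := norm_tang (h := h) hξ
    rw [h0, norm_zero] at h1
    have h2 : tang ξ h = 0 := inner_self_eq_zero.1 (by rw [h1]; norm_num)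
    exact ⟨inner ℝ h ξ, sub_eq_zero.1 h2⟩

/-- The second vector is minus the normalized tangential part of h. This sign cancels the minus in
front of d₃ in the gap. -/
lemma adaptedBasis_eq (hξ : ‖ξ‖ = 1) : adaptedBasis ξ h =
    ![ξ, -(‖cross h ξ‖⁻¹ • tang ξ h), ‖cross h ξ‖⁻¹ • cross h ξ] := by
  have e : cross ξ (cross ξ h) = - tang ξ h := by
    rw [cross_anticomm ξ h, ← cross_cross_of_unit hξ]
    ext i
    fin_cases i <;> simp [cross_apply_zero, cross_apply_one, cross_apply_two] <;> ring
  rw [adaptedBasis, e, smul_neg]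

lemma inner_tang_cross (hξ : ‖ξ‖ = 1) : inner ℝ (tang ξ h) (cross h ξ) = 0 := by
  rw [← cross_cross_of_unit hξ, real_inner_comm, inner_cross_right]

lemma orthonormal_adaptedBasis (hξ : ‖ξ‖ = 1) (hh : ¬ Parallel h ξ) :
    Orthonormal ℝ (adaptedBasis ξ h) := by
  rw [parallel_iff hξ] at hh
  have hq : ‖cross h ξ‖ ≠ 0 := norm_ne_zero_iff.2 hh
  have gg := norm_tang (h := h) hξ
  have kk : inner ℝ (cross h ξ) (cross h ξ) = ‖cross h ξ‖ ^ 2 := real_inner_self_eq_norm_sq _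
  have kξ : inner ℝ ξ (cross h ξ) = 0 := inner_cross_right h ξ
  have ξk : inner ℝ (cross h ξ) ξ = 0 := by rw [real_inner_comm]; exact kξ
  have gξ : inner ℝ ξ (tang ξ h) = 0 := inner_tang hξ
  have ξg : inner ℝ (tang ξ h) ξ = 0 := by rw [real_inner_comm]; exact gξ
  have gk := inner_tang_cross (h := h) hξ
  have kg : inner ℝ (cross h ξ) (tang ξ h) = 0 := by rw [real_inner_comm]; exact gk
  rw [adaptedBasis_eq hξ, orthonormal_iff_ite]
  intro i j
  fin_cases i <;> fin_cases j <;>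
    simp only [Fin.zero_eta, Fin.mk_one, Fin.reduceFinMk, Matrix.cons_val, inner_neg_left,
      inner_neg_right, real_inner_smul_left, real_inner_smul_right, kξ, ξk, gξ, ξg, gk, kg, gg,
      kk, inner_self_of_unit hξ] <;> simp
  all_goals field_simp

lemma inner_adaptedBasis_self (hξ : ‖ξ‖ = 1) (i : Fin 3) :
    inner ℝ (adaptedBasis ξ h i) ξ = ![1, 0, 0] i := by
  have ξk : inner ℝ (cross h ξ) ξ = 0 := by rw [real_inner_comm]; exact inner_cross_right h ξ
  have ξg : inner ℝ (tang ξ h) ξ = 0 := by rw [real_inner_comm]; exact inner_tang hξ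
  rw [adaptedBasis_eq hξ]
  fin_cases i <;> simp [inner_neg_left, real_inner_smul_left, ξk, ξg, hξ]

lemma inner_adaptedBasis_tang (hξ : ‖ξ‖ = 1) (i : Fin 3) :
    inner ℝ (adaptedBasis ξ h i) (tang ξ h) = ![0, -‖cross h ξ‖, 0] i := by
  have gξ : inner ℝ ξ (tang ξ h) = 0 := inner_tang hξ
  have gg := norm_tang (h := h) hξ
  have kg : inner ℝ (cross h ξ) (tang ξ h) = 0 := by
    rw [real_inner_comm]; exact inner_tang_cross hξ
  rw [adaptedBasis_eq hξ]
  fin_cases i <;> simp only [Fin.zero_eta, Fin.mk_one, Fin.reduceFinMk, Matrix.cons_val,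
      inner_neg_left, real_inner_smul_left, kg, gξ, gg, mul_zero]
  -- When h is parallel to ξ, the convention `0⁻¹ = 0` makes both sides vanish.
  by_cases hq : ‖cross h ξ‖ = 0
  · simp [hq]
  · field_simp

end unit

section unit

variable {ξ h : V}

lemma colMat_gap (e : Fin 3 → V) (x y z : ℝ) (i j : Fin 3) :
    ((colMat e)ᵀ * (x • (1 - outer ξ ξ) + y • outer ξ ξ -
      z • (outer (tang ξ h) ξ + outer ξ (tang ξ h))) * colMat e) i j =
    x * (inner ℝ (e i) (e j) - inner ℝ (e i) ξ * inner ℝ (e j) ξ) +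
      y * (inner ℝ (e i) ξ * inner ℝ (e j) ξ) -
      z * (inner ℝ (e i) (tang ξ h) * inner ℝ (e j) ξ +
        inner ℝ (e i) ξ * inner ℝ (e j) (tang ξ h)) := by
  simp only [mul_add, add_mul, mul_sub, sub_mul, Matrix.mul_smul, Matrix.smul_mul, smul_add,
    smul_sub, Matrix.add_apply, Matrix.sub_apply, Matrix.smul_apply, smul_eq_mul, colMat_outer,
    colMat_one]

lemma tang_eq_zero (hξ : ‖ξ‖ = 1) (hh : Parallel h ξ) : tang ξ h = 0 := by
  rw [← cross_cross_of_unit hξ, (parallel_iff hξ).1 hh]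
  ext i
  fin_cases i <;> simp [cross_apply_zero, cross_apply_one, cross_apply_two]

/-- The form M ↦ ξ·Mξ returns `y`, and the trace returns `2x + y`. Neither sees the mixed terms,
because the tangential part of h is orthogonal to ξ. -/
lemma gap_eq_zero_imp (hξ : ‖ξ‖ = 1) {x y z : ℝ} (h0 : x • (1 - outer ξ ξ) + y • outer ξ ξ -
    z • (outer (tang ξ h) ξ + outer ξ (tang ξ h)) = 0) : x = 0 ∧ y = 0 := by
  have gξ := inner_tang (h := h) hξ
  have ξξ := inner_self_of_unit hξ
  have hn := congrArg (normalPart ξ) h0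
  have ho : ∀ u w : V, normalPart ξ (outer u w) = inner ℝ ξ u * inner ℝ ξ w := fun u w => by
    simp only [normalPart_apply, outer_apply, Fin.sum_univ_three, inner_eq_sum]; ring
  have ht : ∀ u w : V, (outer u w).trace = inner ℝ u w := fun u w => by
    simp only [Matrix.trace, Matrix.diag_apply, outer_apply, Fin.sum_univ_three, inner_eq_sum]
  have hy : y = 0 := by
    simpa only [map_sub, map_add, map_smul, map_zero, normalPart_one hξ, ho, ξξ, gξ, smul_eq_mul,
      mul_one, mul_zero, zero_mul, sub_self, add_zero, zero_add, sub_zero] using hn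
  have htr := congrArg Matrix.trace h0
  have ξg : inner ℝ (tang ξ h) ξ = 0 := by rw [real_inner_comm]; exact gξ
  simp only [Matrix.trace_sub, Matrix.trace_add, Matrix.trace_smul, Matrix.trace_zero,
    Matrix.trace_one, ht, ξξ, gξ, ξg, smul_eq_mul, hy, Fintype.card_fin] at htr
  refine ⟨?_, hy⟩
  push_cast at htr
  linarith

end unit

/-! ### The coefficients d₁, d₂, d₃ in terms of a and s, and their vanishing. -/

section coefficients

variable {α β : ℝ} {a s : ℝ → ℝ}

lemma d1_eq (ha : ∀ t, a t ≠ 0) : d1 a (hallCoeff a s) = ((avg fun t => (a t)⁻¹)⁻¹) ^ 2 *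
    ((avg fun t => (a t)⁻¹ ^ 3 * s t ^ 2) - (avg a)⁻¹ * (avg fun t => (a t)⁻¹ * s t) ^ 2) := by
  have e1 : (fun t => a t * hallCoeff a s t ^ 2) = fun t => (a t)⁻¹ ^ 3 * s t ^ 2 := by
    ext t; have := ha t; simp only [hallCoeff]; field_simp
  have e2 : (fun t => a t * hallCoeff a s t) = fun t => (-1) * ((a t)⁻¹ * s t) := by
    ext t; have := ha t; simp only [hallCoeff]; field_simp
  rw [d1, e1, e2, avg_const_mul, inv_pow]
  ring

lemma d2_eq (ha : ∀ t, a t ≠ 0) : d2 a (hallCoeff a s) =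
    (avg fun t => (a t)⁻¹ * s t ^ 2) - (avg a)⁻¹ * avg s ^ 2 := by
  have e1 : (fun t => a t ^ 3 * hallCoeff a s t ^ 2) = fun t => (a t)⁻¹ * s t ^ 2 := by
    ext t; have := ha t; simp only [hallCoeff]; field_simp
  have e2 : (fun t => a t ^ 2 * hallCoeff a s t) = fun t => (-1) * s t := by
    ext t; have := ha t; simp only [hallCoeff]; field_simp
  rw [d2, e1, e2, avg_const_mul]
  ring

lemma d3_eq (ha : ∀ t, a t ≠ 0) : d3 a (hallCoeff a s) = (avg fun t => (a t)⁻¹)⁻¹ *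
    ((avg fun t => (a t)⁻¹ ^ 2 * s t ^ 2) - (avg a)⁻¹ * (avg fun t => (a t)⁻¹ * s t) * avg s) := by
  have e1 : (fun t => a t ^ 2 * hallCoeff a s t ^ 2) = fun t => (a t)⁻¹ ^ 2 * s t ^ 2 := by
    ext t; have := ha t; simp only [hallCoeff]; field_simp
  have e2 : (fun t => a t ^ 2 * hallCoeff a s t) = fun t => (-1) * s t := by
    ext t; have := ha t; simp only [hallCoeff]; field_simp
  have e3 : (fun t => a t * hallCoeff a s t) = fun t => (-1) * ((a t)⁻¹ * s t) := by
    ext t; have := ha t; simp only [hallCoeff]; field_simp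
  rw [d3, e1, e2, e3, avg_const_mul, avg_const_mul]
  ring

variable (hα : 0 < α) (ha : Measurable a) (hab : ∀ t, a t ∈ Set.Icc α β)

include hα ha hab in
lemma avg_pos : 0 < avg a :=
  hα.trans_le (le_avg (intervalIntegrable_of_bound (C := β) ha (.of_forall fun t => by
    rw [abs_of_pos (hα.trans_le (hab t).1)]; exact (hab t).2) 0 1) fun t => (hab t).1)

include hα ha hab in
lemma avg_inv_pos (hβ : 0 < β) : 0 < avg fun t => (a t)⁻¹ :=
  avg_pos (α := β⁻¹) (β := α⁻¹) (inv_pos.2 hβ) ha.inv fun t =>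
    ⟨inv_anti₀ (hα.trans_le (hab t).1) (hab t).2, inv_anti₀ hα (hab t).1⟩

variable (hs : Measurable s) (haper : Function.Periodic a 1) (hsper : Function.Periodic s 1)
  {C : ℝ} (hC : ∀ᵐ t, |s t| ≤ C)

include hα ha hab hs haper hsper hC

/-- Up to the positive factor ⟨a⁻¹⟩⁻², d₁ is the variance of r for the weight a. -/
lemma d1_eq_zero_iff (hβ : 0 < β) : d1 a (hallCoeff a s) = 0 ↔ IsConst (hallCoeff a s) := by
  have hp := avg_inv_pos hα ha hab hβ
  have ha0 : ∀ t, 0 < a t := fun t => hα.trans_le (hab t).1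
  rw [← weighted_variance_eq_zero_iff (f := hallCoeff a s) (C := C * α⁻¹ ^ 2) hα ha hab
    ((hs.div (ha.pow_const 2)).neg) ?_ (fun t => by simp only [hallCoeff, haper t, hsper t]), d1,
    mul_eq_zero]
  · simp only [inv_eq_zero, ne_eq, OfNat.ofNat_ne_zero, not_false_eq_true,
      pow_eq_zero_iff, hp.ne', false_or]
  · filter_upwards [hC] with t ht
    rw [hallCoeff, abs_neg, abs_div, abs_pow, abs_of_pos (ha0 t), div_eq_mul_inv, ← inv_pow]
    exact mul_le_mul ht (pow_le_pow_left₀ (inv_nonneg.2 (ha0 t).le) (inv_anti₀ hα (hab t).1) 2)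
      (by have := (ha0 t).le; positivity) ((abs_nonneg _).trans ht)

/-- Writing a³r² = a(ar)² and a²r = a(ar) shows d₂ to be the variance of ar for the weight a. -/
lemma d2_eq_zero_iff : d2 a (hallCoeff a s) = 0 ↔ IsConst fun t => a t * hallCoeff a s t := by
  have ha0 : ∀ t, 0 < a t := fun t => hα.trans_le (hab t).1
  have e : ∀ t, a t * hallCoeff a s t = -(s t / a t) := fun t => by
    have := (ha0 t).ne'; simp only [hallCoeff]; field_simp
  rw [← weighted_variance_eq_zero_iff (f := fun t => a t * hallCoeff a s t) (C := C * α⁻¹) hα ha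
    hab (ha.mul (hs.div (ha.pow_const 2)).neg) ?_
    (fun t => by simp only [hallCoeff, haper t, hsper t]), d2]
  · have e1 : (fun t => a t ^ 3 * hallCoeff a s t ^ 2) =
        fun t => a t * (a t * hallCoeff a s t) ^ 2 := by ext t; ring
    have e2 : (fun t => a t ^ 2 * hallCoeff a s t) =
        fun t => a t * (a t * hallCoeff a s t) := by ext t; ring
    rw [e1, e2]
  · filter_upwards [hC] with t ht
    rw [e, abs_neg, abs_div, abs_of_pos (ha0 t), div_eq_mul_inv]
    exact mul_le_mul ht (inv_anti₀ hα (hab t).1) (inv_nonneg.2 (ha0 t).le)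
      ((abs_nonneg _).trans ht)

omit hs haper hsper hC in
-- If ar = c, then ⟨a²r²⟩ = c², ⟨ar⟩ = c and ⟨a²r⟩ = c⟨a⟩, so the bracket is c² − c².
lemma d3_eq_zero {r : ℝ → ℝ} (h : IsConst fun t => a t * r t) : d3 a r = 0 := by
  obtain ⟨c, hc⟩ := h
  have hp := (avg_pos hα ha hab).ne'
  have e1 : avg (fun t => a t ^ 2 * r t ^ 2) = c ^ 2 := by
    rw [avg_congr (g := fun _ => c ^ 2) (by
      filter_upwards [hc] with t ht; rw [← mul_pow, ht])]
    simp [avg]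
  have e2 : avg (fun t => a t * r t) = c := by
    rw [avg_congr (g := fun _ => c) hc]; simp [avg]
  have e3 : avg (fun t => a t ^ 2 * r t) = c * avg a := by
    rw [← avg_const_mul]
    exact avg_congr (by filter_upwards [hc] with t ht; rw [← ht]; ring)
  rw [d3, e1, e2, e3]
  field_simp
  ring

end coefficients

/-! ### The gap of a layered conductivity in terms of one-variable averages. -/

section main

variable {α β δ : ℝ} (hα : 0 < α) (hβ : 0 < β) (hδ : 0 < δ) {ξ : V} (hξ : ‖ξ‖ = 1)
  {b : Module.Basis (Fin 3) ℝ V} {A : V → ℝ → Mat}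
  (hAM : ∀ h ∈ Metric.ball (0 : V) δ, MemM α β (layered ξ (A h)))
  (hAper : ∀ h ∈ Metric.ball (0 : V) δ, ∀ (i : Fin 3) (y : V),
    layered ξ (A h) (y + b i) = layered ξ (A h) y)
  {a s : ℝ → ℝ} {N : V →ₗ[ℝ] V →ₗ[ℝ] (ℝ → Mat)}
  (ha : Measurable a) (hs : Measurable s)
  (haper : Function.Periodic a 1) (hsper : Function.Periodic s 1)
  (habd : ∀ t, a t ∈ Set.Icc α β)
  (hexp : HasLinftyExpansion (fun h => layered ξ (A h))
    (layered ξ fun t => a t • (1 : Mat)) (fun h => layered ξ fun t => s t • crossMat h)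
    (fun h => layered ξ (N h h)))

include hδ hAM hexp in
lemma matExp_conductivity : MatExp volume (fun h => layered ξ (A h))
    (fun y => layered ξ a y • (1 : Mat)) (fun h y => layered ξ s y • crossMat h)
    (fun h => layered ξ (N h h)) where
  meas := by
    filter_upwards [Metric.ball_mem_nhds 0 hδ] with h hh
    exact aestronglyMeasurable_toOp.2 fun i j => ((hAM h hh).measurable i j).aestronglyMeasurable
  zero := matBdd_iff.1 hexp.bdd0
  one := matLin_of_linearMap (L :=
    { toFun := fun h y => layered ξ s y • crossMat h
      map_add' := fun h k => by ext1 y; simp [crossMat_add]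
      map_smul' := fun c h => by ext1 y; simp [crossMat_smul, smul_comm c] }) hexp.bdd1
  two := matQuad_of_bilinear (B := N.compr₂ (LinearMap.funLeft ℝ Mat fun y : V => inner ℝ ξ y))
    hexp.bdd2
  rem := matRem_iff.2 hexp.remainder

include hexp in
lemma memLp_layered_s : MemLp (layered ξ s) ⊤ volume := by
  have := hexp.bdd1 (EuclideanSpace.single 0 1) 2 1
  change MemLp (fun y => s (inner ℝ ξ y)) ⊤ volume
  simpa [layered, crossMat] using this

include hα ha habd in
lemma memLp_layered_a : MemLp (layered ξ a) ⊤ volume :=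
  memLp_top_of_bound (ha.comp (innerSL ℝ ξ).continuous.measurable).aestronglyMeasurable β
    (.of_forall fun y => by
      rw [layered, Real.norm_of_nonneg (hα.le.trans (habd _).1)]; exact (habd _).2)

include hα hβ hδ hξ hAM hAper ha hs haper hsper habd hexp

/-- The coefficients a and s inherit the periodicity of the lattice from the conductivities, so
every cell average occurring in the general formula becomes an average over one period. -/
lemma exists_isEffectiveHall_layered {P : V → V → Mat}
    (hP : ∀ h ∈ Metric.ball (0 : V) δ, IsCorrector b (layered ξ (A h)) (P h)) :
    (∃ (Rs : Mat) (Ms : V →ₗ[ℝ] V →ₗ[ℝ] Mat),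
      IsEffectiveHall b (fun h => layered ξ (A h)) P Rs Ms) ∧
    ∀ (R : V → Mat) (M : V →ₗ[ℝ] V →ₗ[ℝ] (V → Mat)) (Rs : Mat) (Ms : V →ₗ[ℝ] V →ₗ[ℝ] Mat),
      IsLocalHall (fun h => layered ξ (A h)) R M →
      IsEffectiveHall b (fun h => layered ξ (A h)) P Rs Ms → ∀ h : V,
      gap b (fun h => layered ξ (A h)) P M Ms h =
        (d2 a (hallCoeff a s) * inner ℝ h ξ ^ 2) • (1 - outer ξ ξ) +
        (d1 a (hallCoeff a s) * ‖cross h ξ‖ ^ 2) • outer ξ ξ -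
        (d3 a (hallCoeff a s) * inner ℝ h ξ) •
          (outer (tang ξ h) ξ + outer ξ (tang ξ h)) := by
  have hball := Metric.ball_mem_nhds (0 : V) hδ
  have hS : ∀ᶠ h in 𝓝 (0 : V), MemM α β (layered ξ (A h)) := by
    filter_upwards [hball] with h hh using hAM h hh
  have hE := matExp_conductivity hδ hAM hexp
  have ham : MemLp (layered ξ a) ⊤ volume := memLp_layered_a hα ha habd
  have hsm : MemLp (layered ξ s) ⊤ volume := memLp_layered_s hexp
  have hale : ∀ y, α ≤ layered ξ a y := fun y => (habd _).1
  have hai := memLp_inv_of_le hα hale ham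
  have hs2 := memLp_top_mul hsm hsm
  have ha2 := memLp_top_mul hai hai
  obtain ⟨hab, hsb⟩ := aePeriodic_coefficients hδ hAper hE
  have conv := fun {g : ℝ → ℝ → ℝ} (hg : Measurable fun x : ℝ × ℝ => g x.1 x.2) hL =>
    cellAverage_layered_comp (b := b) (g := g) hξ ha hs haper hsper hab hsb hg hL
  have eff := fun h hh => effCond_eq_laminateCond hα hβ hξ (hAM h hh) (hAper h hh) (hP h hh)
  have hPe : ∀ᶠ h in 𝓝 (0 : V), effCond b (layered ξ (A h)) (P h) =
      laminateCond b ξ (layered ξ (A h)) := by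
    filter_upwards [hball] with h hh using (eff h hh).2
  have ha0 : ∀ t, a t ≠ 0 := fun t => (hα.trans_le (habd t).1).ne'
  have ham0 := (avg_pos hα ha habd).ne'
  have hc0 := inv_ne_zero (avg_inv_pos hα ha habd hβ).ne'
  have eam := conv (g := fun x _ => x) (by fun_prop) ham
  have ec0 := (conv (g := fun x _ => x⁻¹) (by fun_prop) hai).trans (inv_inv _).symm
  have esm := conv (g := fun _ z => z) (by fun_prop) hsm
  have eu := conv (g := fun x z => x⁻¹ * z) (by fun_prop) (memLp_top_mul hai hsm)
  have ev := conv (g := fun x z => x⁻¹ * z ^ 2) (by fun_prop)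
    (by simpa only [pow_two] using memLp_top_mul hai hs2)
  have ev2 := conv (g := fun x z => x⁻¹ ^ 2 * z ^ 2) (by fun_prop)
    (by simpa only [pow_two] using memLp_top_mul ha2 hs2)
  have ev3 := conv (g := fun x z => x⁻¹ ^ 3 * z ^ 2) (by fun_prop)
    (by simpa only [pow_succ, pow_zero, one_mul] using
      memLp_top_mul (memLp_top_mul ha2 hai) hs2)
  refine ⟨exists_isEffectiveHall_laminate hα hβ hξ hS hale ham hsm hE hPe ham0 hc0 eam ec0 esm eu
    ev, fun R M Rs Ms hM hMs h => ?_⟩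
  rw [gap_laminate hα hβ hξ hS hale ham hsm hE hPe ham0 hc0 eam ec0 esm eu ev
    (eff 0 (Metric.mem_ball_self hδ)).1 ev2 ev3 hM hMs h, d1_eq ha0, d2_eq ha0, d3_eq ha0]

end main

end HallLaminate

theorem proposition4p1
    (α β δ : ℝ) (hα : 0 < α) (hβ : 0 < β) (hδ : 0 < δ)
    -- the direction of lamination and the period cell
    (ξ : V) (hξ : ‖ξ‖ = 1) (b : Module.Basis (Fin 3) ℝ V)
    -- the perturbed conductivity `σ(h)(y) = A h (ξ · y)`, for `h` in the ball of radius `δ`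
    (A : V → ℝ → Mat)
    (hAM : ∀ h ∈ Metric.ball (0 : V) δ, MemM α β (layered ξ (A h)))
    (hAper : ∀ h ∈ Metric.ball (0 : V) δ, ∀ (i : Fin 3) (y : V),
      layered ξ (A h) (y + b i) = layered ξ (A h) y)
    -- its expansion `σ(h)(y) = a(ξ · y) I + s(ξ · y) 𝓔(h) + N(h,h)(ξ · y) + o(|h|²)`
    (a s : ℝ → ℝ) (N : V →ₗ[ℝ] V →ₗ[ℝ] (ℝ → Mat))
    (ha : Measurable a) (hs : Measurable s)
    (haper : Function.Periodic a 1) (hsper : Function.Periodic s 1)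
    (habd : ∀ t, a t ∈ Set.Icc α β)
    (hexp : HasLinftyExpansion (fun h => layered ξ (A h))
      (layered ξ fun t => a t • (1 : Mat))
      (fun h => layered ξ fun t => s t • crossMat h)
      (fun h => layered ξ (N h h))) :
    -- the correctors and the local magneto-resistance exist, and the Hall matrix is `r I`
    (∃ P : V → V → Mat, ∀ h ∈ Metric.ball (0 : V) δ, IsCorrector b (layered ξ (A h)) (P h)) ∧
    (∃ M : V →ₗ[ℝ] V →ₗ[ℝ] (V → Mat), IsLocalHall (fun h => layered ξ (A h))
      (layered ξ fun t => hallCoeff a s t • (1 : Mat)) M) ∧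
    ∀ P : V → V → Mat,
      (∀ h ∈ Metric.ball (0 : V) δ, IsCorrector b (layered ξ (A h)) (P h)) →
      -- the effective resistivity has a second-order expansion
      (∃ (Rs : Mat) (Ms : V →ₗ[ℝ] V →ₗ[ℝ] Mat),
        IsEffectiveHall b (fun h => layered ξ (A h)) P Rs Ms) ∧
      ∀ (R : V → Mat) (M : V →ₗ[ℝ] V →ₗ[ℝ] (V → Mat))
        (Rs : Mat) (Ms : V →ₗ[ℝ] V →ₗ[ℝ] Mat),
        IsLocalHall (fun h => layered ξ (A h)) R M →
        IsEffectiveHall b (fun h => layered ξ (A h)) P Rs Ms →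
        ∀ h : V,
          let D : Mat := gap b (fun h => layered ξ (A h)) P M Ms h
          let r : ℝ → ℝ := hallCoeff a s
          let p : ℝ := inner ℝ h ξ
          let q : ℝ := ‖cross h ξ‖
          -- `h` not parallel to `ξ`
          (¬ Parallel h ξ →
            Orthonormal ℝ (adaptedBasis ξ h) ∧
            (colMat (adaptedBasis ξ h))ᵀ * D * colMat (adaptedBasis ξ h) =
              !![d1 a r * q ^ 2, d3 a r * p * q, 0;
                 d3 a r * p * q, d2 a r * p ^ 2, 0;
                 0, 0, d2 a r * p ^ 2]) ∧
          -- `h` parallel to `ξ`, in any orthonormal basis `(ξ, u, v)`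
          (Parallel h ξ → ∀ u v : V, Orthonormal ℝ ![ξ, u, v] →
            (colMat ![ξ, u, v])ᵀ * D * colMat ![ξ, u, v] =
              (d2 a r * p ^ 2) • (!![0, 0, 0; 0, 1, 0; 0, 0, 1] : Mat)) ∧
          -- the cases of equality
          (D = 0 ↔
            h = 0 ∨
            (h ≠ 0 ∧ inner ℝ h ξ = 0 ∧ IsConst r) ∨
            (h ≠ 0 ∧ Parallel h ξ ∧ IsConst fun t => a t * r t) ∨
            (h ≠ 0 ∧ ¬ Parallel h ξ ∧ inner ℝ h ξ ≠ 0 ∧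
              (IsConst fun t => a t * r t) ∧ IsConst r)) := by

  have hξ0 : ξ ≠ 0 := by rintro rfl; simp at hξ
  have hball := Metric.ball_mem_nhds (0 : V) hδ
  have hE := matExp_conductivity hδ hAM hexp
  have ham : MemLp (layered ξ a) ⊤ volume := memLp_layered_a hα ha habd
  obtain ⟨C, hC⟩ := exists_bound_of_layered hξ0 hs (memLp_layered_s hexp)
  refine ⟨⟨fun h => laminateGrad b ξ (layered ξ (A h)), fun h hh =>
    isCorrector_laminateGrad hα hβ hξ (hAM h hh) (hAper h hh)⟩,
    exists_isLocalHall hα (by filter_upwards [hball] with h hh using hAM h hh)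
      (fun y => (habd _).1) ham hE fun y => rfl, fun P hP => ?_⟩
  obtain ⟨h1, h2⟩ := exists_isEffectiveHall_layered hα hβ hδ hξ hAM hAper ha hs haper hsper habd
    hexp hP
  refine ⟨h1, fun R M Rs Ms hM hMs h => ?_⟩
  intro D r p q
  have hD : D = (d2 a r * p ^ 2) • (1 - outer ξ ξ) + (d1 a r * q ^ 2) • outer ξ ξ -
      (d3 a r * p) • (outer (tang ξ h) ξ + outer ξ (tang ξ h)) := h2 R M Rs Ms hM hMs h
  have hd1 : d1 a r = 0 ↔ IsConst r := d1_eq_zero_iff hα ha habd hs haper hsper hC hβ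
  have hd2 : d2 a r = 0 ↔ IsConst fun t => a t * r t :=
    d2_eq_zero_iff hα ha habd hs haper hsper hC
  have hd3 : (IsConst fun t => a t * r t) → d3 a r = 0 := d3_eq_zero hα ha habd
  have hpar : Parallel h ξ ↔ q = 0 := (parallel_iff hξ).trans norm_eq_zero.symm
  -- From here on, only the closed formula for `D` and the criteria for the vanishing of the
  -- coefficients matter.
  clear_value D r
  rw [hD]
  refine ⟨fun hh => ⟨orthonormal_adaptedBasis hξ hh, ?_⟩, fun hh u v huv => ?_, ?_⟩
  · have ho := orthonormal_iff_ite.1 (orthonormal_adaptedBasis hξ hh)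
    ext i j
    rw [colMat_gap, ho, inner_adaptedBasis_self hξ, inner_adaptedBasis_self hξ,
      inner_adaptedBasis_tang hξ, inner_adaptedBasis_tang hξ]
    fin_cases i <;> fin_cases j <;> simp [q, p]
  · have ho := orthonormal_iff_ite.1 huv
    have hx : ∀ i, inner ℝ (![ξ, u, v] i) ξ = if i = 0 then 1 else 0 := fun i => ho i 0
    ext i j
    rw [colMat_gap, ho, hx, hx, tang_eq_zero hξ hh, hpar.1 hh, inner_zero_right, inner_zero_right]
    fin_cases i <;> fin_cases j <;> simp
  · constructor
    · intro h0
      obtain ⟨e1, e2⟩ := gap_eq_zero_imp hξ h0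
      by_cases hz : h = 0
      · exact Or.inl hz
      by_cases hh : Parallel h ξ
      -- A parallel `h` equals `p • ξ`, so `p = 0` would force `h = 0`.
      · have hp : p ≠ 0 := fun hp0 => hz (by
          have := tang_eq_zero hξ hh
          rw [tang, sub_eq_zero] at this
          rw [this, show inner ℝ h ξ = 0 from hp0, zero_smul])
        exact Or.inr (Or.inr (Or.inl ⟨hz, hh, hd2.1 (by simpa [hp] using e1)⟩))
      · have hq : q ≠ 0 := fun hq0 => hh (hpar.2 hq0)
        have hr : IsConst r := hd1.1 (by simpa [hq] using e2)
        by_cases hp : p = 0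
        · exact Or.inr (Or.inl ⟨hz, hp, hr⟩)
        · exact Or.inr (Or.inr (Or.inr ⟨hz, hh, hp, hd2.1 (by simpa [hp] using e1), hr⟩))
    · rintro (hz | ⟨-, hp, hr⟩ | ⟨-, hh, har⟩ | ⟨-, -, -, har, hr⟩)
      · have hp : p = 0 := by simp [p, hz]
        have hq : q = 0 := hpar.1 ⟨0, by simp [hz]⟩
        simp [hp, hq]
      · have hp' : p = 0 := hp
        simp [hp', hd1.2 hr]
      · simp [hd2.2 har, hpar.1 hh, tang_eq_zero hξ hh, outer_zero_left, outer_zero_right]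
      · simp [hd1.2 hr, hd2.2 har, hd3 har]
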